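/- **Setting.** Let $G=(V,E)$ be a finite undirected graph, $s\in V$ a source, $t\ge 0$ an integer; $dist$ is the graph distance ($\infty$ if there is no path). For every $j\in\{0,\dots,t+6\}$ a $2^j$-cover is given: finitely many clusters (sets of nodes) such that any two nodes at distance at most $2^j$ lie in a common cluster. Each cluster $C$ comes with a rooted tree in $G$ that spans $C$ (and may use further nodes); every node knows its clusters and its parent and children in the trees. The network is asynchronous: nodes react to arriving messages and to their own state, messages travel along edges with arbitrary finite delays, different nodes and different procedures interleave arbitrarily, and messages of the same procedure sent over the same edge in the same direction arrive in the order of sending. Every message is eventually delivered and every enabled local action is eventually performed. **Pulses.** For $p>0$ let $\ell(p)$ be the exponent of the largest power of $2$ dividing $p$, and let $prev(p)$ be the largest positive integer $q\le p-2^{\ell(p)}$ with $\ell(q)=\ell(p)+1$, or $0$ if there is none; $prev(0)=0$. **Algorithm.** Initially $pulse(s)=0$ and no other node has a pulse. A node sends a "join" proposal to all its neighbours when it is $s$, or when its pulse $k$ satisfies $0<k<2^t$ and it has received $Go\_Ahead(k)$. A node without a pulse that receives a proposal from $u$ accepts it, sets $parent(v)=u$, $pulse(v)=pulse(u)+1$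 and outputs this pulse; every other proposal is declined. The edges $(v,parent(v))$ form the execution tree. A node is *$p$-empty* if its subtree has no node of pulse $p$, and *$p$-safe* if it is $p$-empty or all nodes of pulse at most $p-1$ in its subtree have sent their proposals and received all answers. For $0<p\le 2^t$, nodes learn by a convergecast in the execution tree (from nodes of pulse at most $p$ up to nodes of pulse $prev(prev(p))$) whether they are $p$-empty and when they are $p$-safe. For every $0<p\le 2^t$, a node $v$ with $pulse(v)=prev(prev(p))$ does the following, where "its clusters" are the clusters of the $2^{\ell(p)+5}$-cover that contain $v$: - When $v$ knows that it is $prev(p)$-safe and not $prev(p)$-empty, it $p$-registers in all its clusters; only after all these registrations are confirmed does it pass the information that it is $prev(p)$-safe to its parent. - When it is $p$-registered and knows that it is $p$-safe, it $p$-deregisters in all its clusters, and waits for a Go-Ahead from each of them. - After that, it sends $Go\_Ahead(p)$ down the execution tree to all its descendants of pulse $p$. *Registration in a cluster tree* (separately for each $p$ and each cluster). Tree edges carry marks *clean* (initially), *dirty* or *waiting*; a node may be *finished*, and the root always is. Procedure $\mathcal R(u)$: if $u$ is finished, it is over; otherwise, unless it is already in progress at $u$ (then the invocations are merged), $u$ marks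 the edge to its parent dirty, invokes $\mathcal R$ at the parent, and when this is over, $u$ becomes finished and notifies the children that invoked it. To register, $v$ runs $\mathcal R(v)$ and is registered when it is over. To deregister, $v$ is marked deregistered and invokes $\mathcal D(v)$. Procedure $\mathcal D(u)$: stop if some edge to a child is dirty or $u$ is registered; otherwise, if $u$ is not the root, change the edge to the parent from dirty to waiting, make $u$ not finished, and invoke $\mathcal D$ at the parent; if $u$ is the root, issue a Go-Ahead. A Go-Ahead that reaches a deregistered node frees it (this is the Go-Ahead it was waiting for), and moves on to all children along waiting edges, which become clean. *Checking stage.* Every node $v\ne s$ is done at the start, and $s$ is done when it knows that it is $2^t$-safe. In each cluster of the $2^t$-cover, a convergecast to the root of the cluster tree collects that all nodes of the tree are done, and then the root broadcasts this. A node without a pulse that has received this confirmation from all clusters of the $2^t$-cover containing it outputs $\infty$ (it has learned that $dist(v,s)>2^t$). **Lemma.** In every execution, this algorithm computes a $2^t$-thresholded BFS from $s$. For every node $v$ with $dist(v,s)\le 2^t$, $v$ eventually has a pulse, $pulse(v)=dist(v,s)$, and $v$ outputs it; the execution tree is a BFS tree: it consists of these nodes, and for $v\neq s$ in it, $parent(v)$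 is a neighbour of $v$ with $dist(v,s)=dist(parent(v),s)+1$. Every node $v$ with $dist(v,s)>2^t$ never gets a pulse and eventually outputs $\infty$, i.e. learns that its distance exceeds $2^t$. At no time does any node hold a pulse or an output that is wrong. -/

import Mathlib

noncomputable section

open scoped Classical

/-! ## Asynchronous message passing

A node reacts to the arrival of a message (`recv`) and may perform enabled internal actions (`act`);
in both cases it changes its own state only and hands messages to the links to its neighbours.
Every link direction carries one first-in-first-out queue per procedure (`proc`); apart from that,
delays and the interleaving of all events are arbitrary. -/

structure AsyncAlgorithm (V P M S A : Type*) where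
  /-- the procedure that a message belongs to -/
  proc : M → P
  init : V → S
  /-- `recv v w m x`: what node `v` in state `x` does when it receives `m` from `w` -/
  recv : V → V → M → S → S × (V → List M)
  /-- `act v a x`: the internal action `a` of node `v` in state `x`; `none` if it is not enabled -/
  act : V → A → S → Option (S × (V → List M))

namespace AsyncAlgorithm

structure Config (V P M S : Type*) where
  state : V → S
  /-- `chan u v π`: messages of procedure `π` on their way from `u` to `v`, oldest first -/
  chan : V → V → P → List M

inductive Event (V P A : Type*) where
  | deliver (u v : V) (π : P)
  | internal (v : V) (a : A)

variable {V P M S A : Type*}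

def initial (alg : AsyncAlgorithm V P M S A) : Config V P M S where
  state := alg.init
  chan := fun _ _ _ => []

/-- Node `v` enters the state `x` and sends the messages `out w` to each neighbour `w`. -/
def commit (G : SimpleGraph V) (alg : AsyncAlgorithm V P M S A) (v : V)
    (r : S × (V → List M)) (c : Config V P M S) : Config V P M S where
  state := Function.update c.state v r.1
  chan := fun a b π =>
    if a = v ∧ G.Adj a b then c.chan a b π ++ (r.2 b).filter (fun m => decide (alg.proc m = π))
    else c.chan a b π

/-- The effect of an event; `none` if the event is not possible. -/
def step (G : SimpleGraph V) (alg : AsyncAlgorithm V P M S A) (c : Config V P M S) :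
    Event V P A → Option (Config V P M S)
  | .deliver u v π =>
    match c.chan u v π with
    | [] => none
    | m :: rest =>
      some (commit G alg v (alg.recv v u m (c.state v))
        { c with
          chan := fun a b ρ => if a = u ∧ b = v ∧ ρ = π then rest else c.chan a b ρ })
  | .internal v a => (alg.act v a (c.state v)).map (fun r => commit G alg v r c)

/-- An infinite run from the initial configuration. At each time one event happens, or nothing
does. Fairness: no event stays possible forever without happening, i.e. every message is delivered
eventually and every enabled internal action is performed eventually. -/
structure IsFairExecution (G : SimpleGraph V) (alg : AsyncAlgorithm V P M S A)
    (σ : ℕ → Config V P M S) : Prop where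
  start : σ 0 = alg.initial
  next : ∀ n, σ (n + 1) = σ n ∨ ∃ e, step G alg (σ n) e = some (σ (n + 1))
  fair : ∀ e n, ∃ m, n ≤ m ∧
    (step G alg (σ m) e = none ∨ step G alg (σ m) e = some (σ (m + 1)))

end AsyncAlgorithm

namespace PulseBFS

/-! ## Clusters and covers -/

/-- A cluster with a rooted tree in `G` that spans it (the tree may use further nodes). -/
structure Cluster {V : Type*} (G : SimpleGraph V) where
  members : Set V
  /-- the nodes of the cluster tree -/
  nodes : Set V
  root : V
  /-- tree parent; only used at nodes of the tree other than the root -/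
  parent : V → V
  members_subset : members ⊆ nodes
  root_mem : root ∈ nodes
  parent_mem : ∀ v ∈ nodes, v ≠ root → parent v ∈ nodes
  parent_adj : ∀ v ∈ nodes, v ≠ root → G.Adj v (parent v)
  reaches_root : ∀ v ∈ nodes, ∃ k, parent^[k] v = root

def Cluster.IsChild {V : Type*} {G : SimpleGraph V} (T : Cluster G) (u w : V) : Prop :=
  w ∈ T.nodes ∧ w ≠ T.root ∧ T.parent w = u

/-- For every `j ≤ J`, the clusters `c` with `level c = j` form a `2 ^ j`-cover of `G`. -/
structure LayeredCover {V : Type*} (G : SimpleGraph V) (κ : Type*) (J : ℕ) where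
  level : κ → ℕ
  cluster : κ → Cluster G
  covers : ∀ j ≤ J, ∀ u v : V, G.edist u v ≤ ((2 ^ j : ℕ) : ℕ∞) →
    ∃ c, level c = j ∧ u ∈ (cluster c).members ∧ v ∈ (cluster c).members

/-! ## Pulses -/

/-- The level of a positive pulse: the exponent of the largest power of `2` that divides it.
(Never used at pulse `0`.) -/
def level (p : ℕ) : ℕ := padicValNat 2 p

/-- The largest positive `q ≤ p - 2 ^ level p` of level `level p + 1`, and `0` if there is none. -/
def prev (p : ℕ) : ℕ :=
  if p = 0 then 0
  else Nat.findGreatest (fun q => 0 < q ∧ level q = level p + 1) (p - 2 ^ level p)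

/-! ## Registration in one cluster tree -/

inductive RegStatus where
  | idle
  | registering
  | registered
  | deregistered
  | free

inductive Mark where
  | clean
  | dirty
  | waiting

/-- `invoke`: the edge to the parent has become dirty, and the registration procedure is invoked at
the parent; `done`: answer to `invoke`; `cancel`: the edge to the parent has changed from dirty to
waiting, and the deregistration procedure is invoked at the parent; `go`: a Go-Ahead on its way
down the tree. -/
inductive RegSignal where
  | invoke
  | done
  | cancel
  | go

/-- What a node stores for one registration process in one cluster tree. -/
structure RegState (V : Type*) where
  status : RegStatus
  /-- the edge to the tree parent is dirty -/
  dirtyUp : Bool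
  /-- the node knows that all edges from it to the root are dirty -/
  finished : Bool
  /-- the marks of the edges to the tree children -/
  mark : V → Mark
  /-- the tree children that wait for a `done` -/
  callers : V → Bool

namespace RegState

variable {V : Type*} {G : SimpleGraph V}

def start (T : Cluster G) (u : V) : RegState V where
  status := .idle
  dirtyUp := false
  finished := decide (u = T.root)
  mark := fun _ => .clean
  callers := fun _ => false

def complete (x : RegState V) : RegState V × (V → List RegSignal) :=
  ({ x with
      finished := true
      status := if x.status = .registering then .registered else x.status
      callers := fun _ => false },
    fun w => if x.callers w = true then [.done] else [])

/-- The registration procedure at `u`. If it is invoked while a previous invocation at `u` is still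
waiting for the parent, it joins that one. -/
def runRegister (T : Cluster G) (u : V) (x : RegState V) : RegState V × (V → List RegSignal) :=
  if x.finished = true then x.complete
  else if x.dirtyUp = true then (x, fun _ => [])
  else ({ x with dirtyUp := true }, fun w => if w = T.parent u then [.invoke] else [])

/-- A Go-Ahead at a node: it frees the node if this has deregistered, and moves on through the
waiting edges, which thereby stop waiting. -/
def runGo (x : RegState V) : RegState V × (V → List RegSignal) :=
  ({ x with
      status := if x.status = .deregistered then .free else x.status
      mark := fun w => if x.mark w = .waiting then .clean else x.mark w },
    fun w => if x.mark w = .waiting then [.go] else [])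

/-- The deregistration procedure at `u`. The root issues a Go-Ahead when no edge to a child is
dirty and the root itself is not registered. -/
def runDeregister (T : Cluster G) (u : V) (x : RegState V) : RegState V × (V → List RegSignal) :=
  if (∃ w, x.mark w = .dirty) ∨ x.status = .registered then (x, fun _ => [])
  else if u = T.root then x.runGo
  else ({ x with dirtyUp := false, finished := false },
    fun w => if w = T.parent u then [.cancel] else [])

def register (T : Cluster G) (u : V) (x : RegState V) : RegState V × (V → List RegSignal) :=
  runRegister T u { x with status := .registering }

def deregister (T : Cluster G) (u : V) (x : RegState V) : RegState V × (V → List RegSignal) :=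
  runDeregister T u { x with status := .deregistered }

/-- Reaction of `u` to a signal from its neighbour `w` in the tree. -/
def receive (T : Cluster G) (u w : V) (x : RegState V) :
    RegSignal → RegState V × (V → List RegSignal)
  | .invoke => runRegister T u
      { x with
        mark := Function.update x.mark w .dirty
        callers := Function.update x.callers w true }
  | .done => x.complete
  | .cancel => runDeregister T u { x with mark := Function.update x.mark w .waiting }
  | .go => x.runGo

end RegState

/-! ## The thresholded BFS algorithm -/

inductive Msg (κ : Type*) where
  /-- join proposal of a node of pulse `k` -/
  | join (k : ℕ)
  | answer (accept : Bool)
  /-- the sender is `p`-empty (`empty = true`), or `p`-safe and not `p`-empty -/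
  | report (p : ℕ) (empty : Bool)
  /-- Go-Ahead for pulse `p`, on its way down the execution tree -/
  | goAhead (p : ℕ)
  /-- registration for pulse `p` in the cluster `c` -/
  | reg (p : ℕ) (c : κ) (sig : RegSignal)
  | checkUp (c : κ)
  | checkDown (c : κ)

inductive Proc (κ : Type*) where
  | search
  | safety (p : ℕ)
  | release (p : ℕ)
  | reg (p : ℕ) (c : κ)
  | check (c : κ)

def Msg.proc {κ : Type*} : Msg κ → Proc κ
  | .join _ => .search
  | .answer _ => .search
  | .report p _ => .safety p
  | .goAhead p => .release p
  | .reg p c _ => .reg p c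
  | .checkUp c => .check c
  | .checkDown c => .check c

structure NodeState (V κ : Type*) where
  pulse : Option ℕ
  /-- parent in the execution tree -/
  parent : Option V
  /-- the output of the node; `⊤` stands for the special symbol `∞` -/
  output : Option ℕ∞
  /-- the node has sent its join proposals -/
  sent : Bool
  /-- answers to these proposals; `some true` means accepted -/
  answer : V → Option Bool
  /-- reports received: `report w p = some e` if `w` has reported `e` for pulse `p` -/
  report : V → ℕ → Option Bool
  /-- the pulses for which the node has reported to its parent -/
  reported : ℕ → Bool
  /-- the pulses for which the node has the Go-Ahead -/
  go : ℕ → Bool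
  reg : ℕ → κ → RegState V
  /-- checking stage: the tree children that have reported the end of the process below them -/
  checkedChild : κ → V → Bool
  checkSent : κ → Bool
  /-- checking stage: the whole cluster is known to be done -/
  confirmed : κ → Bool

inductive Act (κ : Type*) where
  | propose
  | report (p : ℕ)
  | register (p : ℕ) (c : κ)
  | deregister (p : ℕ) (c : κ)
  | release (p : ℕ)
  | checkUp (c : κ)
  | checkRoot (c : κ)
  | conclude

namespace NodeState

variable {V κ : Type*} {G : SimpleGraph V} {J : ℕ}

def IsExecChild (x : NodeState V κ) (w : V) : Prop := x.answer w = some true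

/-- Node `u` knows that it is `p`-safe (possibly because it is `p`-empty): its pulse is `p`, or its
pulse is smaller, all its proposals are answered, and all its children in the execution tree have
reported for `p`. -/
def KnowsSafe (G : SimpleGraph V) (u : V) (x : NodeState V κ) (p : ℕ) : Prop :=
  ∃ k, x.pulse = some k ∧
    (k = p ∨
      k < p ∧ x.sent = true ∧ (∀ w, G.Adj u w → x.answer w ≠ none) ∧
        ∀ w, x.IsExecChild w → x.report w p ≠ none)

/-- Node `u` knows that it is `p`-empty. -/
def KnowsEmpty (G : SimpleGraph V) (u : V) (x : NodeState V κ) (p : ℕ) : Prop :=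
  x.KnowsSafe G u p ∧ x.pulse ≠ some p ∧ ∀ w, x.IsExecChild w → x.report w p = some true

/-- The clusters of the `2 ^ (level p + 5)`-cover that contain `u`. -/
def RegCluster (L : LayeredCover G κ J) (u : V) (p : ℕ) (c : κ) : Prop :=
  L.level c = level p + 5 ∧ u ∈ (L.cluster c).members

/-- Node `u` has received the confirmation of all its `p`-registrations. -/
def IsRegistered (L : LayeredCover G κ J) (u : V) (x : NodeState V κ) (p : ℕ) : Prop :=
  ∀ c, RegCluster L u p c → (x.reg p c).status ≠ .idle ∧ (x.reg p c).status ≠ .registering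

/-- Replace the registration state for `(p, c)` and send the signals that belong to it. -/
def withReg (x : NodeState V κ) (p : ℕ) (c : κ) (r : RegState V × (V → List RegSignal)) :
    NodeState V κ × (V → List (Msg κ)) :=
  ({ x with reg := Function.update x.reg p (Function.update (x.reg p) c r.1) },
    fun w => (r.2 w).map (Msg.reg p c))

/-- Obtain the Go-Ahead for `p`, and pass it on to the children unless one's own pulse is `p`. -/
def takeGoAhead (x : NodeState V κ) (p : ℕ) : NodeState V κ × (V → List (Msg κ)) :=
  ({ x with go := Function.update x.go p true },
    fun w => if (∃ k, x.pulse = some k ∧ k < p) ∧ x.IsExecChild w then [.goAhead p] else [])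

/-- The whole cluster `c` is done; tell the tree children. -/
def takeConfirmation (L : LayeredCover G κ J) (u : V) (x : NodeState V κ) (c : κ) :
    NodeState V κ × (V → List (Msg κ)) :=
  ({ x with confirmed := Function.update x.confirmed c true },
    fun w => if (L.cluster c).IsChild u w then [.checkDown c] else [])

/-- In the checking stage of threshold `2 ^ t`, the part of the tree of `c` below and including `u`
is done: all nodes other than the source are done from the beginning, and the source is done when
it knows that it is `2 ^ t`-safe. -/
def SubtreeDone (G : SimpleGraph V) (s : V) (t : ℕ) (L : LayeredCover G κ J) (u : V)
    (x : NodeState V κ) (c : κ) : Prop :=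
  L.level c = t ∧ u ∈ (L.cluster c).nodes ∧ (u = s → x.KnowsSafe G u (2 ^ t)) ∧
    ∀ w, (L.cluster c).IsChild u w → x.checkedChild c w = true

end NodeState

open NodeState

variable {V κ : Type*} {J : ℕ}

def initState (G : SimpleGraph V) (s : V) (L : LayeredCover G κ J) (u : V) : NodeState V κ where
  pulse := if u = s then some 0 else none
  parent := none
  output := if u = s then some 0 else none
  sent := false
  answer := fun _ => none
  report := fun _ _ => none
  reported := fun _ => false
  go := fun _ => false
  reg := fun _ c => RegState.start (L.cluster c) u
  checkedChild := fun _ _ => false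
  checkSent := fun _ => false
  confirmed := fun _ => false

/-- Reaction of node `u` to a message from `w`. -/
def onReceive (G : SimpleGraph V) (L : LayeredCover G κ J) (u w : V) (m : Msg κ)
    (x : NodeState V κ) : NodeState V κ × (V → List (Msg κ)) :=
  match m with
  | .join k =>
    if x.pulse = none then
      ({ x with pulse := some (k + 1), parent := some w, output := some ((k + 1 : ℕ) : ℕ∞) },
        fun z => if z = w then [.answer true] else [])
    else (x, fun z => if z = w then [.answer false] else [])
  | .answer b => ({ x with answer := Function.update x.answer w (some b) }, fun _ => [])
  | .report p e =>
    ({ x with report := Function.update x.report w (Function.update (x.report w) p (some e)) },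
      fun _ => [])
  | .goAhead p => x.takeGoAhead p
  | .reg p c sig => x.withReg p c ((x.reg p c).receive (L.cluster c) u w sig)
  | .checkUp c =>
    ({ x with
        checkedChild :=
          Function.update x.checkedChild c (Function.update (x.checkedChild c) w true) },
      fun _ => [])
  | .checkDown c => takeConfirmation L u x c

/-- The internal actions of node `u`. -/
def onAct (G : SimpleGraph V) (s : V) (t : ℕ) (L : LayeredCover G κ J) (u : V) (a : Act κ)
    (x : NodeState V κ) : Option (NodeState V κ × (V → List (Msg κ))) :=
  match a with
  | .propose =>
    -- The source proposes unconditionally, a node of pulse `k > 0` needs the Go-Ahead for `k`;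
    -- nodes of pulse `2 ^ t` do not propose.
    match x.pulse with
    | none => none
    | some k =>
      if x.sent = false ∧ k < 2 ^ t ∧ (k = 0 ∨ x.go k = true) then
        some ({ x with sent := true }, fun w => if G.Adj u w then [.join k] else [])
      else none
  | .report p =>
    -- The status for `p` is collected up to pulse `prev (prev p)`. A node of pulse `prev p` that is
    -- not `p`-empty first waits for its `q`-registrations, for all `q` with `prev q = p`.
    if x.reported p = false ∧ p ≤ 2 ^ t ∧
        (∃ k, x.pulse = some k ∧ prev (prev p) < k ∧ k ≤ p) ∧ x.KnowsSafe G u p ∧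
        (x.KnowsEmpty G u p ∨
          ∀ q, 0 < q → q ≤ 2 ^ t → prev q = p → x.pulse = some (prev (prev q)) →
            x.IsRegistered L u q) then
      some ({ x with reported := Function.update x.reported p true },
        fun w => if x.parent = some w then [.report p (decide (x.KnowsEmpty G u p))] else [])
    else none
  | .register p c =>
    if 0 < p ∧ p ≤ 2 ^ t ∧ x.pulse = some (prev (prev p)) ∧ RegCluster L u p c ∧
        (x.reg p c).status = .idle ∧
        x.KnowsSafe G u (prev p) ∧ ¬ x.KnowsEmpty G u (prev p) then
      some (x.withReg p c ((x.reg p c).register (L.cluster c) u))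
    else none
  | .deregister p c =>
    if 0 < p ∧ p ≤ 2 ^ t ∧ x.pulse = some (prev (prev p)) ∧ RegCluster L u p c ∧
        (x.reg p c).status = .registered ∧ x.IsRegistered L u p ∧ x.KnowsSafe G u p then
      some (x.withReg p c ((x.reg p c).deregister (L.cluster c) u))
    else none
  | .release p =>
    if 0 < p ∧ p ≤ 2 ^ t ∧ x.pulse = some (prev (prev p)) ∧ x.go p = false ∧
        ∀ c, RegCluster L u p c → (x.reg p c).status = .free then
      some (x.takeGoAhead p)
    else none
  | .checkUp c =>
    if SubtreeDone G s t L u x c ∧ u ≠ (L.cluster c).root ∧ x.checkSent c = false then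
      some ({ x with checkSent := Function.update x.checkSent c true },
        fun w => if w = (L.cluster c).parent u then [.checkUp c] else [])
    else none
  | .checkRoot c =>
    if SubtreeDone G s t L u x c ∧ u = (L.cluster c).root ∧ x.confirmed c = false then
      some (takeConfirmation L u x c)
    else none
  | .conclude =>
    if x.pulse = none ∧ x.output = none ∧
        ∀ c, L.level c = t → u ∈ (L.cluster c).members → x.confirmed c = true then
      some ({ x with output := some ⊤ }, fun _ => [])
    else none

/-- The pulse-based algorithm for the `2 ^ t`-thresholded BFS from `s`, given a layered cover. -/
def algorithm (G : SimpleGraph V) (s : V) (t : ℕ) (L : LayeredCover G κ J) :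
    AsyncAlgorithm V (Proc κ) (Msg κ) (NodeState V κ) (Act κ) where
  proc := Msg.proc
  init := initState G s L
  recv := onReceive G L
  act := onAct G s t L

/-- What node `v` has to output in the `τ`-thresholded BFS from `s`. -/
def thresholdedDist (G : SimpleGraph V) (s : V) (τ : ℕ) (v : V) : ℕ∞ :=
  if G.edist v s ≤ (τ : ℕ∞) then G.edist v s else ⊤

end PulseBFS

end

noncomputable section

open scoped Classical

set_option linter.unusedSimpArgs false

namespace PulseBFS

section

open Filter

/-! ## Cluster trees -/

namespace Cluster

variable {V : Type*} {G : SimpleGraph V} (T : Cluster G)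

/-! Safety. A pulse can only be wrong if a node `u` of pulse `p` proposes to a neighbour `v` whose
distance is at most `p` but which has no pulse yet. `exec_correct` rules this out by induction on
time. Write l for `level p`. By `exec_covered`, once `u` has the Go-Ahead for `p`, every node at
distance `prev (prev p)` from the source and within `23 * 2 ^ l` of `u` is known to itself to be
`p`-safe or `prev p`-empty. Such a node has all its answers, so its neighbours have pulses, and its
tree children inherit the property. `Correct.ball` spreads this outwards one distance at a time,
until `v` itself is seen to have had a pulse already.

`exec_covered` is a strong induction on `p`. The Go-Ahead comes from an ancestor `a` of pulse `prev
(prev p)`, which is at most `9 * 2 ^ l` away by `le_prev_prev_add`; as 9 + 23 = 32, `a` shares a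
cluster of the `2 ^ (l + 5)`-cover with each node `b` in question. At a time when `a` was still
registered there but already `p`-safe, the ancestor of `u` of pulse `prev p` had its own Go-Ahead.
The induction hypothesis around that ancestor, whose radius is twice as large, shows that `b` had by
then reported for `prev p`, and a node that is not `prev p`-empty reports only after registering. By
`IsRegRun.not_free`, `a` is not freed before `b` deregisters, and `b` deregisters only when it is
`p`-safe.

The registration protocol is studied for one pulse and one cluster in isolation, through the
invariant `RegInv`. A registered node is `finished`, hence every edge from it to the root is dirty;
the root issues no Go-Ahead while it sees a dirty edge or is registered itself, and no Go-Ahead is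
in transit on the path above a finished node.

Liveness. `exec_progress` is a strong induction on the pulse `p`. Nodes at distance `p` are reached
because their neighbours at distance `p - 1` have all answers; the knowledge of `p`-safety climbs
the execution tree to pulse `prev (prev p)`; then all registrations for `p` end in deregistrations,
every cluster tree becomes quiet, and the Go-Aheads descend. There is no deadlock: `p`-safety
concerns answers to nodes of pulse below `p` only, and the registrations for which a report for `p`
waits come to an end by themselves.

Finally, a node outputs infinity only after a cluster containing both it and the source (if it is
within the threshold) has confirmed that the source is `2 ^ t`-safe. Then all nodes within the
threshold already have pulses, so this output is correct; and the source does become safe, so all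
nodes produce an output. -/

/-- Distance to the root in the cluster tree. -/
def depth (v : V) : ℕ := sInf {k | T.parent^[k] v = T.root}

variable {T}

theorem IsChild.parent_mem {u w : V} (h : T.IsChild u w) : u ∈ T.nodes :=
  h.2.2 ▸ T.parent_mem w h.1 h.2.1

theorem IsChild.adj {u w : V} (h : T.IsChild u w) : G.Adj u w :=
  (h.2.2 ▸ T.parent_adj w h.1 h.2.1).symm

theorem IsChild.depth_eq {u w : V} (h : T.IsChild u w) : T.depth w = T.depth u + 1 := by
  have hu : T.parent^[T.depth u] u = T.root :=
    Nat.sInf_mem (s := {k | T.parent^[k] u = T.root}) (T.reaches_root u h.parent_mem)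
  have hw : T.parent^[T.depth w] w = T.root :=
    Nat.sInf_mem (s := {k | T.parent^[k] w = T.root}) (T.reaches_root w h.1)
  have h1 : T.depth w ≤ T.depth u + 1 := by
    apply Nat.sInf_le
    simp only [Set.mem_ofPred_eq, Function.iterate_succ, Function.comp]
    rw [h.2.2, hu]
  have h2 : T.depth w ≠ 0 := by
    intro h0
    rw [h0] at hw
    exact h.2.1 hw
  obtain ⟨k, hk⟩ := Nat.exists_eq_succ_of_ne_zero h2
  have h3 : T.depth u ≤ k := by
    apply Nat.sInf_le
    simp only [Set.mem_ofPred_eq]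
    rw [hk] at hw
    simpa [h.2.2] using hw
  omega

/-- Depth grows by one along tree edges. This separates the upward from the downward channel of an
edge, so that the situation of one edge is not disturbed by signals meant for another. -/
theorem IsChild.not_symm {u w : V} (h : T.IsChild u w) : ¬ T.IsChild w u := by
  intro h'
  have := h.depth_eq
  have := h'.depth_eq
  omega

theorem isChild_parent {w : V} (h : w ∈ T.nodes) (hr : w ≠ T.root) : T.IsChild (T.parent w) w :=
  ⟨h, hr, rfl⟩

/-- Induction from the root of a cluster tree downwards. -/
theorem induction_down {P : V → Prop} (hroot : P T.root)
    (hstep : ∀ u w, T.IsChild u w → P u → P w) : ∀ v ∈ T.nodes, P v := by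
  have key : ∀ d, ∀ v ∈ T.nodes, T.depth v = d → P v := by
    intro d
    induction d with
    | zero =>
      intro v hv hd
      by_cases hr : v = T.root
      · rw [hr]; exact hroot
      · have := (isChild_parent hv hr).depth_eq
        omega
    | succ d ih =>
      intro v hv hd
      by_cases hr : v = T.root
      · rw [hr]; exact hroot
      · have hc := isChild_parent hv hr
        have := hc.depth_eq
        exact hstep _ _ hc (ih _ hc.parent_mem (by omega))
  exact fun v hv => key _ v hv rfl

/-- Induction from the leaves of a finite cluster tree upwards. -/
theorem induction_up [Finite V] {P : V → Prop}
    (hstep : ∀ u ∈ T.nodes, (∀ w, T.IsChild u w → P w) → P u) : ∀ v ∈ T.nodes, P v := by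
  obtain ⟨B, hB⟩ := (Set.finite_range T.depth).bddAbove
  have hB' : ∀ v, T.depth v ≤ B := fun v => hB ⟨v, rfl⟩
  have key : ∀ d, ∀ v ∈ T.nodes, B - T.depth v < d → P v := by
    intro d
    induction d with
    | zero => intro v _ h; omega
    | succ d ih =>
      intro v hv hd
      refine hstep v hv fun w hw => ih w hw.1 ?_
      have := hw.depth_eq
      have := hB' w
      omega
  exact fun v hv => key _ v hv (Nat.lt_succ_self _)

end Cluster

/-! ## The registration protocol of one pulse in one cluster tree -/

/-- States of all nodes and signals in transit for one registration process. -/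
@[ext] structure RegConfig (V : Type*) where
  st : V → RegState V
  ch : V → V → List RegSignal

namespace RegConfig

variable {V : Type*} {G : SimpleGraph V}

def start (T : Cluster G) : RegConfig V := ⟨RegState.start T, fun _ _ => []⟩

def pop (ρ : RegConfig V) (u v : V) (rest : List RegSignal) : RegConfig V :=
  ⟨ρ.st, fun a b => if a = u ∧ b = v then rest else ρ.ch a b⟩

def send (G : SimpleGraph V) (ρ : RegConfig V) (u : V) (r : RegState V × (V → List RegSignal)) :
    RegConfig V :=
  ⟨Function.update ρ.st u r.1, fun a b => if a = u ∧ G.Adj a b then ρ.ch a b ++ r.2 b else ρ.ch a b⟩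

/-- The guards of `register` and `deregister` forget safety, emptiness and the registrations in
other clusters. The protocol analysis therefore holds whatever makes members register and
deregister, provided each does so at most once and in this order. -/
inductive Step (T : Cluster G) (ρ : RegConfig V) : RegConfig V → Prop
  | stay : Step T ρ ρ
  | register (u : V) (hu : u ∈ T.members) (h : (ρ.st u).status = .idle) :
      Step T ρ (ρ.send G u ((ρ.st u).register T u))
  | deregister (u : V) (hu : u ∈ T.members) (h : (ρ.st u).status = .registered) :
      Step T ρ (ρ.send G u ((ρ.st u).deregister T u))
  | deliver (u v : V) (m : RegSignal) (rest : List RegSignal) (h : ρ.ch u v = m :: rest) :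
      Step T ρ ((ρ.pop u v rest).send G v ((ρ.st v).receive T v u m))

end RegConfig

/-- The node owes a Go-Ahead to itself or to a child. -/
def RegState.Pending {V : Type*} (x : RegState V) : Prop :=
  x.status = .deregistered ∨ ∃ w, x.mark w = .waiting

/-- The possible situations of the tree edge from `y` to its parent; `y` is in the state `sy`, the
parent in the state `sz`, and the signals in `up` and `dn` are on their way up and down. -/
def EdgeInv {V : Type*} (y : V) (sy sz : RegState V) (up dn : List RegSignal) : Prop :=
  (sy.dirtyUp = false ∧ sy.finished = false ∧ up = [] ∧ sz.callers y = false ∧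
    (sz.mark y = .waiting ∧ dn = [] ∨ sz.mark y = .clean ∧ dn = [.go] ∨
      sz.mark y = .clean ∧ dn = [] ∧ ¬ sy.Pending)) ∨
  (sy.dirtyUp = true ∧ sy.finished = false ∧ up = [.invoke] ∧ sz.callers y = false ∧
    (sz.mark y = .waiting ∧ dn = [] ∨ sz.mark y = .clean ∧ dn = [.go] ∨
      sz.mark y = .clean ∧ dn = [])) ∨
  (sy.dirtyUp = true ∧ sy.finished = false ∧ up = [] ∧ sz.mark y = .dirty ∧ sz.callers y = true ∧
    (dn = [] ∨ dn = [.go]) ∧ sz.finished = false ∧ sz.dirtyUp = true) ∨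
  (sy.dirtyUp = true ∧ sy.finished = false ∧ up = [] ∧ sz.mark y = .dirty ∧ sz.callers y = false ∧
    (dn = [.done] ∨ dn = [.go, .done]) ∧ sz.finished = true) ∨
  (sy.dirtyUp = true ∧ sy.finished = true ∧ up = [] ∧ sz.mark y = .dirty ∧ sz.callers y = false ∧
    dn = [] ∧ sz.finished = true) ∨
  (sy.dirtyUp = false ∧ sy.finished = false ∧ up = [.cancel] ∧ sz.mark y = .dirty ∧
    sz.callers y = false ∧ dn = [] ∧ sz.finished = true) ∨
  (sy.dirtyUp = true ∧ sy.finished = false ∧ up = [.cancel, .invoke] ∧ sz.mark y = .dirty ∧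
    sz.callers y = false ∧ dn = [] ∧ sz.finished = true)

/-- Local invariant of a node of a cluster tree. -/
structure NodeInv {V : Type*} {G : SimpleGraph V} (T : Cluster G) (x : V) (sx : RegState V) :
    Prop where
  mark_clean : ∀ w, ¬ T.IsChild x w → sx.mark w = .clean
  callers : ∀ w, sx.callers w = true → T.IsChild x w
  root : x = T.root → sx.finished = true ∧
    ((∃ w, sx.mark w = .dirty) ∨ sx.status = .registered ∨ ¬ sx.Pending)
  inner : x ≠ T.root → sx.dirtyUp = true →
    (∃ w, sx.mark w = .dirty) ∨ sx.status = .registering ∨ sx.status = .registered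
  registering : sx.status = .registering → sx.finished = false ∧ sx.dirtyUp = true
  registered : sx.status = .registered → sx.finished = true
  mem : sx.status ≠ .idle → x ∈ T.nodes

/-- The seven disjuncts of `EdgeInv` are the stages of an edge: (1) not dirty, with a Go-Ahead still
owed, in transit, or not needed below; (2) `invoke` in transit; (3) `invoke` received, the parent
still unfinished; (4) `done` in transit, perhaps behind an older `go`; (5) both ends finished; (6)
`cancel` in transit; (7) `cancel` followed by a new `invoke`. Stages 4 and 7 depend on the
first-in-first-out order. The third alternative of stage 1 is what liveness needs: a pending node
below a clean edge always has a `go` under way. -/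
structure RegInv {V : Type*} {G : SimpleGraph V} (T : Cluster G) (ρ : RegConfig V) : Prop where
  nil : ∀ a b, ¬ T.IsChild a b → ¬ T.IsChild b a → ρ.ch a b = []
  edge : ∀ y z, T.IsChild z y → EdgeInv y (ρ.st y) (ρ.st z) (ρ.ch y z) (ρ.ch z y)
  node : ∀ x, NodeInv T x (ρ.st x)

variable {V : Type*} {G : SimpleGraph V} {T : Cluster G}

theorem RegInv.start (T : Cluster G) : RegInv T (RegConfig.start T) := by
  refine ⟨fun _ _ _ _ => rfl, ?_, ?_⟩
  · intro y z h
    have := h.2.1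
    simp [EdgeInv, RegConfig.start, RegState.start, RegState.Pending, this]
  · intro x
    constructor <;> simp [RegConfig.start, RegState.start, RegState.Pending]

/-- Frame rule for all events: `ρ1` is `ρ` with possibly one signal removed from a channel into `x`.
Since only the state of `x` and the channels at `x` change, only the edge from `x` upwards, the
edges from `x` downwards and the local invariant of `x` must be checked. -/
theorem RegInv.send {ρ ρ1 : RegConfig V} (h : RegInv T ρ) (x : V)
    (r : RegState V × (V → List RegSignal)) (hst : ρ1.st = ρ.st)
    (hch : ∀ a b, b ≠ x → ρ1.ch a b = ρ.ch a b)
    (hnil : ∀ w, ¬ T.IsChild x w → ¬ T.IsChild w x → ρ1.ch w x = [] ∧ r.2 w = [])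
    (hup : ∀ z, T.IsChild z x → EdgeInv x r.1 (ρ.st z) (ρ.ch x z ++ r.2 z) (ρ1.ch z x))
    (hdn : ∀ y, T.IsChild x y → EdgeInv y (ρ.st y) r.1 (ρ1.ch y x) (ρ.ch x y ++ r.2 y))
    (hnode : NodeInv T x r.1) : RegInv T (ρ1.send G x r) := by
  refine ⟨?_, ?_, ?_⟩
  · intro a b h1 h2
    simp only [RegConfig.send]
    by_cases hb : b = x
    · subst hb
      have : ρ1.ch a b = [] := (hnil a h2 h1).1
      split_ifs with hab
      · exact absurd (hab.1 ▸ hab.2) (by simp)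
      · exact this
    · rw [hch a b hb, h.nil a b h1 h2]
      split_ifs with hab
      · obtain ⟨rfl, _⟩ := hab
        simpa using (hnil b h1 h2).2
      · rfl
  · intro y z hc
    have hyz : y ≠ z := hc.adj.ne'
    simp only [RegConfig.send, hst]
    by_cases hy : y = x
    · subst hy
      have h1 := hup z hc
      rw [← hch y z (Ne.symm hyz)] at h1
      simpa [Function.update_of_ne (Ne.symm hyz), hc.adj.symm, (Ne.symm hyz)] using h1
    · by_cases hz : z = x
      · subst hz
        have h1 := hdn y hc
        rw [← hch z y hyz] at h1
        simpa [Function.update_of_ne hyz, hc.adj, hyz] using h1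
      · simpa [Function.update_of_ne hy, Function.update_of_ne hz, hy, hz, hch] using h.edge y z hc
  · intro y
    simp only [RegConfig.send, hst]
    by_cases hy : y = x
    · subst hy; simpa using hnode
    · simpa [Function.update_of_ne hy] using h.node y

end

/-! ### Preservation of the registration invariant, event by event -/

section

open Filter
variable {V : Type*} {G : SimpleGraph V} {T : Cluster G}

/-- Only stage 3 of an edge has a waiting caller, and there the parent is unfinished. -/
theorem RegInv.callers_eq_false {ρ : RegConfig V} (h : RegInv T ρ) {z : V}
    (hz : (ρ.st z).finished = true) (w : V) : (ρ.st z).callers w = false := by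
  by_contra hw
  simp only [Bool.not_eq_false] at hw
  have he := h.edge w z ((h.node z).callers w hw)
  simp only [EdgeInv] at he
  grind

/-- A finished node is registered at once and has no callers to notify; a node with a dirty upward
edge joins the invocation in progress; otherwise the upward edge moves from stage 1 to 2, or from 6
to 7. -/
theorem RegInv.step_register {ρ : RegConfig V} (h : RegInv T ρ) (u : V) (hu : u ∈ T.members)
    (hi : (ρ.st u).status = .idle) : RegInv T (ρ.send G u ((ρ.st u).register T u)) := by
  have hu' := T.members_subset hu
  have hn := h.node u
  cases hf : (ρ.st u).finished with
  | true =>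
    have hc := h.callers_eq_false hf
    have hr : (ρ.st u).register T u = ({ ρ.st u with status := .registered }, fun _ => []) := by
      rcases hs : ρ.st u with ⟨_, _, _, _, _⟩
      simp_all [RegState.register, RegState.runRegister, RegState.complete]
      funext w; simp [hc]
    rw [hr]
    refine h.send u _ rfl (fun _ _ _ => rfl) ?_ ?_ ?_ ?_
    · exact fun w h1 h2 => ⟨h.nil w u h2 h1, rfl⟩
    · intro z hz
      have he := h.edge u z hz
      rcases he with he | he | he | he | he | he | he <;> simp [EdgeInv, hf] at he ⊢ <;> simp [he]
    · intro y hy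
      have he := h.edge y u hy
      simpa [EdgeInv] using he
    · obtain ⟨a1, a2, a3, a4, a5, a6⟩ := hn
      constructor <;> simp_all
  | false =>
    have hur : u ≠ T.root := fun e => by simp [(hn.root e).1] at hf
    cases hd : (ρ.st u).dirtyUp with
    | true =>
      have hr : (ρ.st u).register T u = ({ ρ.st u with status := .registering }, fun _ => []) := by
        simp_all [RegState.register, RegState.runRegister]
      rw [hr]
      refine h.send u _ rfl (fun _ _ _ => rfl) ?_ ?_ ?_ ?_
      · exact fun w h1 h2 => ⟨h.nil w u h2 h1, rfl⟩
      · intro z hz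
        have he := h.edge u z hz
        rcases he with he | he | he | he | he | he | he <;> simp [EdgeInv, hd, hf] at he ⊢ <;> simp [he]
      · intro y hy
        have he := h.edge y u hy
        simpa [EdgeInv] using he
      · obtain ⟨a1, a2, a3, a4, a5, a6⟩ := hn
        constructor <;> simp_all
    | false =>
      have hr : (ρ.st u).register T u = ({ ρ.st u with status := .registering, dirtyUp := true },
          fun w => if w = T.parent u then [.invoke] else []) := by
        simp_all [RegState.register, RegState.runRegister]
      rw [hr]
      refine h.send u _ rfl (fun _ _ _ => rfl) ?_ ?_ ?_ ?_
      · intro w h1 h2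
        have : w ≠ T.parent u := fun e => h2 (e ▸ Cluster.isChild_parent hu' hur)
        exact ⟨h.nil w u h2 h1, by simp [this]⟩
      · intro z hz
        have he := h.edge u z hz
        rcases he with he | he | he | he | he | he | he <;>
          simp [EdgeInv, hd, hf, hz.2.2] at he ⊢ <;> simp [he] <;> tauto
      · intro y hy
        have he := h.edge y u hy
        have hy' : y ≠ T.parent u :=
          fun e => hy.not_symm (e ▸ Cluster.isChild_parent hu' hur)
        rcases he with he | he | he | he | he | he | he <;>
          simp [EdgeInv, hd, hf, hy'] at he ⊢ <;> simp [he]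
      · obtain ⟨a1, a2, a3, a4, a5, a6⟩ := hn
        constructor <;> simp_all

end

section

open Filter
variable {V : Type*} {G : SimpleGraph V} {T : Cluster G}

/-- A registered node is finished, so its upward edge is in stage 5. With a dirty child edge nothing
but the status changes; otherwise the root discharges all waiting edges, and any other node moves
its upward edge to stage 6. In the last case the child edges are in stage 1 or 2, which do not
depend on the flags that the node resets. -/
theorem RegInv.step_deregister {ρ : RegConfig V} (h : RegInv T ρ) (u : V) (hu : u ∈ T.members)
    (hi : (ρ.st u).status = .registered) : RegInv T (ρ.send G u ((ρ.st u).deregister T u)) := by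
  have hu' := T.members_subset hu
  have hn := h.node u
  have hf := hn.registered hi
  by_cases hd : ∃ w, (ρ.st u).mark w = .dirty
  · have hr : (ρ.st u).deregister T u = ({ ρ.st u with status := .deregistered }, fun _ => []) := by
      simp_all [RegState.deregister, RegState.runDeregister]
    rw [hr]
    refine h.send u _ rfl (fun _ _ _ => rfl) ?_ ?_ ?_ ?_
    · exact fun w h1 h2 => ⟨h.nil w u h2 h1, rfl⟩
    · intro z hz
      have he := h.edge u z hz
      simp [EdgeInv, hf] at he ⊢
      simp [he]
    · intro y hy
      simpa [EdgeInv] using h.edge y u hy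
    · obtain ⟨a1, a2, a3, a4, a5, a6⟩ := hn
      constructor <;> simp_all
      exact fun e => Or.inl (e ▸ hd)
  · by_cases hur : u = T.root
    · have hr : (ρ.st u).deregister T u =
          ({ ρ.st u with
              status := .free
              mark := fun w => if (ρ.st u).mark w = .waiting then .clean else (ρ.st u).mark w },
            fun w => if (ρ.st u).mark w = .waiting then [.go] else []) := by
        simp only [RegState.deregister, RegState.runDeregister, hd]
        simp [hur, RegState.runGo]
      rw [hr]
      refine h.send u _ rfl (fun _ _ _ => rfl) ?_ ?_ ?_ ?_
      · intro w h1 h2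
        exact ⟨h.nil w u h2 h1, by simp [hn.mark_clean w h1]⟩
      · intro z hz
        exact absurd hur hz.2.1
      · intro y hy
        have he := h.edge y u hy
        have hdy : (ρ.st u).mark y ≠ .dirty := fun e => hd ⟨y, e⟩
        rcases he with he | he | he | he | he | he | he <;>
          simp [EdgeInv, hdy] at he ⊢ <;> simp [he] <;> grind
      · obtain ⟨a1, a2, a3, a4, a5, a6⟩ := hn
        constructor <;> simp_all [RegState.Pending]
        grind
    · have hr : (ρ.st u).deregister T u =
          ({ ρ.st u with status := .deregistered, dirtyUp := false, finished := false },
            fun w => if w = T.parent u then [.cancel] else []) := by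
        simp only [RegState.deregister, RegState.runDeregister, hd]
        simp [hur]
      rw [hr]
      refine h.send u _ rfl (fun _ _ _ => rfl) ?_ ?_ ?_ ?_
      · intro w h1 h2
        have : w ≠ T.parent u := fun e => h2 (e ▸ Cluster.isChild_parent hu' hur)
        exact ⟨h.nil w u h2 h1, by simp [this]⟩
      · intro z hz
        have he := h.edge u z hz
        simp [EdgeInv, hf, hz.2.2] at he ⊢
        simp [he]
      · intro y hy
        have he := h.edge y u hy
        have hy' : y ≠ T.parent u :=
          fun e => hy.not_symm (e ▸ Cluster.isChild_parent hu' hur)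
        -- Stages 3 to 7 require a dirty mark, so they are excluded for every child.
        have hdy : (ρ.st u).mark y ≠ .dirty := fun e => hd ⟨y, e⟩
        simp [EdgeInv, hf, hy', hdy] at he ⊢
        simp [he]
      · obtain ⟨a1, a2, a3, a4, a5, a6⟩ := hn
        constructor <;> simp_all

variable {ρ : RegConfig V}

/-- Signals travel along tree edges: `invoke` and `cancel` up, `done` and `go` down. -/
theorem RegInv.isChild_of_head (h : RegInv T ρ) {u v : V} {m : RegSignal} {rest : List RegSignal}
    (hm : ρ.ch u v = m :: rest) :
    T.IsChild v u ∧ (m = .invoke ∨ m = .cancel) ∨ T.IsChild u v ∧ (m = .done ∨ m = .go) := by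
  by_cases h1 : T.IsChild v u
  · left
    have he := h.edge u v h1
    rw [hm] at he
    simp only [EdgeInv] at he
    refine ⟨h1, ?_⟩
    grind
  · by_cases h2 : T.IsChild u v
    · right
      have he := h.edge v u h2
      rw [hm] at he
      simp only [EdgeInv] at he
      refine ⟨h2, ?_⟩
      grind
    · simp [h.nil u v h2 h1] at hm

/-- A node that receives `go` is unfinished. It passes everything it owes on to its children, so
afterwards it is not pending, which is what stage 1 demands once `go` has left the channel. -/
theorem RegInv.step_go (h : RegInv T ρ) {u v : V} {rest : List RegSignal}
    (hm : ρ.ch u v = .go :: rest) :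
    RegInv T ((ρ.pop u v rest).send G v (RegState.receive T v u (ρ.st v) .go)) := by
  have hc : T.IsChild u v := by simpa using h.isChild_of_head hm
  have hn := h.node v
  have hev := h.edge v u hc
  rw [hm] at hev
  have hf : (ρ.st v).finished = false := by
    simp only [EdgeInv] at hev; grind
  have hr : RegState.receive T v u (ρ.st v) .go =
      ({ ρ.st v with
          status := if (ρ.st v).status = .deregistered then .free else (ρ.st v).status
          mark := fun w => if (ρ.st v).mark w = .waiting then .clean else (ρ.st v).mark w },
        fun w => if (ρ.st v).mark w = .waiting then [.go] else []) := rfl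
  rw [hr]
  refine h.send v _ rfl ?_ ?_ ?_ ?_ ?_
  · intro a b hb; simp [RegConfig.pop, hb]
  · intro w h1 h2
    refine ⟨?_, by simp [hn.mark_clean w h1]⟩
    have : w ≠ u := fun e => h2 (e ▸ hc)
    simp [RegConfig.pop, this, h.nil w v h2 h1]
  · intro z hz
    have hzu : z = u := hz.2.2.symm.trans hc.2.2
    subst hzu
    have hnc : (ρ.st v).mark z = .clean := hn.mark_clean z hc.not_symm
    have hpend : ¬ (({ ρ.st v with
          status := if (ρ.st v).status = .deregistered then .free else (ρ.st v).status
          mark := fun w => if (ρ.st v).mark w = .waiting then .clean else (ρ.st v).mark w } :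
          RegState V)).Pending := by
      simp only [RegState.Pending]; grind
    rcases hev with he | he | he | he | he | he | he <;>
      simp [EdgeInv, RegConfig.pop, hnc, hpend] at he ⊢ <;> simp [he]
  · intro y hy
    have he := h.edge y v hy
    have hyu : y ≠ u := fun e => hy.not_symm (e ▸ hc)
    rcases he with he | he | he | he | he | he | he <;>
      simp [EdgeInv, RegConfig.pop, hyu] at he ⊢ <;> simp [he] <;> grind
  · obtain ⟨a1, a2, a3, a4, a5, a6, a7⟩ := hn
    have := hc.2.1
    constructor
    all_goals simp_all
    all_goals grind

/-- The upward edge passes from stage 4 to 5, and every child edge with a waiting caller from 3 to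
4. A `go` that was sent to such a child earlier stays in front of the `done`. -/
theorem RegInv.step_done (h : RegInv T ρ) {u v : V} {rest : List RegSignal}
    (hm : ρ.ch u v = .done :: rest) :
    RegInv T ((ρ.pop u v rest).send G v (RegState.receive T v u (ρ.st v) .done)) := by
  have hc : T.IsChild u v := by simpa using h.isChild_of_head hm
  have hn := h.node v
  have hev := h.edge v u hc
  rw [hm] at hev
  have hr : RegState.receive T v u (ρ.st v) .done =
      ({ ρ.st v with
          finished := true
          status := if (ρ.st v).status = .registering then .registered else (ρ.st v).status
          callers := fun _ => false },
        fun w => if (ρ.st v).callers w = true then [.done] else []) := rfl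
  rw [hr]
  refine h.send v _ rfl ?_ ?_ ?_ ?_ ?_
  · intro a b hb; simp [RegConfig.pop, hb]
  · intro w h1 h2
    refine ⟨?_, by simpa using fun e => h1 (hn.callers w e)⟩
    have : w ≠ u := fun e => h2 (e ▸ hc)
    simp [RegConfig.pop, this, h.nil w v h2 h1]
  · intro z hz
    have hzu : z = u := hz.2.2.symm.trans hc.2.2
    subst hzu
    have hcc : (ρ.st v).callers z = false := by
      simpa using fun e => hc.not_symm (hn.callers z e)
    rcases hev with he | he | he | he | he | he | he <;>
      simp [EdgeInv, RegConfig.pop, hcc] at he ⊢ <;> simp [he]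
  · intro y hy
    have he := h.edge y v hy
    have hyu : y ≠ u := fun e => hy.not_symm (e ▸ hc)
    rcases he with he | he | he | he | he | he | he <;>
      simp [EdgeInv, RegConfig.pop, hyu] at he ⊢ <;> simp [he] <;> grind
  · obtain ⟨a1, a2, a3, a4, a5, a6, a7⟩ := hn
    have := hc.2.1
    constructor
    all_goals simp_all
    all_goals grind

end

section

open Filter
variable {V : Type*} {G : SimpleGraph V} {T : Cluster G} {ρ : RegConfig V}

/-- Stages 6 and 7 have a finished parent, so the parent's own upward edge is in stage 5 unless it
is the root; a `cancel` that it passes on takes that edge to stage 6. -/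
theorem RegInv.step_cancel (h : RegInv T ρ) {u v : V} {rest : List RegSignal}
    (hm : ρ.ch u v = .cancel :: rest) :
    RegInv T ((ρ.pop u v rest).send G v (RegState.receive T v u (ρ.st v) .cancel)) := by
  have hc : T.IsChild v u := by simpa using h.isChild_of_head hm
  have hn := h.node v
  have hev := h.edge u v hc
  rw [hm] at hev
  have hf : (ρ.st v).finished = true := by
    simp only [EdgeInv] at hev; grind
  have hpop : ∀ a b, b ≠ v → (ρ.pop u v rest).ch a b = ρ.ch a b := by
    intro a b hb; simp [RegConfig.pop, hb]
  have hnil : ∀ w, ¬ T.IsChild v w → ¬ T.IsChild w v → (ρ.pop u v rest).ch w v = [] := by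
    intro w h1 h2
    have : w ≠ u := fun e => h1 (e ▸ hc)
    simp [RegConfig.pop, this, h.nil w v h2 h1]
  have hmark : ∀ w, Function.update (ρ.st v).mark u Mark.waiting w =
      if w = u then .waiting else (ρ.st v).mark w := fun w => by
    simp [Function.update_apply]
  by_cases hd : (∃ w, Function.update (ρ.st v).mark u Mark.waiting w = .dirty) ∨
      (ρ.st v).status = .registered
  · have hr : RegState.receive T v u (ρ.st v) .cancel =
        ({ ρ.st v with mark := Function.update (ρ.st v).mark u .waiting }, fun _ => []) := by
      simp only [RegState.receive, RegState.runDeregister, hd, if_true]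
    rw [hr]
    refine h.send v _ rfl hpop ?_ ?_ ?_ ?_
    · exact fun w h1 h2 => ⟨hnil w h1 h2, rfl⟩
    · intro z hz
      have hzu : z ≠ u := fun e => hc.not_symm (e ▸ hz)
      have he := h.edge v z hz
      rcases he with he | he | he | he | he | he | he <;>
        simp [EdgeInv, hf, RegConfig.pop, hzu] at he ⊢
      simp [he]
    · intro y hy
      have he := h.edge y v hy
      by_cases hyu : y = u
      · subst hyu
        rcases hev with he | he | he | he | he | he | he <;>
          simp [EdgeInv, RegConfig.pop] at he ⊢ <;> simp [he]
      · simpa [EdgeInv, RegConfig.pop, hyu] using he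
    · obtain ⟨a1, a2, a3, a4, a5, a6, a7⟩ := hn
      constructor
      all_goals simp_all
      all_goals grind
  -- The edge of `u` was the last dirty one, so all other child edges are in stage 1 or 2.
  · have hdy : ∀ y, y ≠ u → (ρ.st v).mark y ≠ .dirty := by
      intro y hy e; exact hd (Or.inl ⟨y, by simp [hy, e]⟩)
    by_cases hur : v = T.root
    · have hr : RegState.receive T v u (ρ.st v) .cancel =
          ({ ρ.st v with
              status := if (ρ.st v).status = .deregistered then .free else (ρ.st v).status
              mark := fun w => if w = u ∨ (ρ.st v).mark w = .waiting then .clean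
                else (ρ.st v).mark w },
            fun w => if w = u ∨ (ρ.st v).mark w = .waiting then [.go] else []) := by
        simp only [RegState.receive, RegState.runDeregister, hd]
        simp [hur, RegState.runGo, hmark]
        constructor <;> funext w <;> by_cases w = u <;> simp [*]
      rw [hr]
      refine h.send v _ rfl hpop ?_ ?_ ?_ ?_
      · intro w h1 h2
        have : w ≠ u := fun e => h1 (e ▸ hc)
        exact ⟨hnil w h1 h2, by simp [hn.mark_clean w h1, this]⟩
      · intro z hz
        exact absurd hur hz.2.1
      · intro y hy
        have he := h.edge y v hy
        by_cases hyu : y = u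
        · subst hyu
          rcases hev with he | he | he | he | he | he | he <;>
            simp [EdgeInv, RegConfig.pop] at he ⊢ <;> simp [he]
        · have hdy := hdy y hyu
          rcases he with he | he | he | he | he | he | he <;>
            simp [EdgeInv, hdy, hyu, RegConfig.pop] at he ⊢ <;> simp [he] <;> grind
      · obtain ⟨a1, a2, a3, a4, a5, a6, a7⟩ := hn
        constructor
        all_goals simp_all [RegState.Pending]
        all_goals grind
    · have hr : RegState.receive T v u (ρ.st v) .cancel =
          ({ ρ.st v with
              mark := Function.update (ρ.st v).mark u .waiting
              dirtyUp := false
              finished := false },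
            fun w => if w = T.parent v then [.cancel] else []) := by
        simp only [RegState.receive, RegState.runDeregister, hd]
        simp [hur]
      rw [hr]
      have hcv := Cluster.isChild_parent hc.parent_mem hur
      refine h.send v _ rfl hpop ?_ ?_ ?_ ?_
      · intro w h1 h2
        have : w ≠ T.parent v := fun e => h2 (e ▸ hcv)
        exact ⟨hnil w h1 h2, by simp [this]⟩
      · intro z hz
        have he := h.edge v z hz
        have hzu : z ≠ u := fun e => hc.not_symm (e ▸ hz)
        simp [EdgeInv, hf, hz.2.2, RegConfig.pop, hzu] at he ⊢
        simp [he]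
      · intro y hy
        have he := h.edge y v hy
        have hy' : y ≠ T.parent v := fun e => hy.not_symm (e ▸ hcv)
        by_cases hyu : y = u
        · subst hyu
          rcases hev with he | he | he | he | he | he | he <;>
            simp [EdgeInv, RegConfig.pop, hy'] at he ⊢ <;> simp [he]
        · have hdy := hdy y hyu
          simp [EdgeInv, hf, hy', hdy, hyu, RegConfig.pop] at he ⊢
          simp [he]
      · obtain ⟨a1, a2, a3, a4, a5, a6, a7⟩ := hn
        constructor
        all_goals simp_all
        all_goals grind

/-- Only stage 2 has `invoke` at the head. Overwriting a mark `waiting` by `dirty` loses no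
Go-Ahead: the edge is marked waiting again by the next `cancel`, which the child must send before it
stops being dirty. -/
theorem RegInv.step_invoke (h : RegInv T ρ) {u v : V} {rest : List RegSignal}
    (hm : ρ.ch u v = .invoke :: rest) :
    RegInv T ((ρ.pop u v rest).send G v (RegState.receive T v u (ρ.st v) .invoke)) := by
  have hc : T.IsChild v u := by simpa using h.isChild_of_head hm
  have hn := h.node v
  have hev := h.edge u v hc
  rw [hm] at hev
  have hpop : ∀ a b, b ≠ v → (ρ.pop u v rest).ch a b = ρ.ch a b := by
    intro a b hb; simp [RegConfig.pop, hb]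
  have hnil : ∀ w, ¬ T.IsChild v w → ¬ T.IsChild w v → (ρ.pop u v rest).ch w v = [] := by
    intro w h1 h2
    have : w ≠ u := fun e => h1 (e ▸ hc)
    simp [RegConfig.pop, this, h.nil w v h2 h1]
  have hmark : ∀ w, Function.update (ρ.st v).mark u Mark.dirty w =
      if w = u then .dirty else (ρ.st v).mark w := fun w => by
    simp [Function.update_apply]
  have hcall : ∀ w, Function.update (ρ.st v).callers u true w =
      if w = u then true else (ρ.st v).callers w := fun w => by
    simp [Function.update_apply]
  cases hf : (ρ.st v).finished with
  | true =>
    have hcf := h.callers_eq_false hf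
    have hs : (ρ.st v).status ≠ .registering := fun e => by simp [(hn.registering e).1] at hf
    have hr : RegState.receive T v u (ρ.st v) .invoke =
        ({ ρ.st v with
            mark := Function.update (ρ.st v).mark u .dirty
            callers := fun _ => false },
          fun w => if w = u then [.done] else []) := by
      simp [RegState.receive, RegState.runRegister, hf, RegState.complete, hs, hcall, hcf]
    rw [hr]
    refine h.send v _ rfl hpop ?_ ?_ ?_ ?_
    · intro w h1 h2
      have : w ≠ u := fun e => h1 (e ▸ hc)
      exact ⟨hnil w h1 h2, by simp [this]⟩
    · intro z hz
      have hzu : z ≠ u := fun e => hc.not_symm (e ▸ hz)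
      have he := h.edge v z hz
      simp [EdgeInv, hf, RegConfig.pop, hzu] at he ⊢
      simp [he]
    · intro y hy
      have he := h.edge y v hy
      by_cases hyu : y = u
      · subst hyu
        rcases hev with he | he | he | he | he | he | he <;>
          simp [EdgeInv, RegConfig.pop] at he ⊢
        simp [he, hf]; grind
      · rcases he with he | he | he | he | he | he | he <;>
          simp [EdgeInv, RegConfig.pop, hyu, hf] at he ⊢ <;> simp [he]
    · obtain ⟨a1, a2, a3, a4, a5, a6, a7⟩ := hn
      constructor
      all_goals simp_all
      all_goals grind
  | false =>
    have hur : v ≠ T.root := fun e => by simp [(hn.root e).1] at hf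
    have hcv := Cluster.isChild_parent hc.parent_mem hur
    cases hd : (ρ.st v).dirtyUp with
    | true =>
      have hr : RegState.receive T v u (ρ.st v) .invoke =
          ({ ρ.st v with
              mark := Function.update (ρ.st v).mark u .dirty
              callers := Function.update (ρ.st v).callers u true }, fun _ => []) := by
        simp [RegState.receive, RegState.runRegister, hf, hd]
      rw [hr]
      refine h.send v _ rfl hpop ?_ ?_ ?_ ?_
      · exact fun w h1 h2 => ⟨hnil w h1 h2, rfl⟩
      · intro z hz
        have hzu : z ≠ u := fun e => hc.not_symm (e ▸ hz)
        have he := h.edge v z hz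
        rcases he with he | he | he | he | he | he | he <;>
          simp [EdgeInv, RegConfig.pop, hzu, hf, hd] at he ⊢ <;> simp [he]
      · intro y hy
        have he := h.edge y v hy
        by_cases hyu : y = u
        · subst hyu
          rcases hev with he | he | he | he | he | he | he <;>
            simp [EdgeInv, RegConfig.pop] at he ⊢
          · simp [he, hf, hd]; grind
        · rcases he with he | he | he | he | he | he | he <;>
            simp [EdgeInv, RegConfig.pop, hyu, hf, hd] at he ⊢ <;> simp [he]
      · obtain ⟨a1, a2, a3, a4, a5, a6, a7⟩ := hn
        constructor
        all_goals simp_all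
        all_goals grind
    | false =>
      have hr : RegState.receive T v u (ρ.st v) .invoke =
          ({ ρ.st v with
              mark := Function.update (ρ.st v).mark u .dirty
              callers := Function.update (ρ.st v).callers u true
              dirtyUp := true },
            fun w => if w = T.parent v then [.invoke] else []) := by
        simp [RegState.receive, RegState.runRegister, hf, hd]
      rw [hr]
      refine h.send v _ rfl hpop ?_ ?_ ?_ ?_
      · intro w h1 h2
        have : w ≠ T.parent v := fun e => h2 (e ▸ hcv)
        exact ⟨hnil w h1 h2, by simp [this]⟩
      · intro z hz
        have hzu : z ≠ u := fun e => hc.not_symm (e ▸ hz)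
        have he := h.edge v z hz
        rcases he with he | he | he | he | he | he | he <;>
          simp [EdgeInv, RegConfig.pop, hzu, hf, hd, hz.2.2] at he ⊢ <;> simp [he] <;> tauto
      · intro y hy
        have he := h.edge y v hy
        have hy' : y ≠ T.parent v := fun e => hy.not_symm (e ▸ hcv)
        by_cases hyu : y = u
        · subst hyu
          rcases hev with he | he | he | he | he | he | he <;>
            simp [EdgeInv, RegConfig.pop] at he ⊢
          · simp [he, hf, hy']; grind
        · rcases he with he | he | he | he | he | he | he <;>
            simp [EdgeInv, RegConfig.pop, hyu, hf, hd, hy'] at he ⊢ <;> simp [he]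
      · obtain ⟨a1, a2, a3, a4, a5, a6, a7⟩ := hn
        constructor
        all_goals simp_all
        all_goals grind

theorem RegInv.step {ρ' : RegConfig V} (h : RegInv T ρ) (hs : RegConfig.Step T ρ ρ') :
    RegInv T ρ' := by
  cases hs with
  | stay => exact h
  | register u hu hi => exact h.step_register u hu hi
  | deregister u hu hi => exact h.step_deregister u hu hi
  | deliver u v m rest hm =>
    cases m with
    | invoke => exact h.step_invoke hm
    | done => exact h.step_done hm
    | cancel => exact h.step_cancel hm
    | go => exact h.step_go hm

end

section

open Filter
variable {V : Type*} {G : SimpleGraph V} {T : Cluster G} {ρ ρ' : RegConfig V}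

/-! ### Effects of one step -/

/-- Node `x` enters the state `r.1` and sends the signals `r.2`. -/
inductive RegConfig.NodeEvent (T : Cluster G) (ρ : RegConfig V) (x : V) :
    RegState V × (V → List RegSignal) → Prop
  | register (h : (ρ.st x).status = .idle) (hx : x ∈ T.nodes) :
      NodeEvent T ρ x ((ρ.st x).register T x)
  | deregister (h : (ρ.st x).status = .registered) : NodeEvent T ρ x ((ρ.st x).deregister T x)
  | receive (u : V) (m : RegSignal) (rest : List RegSignal) (h : ρ.ch u x = m :: rest) :
      NodeEvent T ρ x ((ρ.st x).receive T x u m)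

theorem RegConfig.Step.nodeEvent (h : RegConfig.Step T ρ ρ') :
    ρ' = ρ ∨ ∃ x r, ρ.NodeEvent T x r ∧ ρ'.st = Function.update ρ.st x r.1 ∧
      ∀ a b m, m ∈ ρ'.ch a b → m ∈ ρ.ch a b ∨ a = x ∧ m ∈ r.2 b := by
  have key : ∀ (ρ1 : RegConfig V) (x : V) (r : RegState V × (V → List RegSignal)),
      (∀ a b m, m ∈ ρ1.ch a b → m ∈ ρ.ch a b) → ∀ a b m, m ∈ (ρ1.send G x r).ch a b →
        m ∈ ρ.ch a b ∨ a = x ∧ m ∈ r.2 b := by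
    intro ρ1 x r h1 a b m hm
    simp only [RegConfig.send] at hm
    split_ifs at hm with hab
    · rcases List.mem_append.1 hm with hm | hm
      · exact Or.inl (h1 a b m hm)
      · exact Or.inr ⟨hab.1, hm⟩
    · exact Or.inl (h1 a b m hm)
  cases h with
  | stay => exact Or.inl rfl
  | register u hu hi =>
    exact Or.inr ⟨u, _, .register hi (T.members_subset hu), rfl, key _ _ _ fun _ _ _ h => h⟩
  | deregister u hu hi => exact Or.inr ⟨u, _, .deregister hi, rfl, key _ _ _ fun _ _ _ h => h⟩
  | deliver u v m rest hm =>
    refine Or.inr ⟨v, _, .receive u m rest hm, rfl, key _ _ _ ?_⟩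
    intro a b m' hm'
    simp only [RegConfig.pop] at hm'
    split_ifs at hm' with hab
    · rw [hab.1, hab.2, hm]; exact List.mem_cons_of_mem _ hm'
    · exact hm'

/-- What a node can do to its own state and which signals it can send. -/
structure RegConfig.Effect (T : Cluster G) (ρ : RegConfig V) (x : V)
    (r : RegState V × (V → List RegSignal)) : Prop where
  dirtyUp : (ρ.st x).dirtyUp = true → (ρ.st x).finished = false → r.1.dirtyUp = true
  invoke : ∀ w, .invoke ∈ r.2 w → (ρ.st x).dirtyUp = false ∧ r.1.dirtyUp = true
  cancel : ∀ w, .cancel ∈ r.2 w → (ρ.st x).dirtyUp = true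
  go : ∀ w, .go ∈ r.2 w → (ρ.st x).mark w = .waiting ∨ ρ.ch w x ≠ []
  go_origin : ((∃ w, .go ∈ r.2 w) ∨ r.1.status = .free ∧ (ρ.st x).status ≠ .free) →
    (∃ u, T.IsChild u x ∧ .go ∈ ρ.ch u x) ∨
      x = T.root ∧ (¬ ∃ w, r.1.mark w = .dirty) ∧ r.1.status ≠ .registered
  status : r.1.status = (ρ.st x).status ∨
    (ρ.st x).status = .idle ∧ (r.1.status = .registering ∨ r.1.status = .registered) ∨
    (ρ.st x).status = .registering ∧ r.1.status = .registered ∨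
    (ρ.st x).status = .registered ∧ (r.1.status = .deregistered ∨ r.1.status = .free) ∨
    (ρ.st x).status = .deregistered ∧ r.1.status = .free

/-- The part that safety rests on is `go_origin`: a Go-Ahead is either relayed from the parent or
created at the root, and the latter only if no edge there is dirty and the root is not registered
after the event. -/
theorem RegInv.effect (h : RegInv T ρ) {x : V} {r : RegState V × (V → List RegSignal)}
    (he : ρ.NodeEvent T x r) : ρ.Effect T x r := by
  have hn := h.node x
  cases he with
  | register hi hx =>
    constructor <;>
    · simp only [RegState.register, RegState.runRegister, RegState.complete]
      split_ifs <;> simp_all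
  | deregister hi =>
    have hf := hn.registered hi
    have hd : x ≠ T.root → (ρ.st x).dirtyUp = true := by
      intro hr
      have hc := Cluster.isChild_parent (hn.mem (by simp [hi])) hr
      have := h.edge x _ hc
      simp only [EdgeInv] at this; grind
    constructor <;>
    · simp only [RegState.deregister, RegState.runDeregister, RegState.runGo]
      split_ifs <;> simp_all
      all_goals grind
  | receive u m rest hm =>
    have hc := h.isChild_of_head hm
    cases m with
    | invoke =>
      have hs : (ρ.st x).status = .registering → (ρ.st x).finished = false :=
        fun e => (hn.registering e).1
      constructor <;>
      · simp only [RegState.receive, RegState.runRegister, RegState.complete]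
        split_ifs <;> simp_all
    | done =>
      constructor <;>
      · simp only [RegState.receive, RegState.complete]
        try split_ifs
        all_goals simp_all
    | cancel =>
      simp only [reduceCtorEq, or_true, and_true, or_self, and_false, or_false] at hc
      have hev := h.edge u x hc
      have hf : (ρ.st x).finished = true := by
        rw [hm] at hev; simp only [EdgeInv] at hev; grind
      have hd : x ≠ T.root → (ρ.st x).dirtyUp = true := by
        intro hr
        have hc := Cluster.isChild_parent hc.parent_mem hr
        have := h.edge x _ hc
        simp only [EdgeInv] at this; grind
      constructor
      case go_origin =>
        simp only [RegState.receive, RegState.runDeregister, RegState.runGo]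
        split_ifs with h1 h2 h3
        · simp
        · rintro -
          right
          refine ⟨h2, ?_, by simp⟩
          grind
        · rintro -
          right
          refine ⟨h2, ?_, ?_⟩ <;> grind
        · simp
      all_goals
        simp only [RegState.receive, RegState.runDeregister, RegState.runGo]
        split_ifs <;> simp_all [Function.update_apply]
        all_goals grind
    | go =>
      simp only [reduceCtorEq, or_true, and_true, or_self, and_false, false_or] at hc
      have hg : RegSignal.go ∈ ρ.ch u x := by simp [hm]
      constructor
      case go_origin => exact fun _ => Or.inl ⟨u, hc, hg⟩
      all_goals
        simp only [RegState.receive, RegState.runGo]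
        try split_ifs
        all_goals simp_all

end

section

open Filter
variable {V : Type*} {G : SimpleGraph V} {T : Cluster G} {ρ ρ' : RegConfig V}

/-! ### Safety of the registration protocol -/

/-- A Go-Ahead is on its way to `a` or to an ancestor of `a`. -/
def UnderGo (T : Cluster G) (ρ : RegConfig V) (a : V) : Prop :=
  ∃ z y, T.IsChild z y ∧ .go ∈ ρ.ch z y ∧ Relation.ReflTransGen T.IsChild y a

/-- Stage 5 is the only one with a finished child, so being finished propagates to the root, along
dirty edges without downward signals. -/
theorem RegInv.finished_parent (h : RegInv T ρ) {z y : V} (hc : T.IsChild z y)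
    (hy : (ρ.st y).finished = true) :
    (ρ.st z).finished = true ∧ (ρ.st z).mark y = .dirty ∧ ρ.ch z y = [] := by
  have he := h.edge y z hc
  simp only [EdgeInv] at he
  grind

theorem RegInv.not_underGo (h : RegInv T ρ) {a : V} (ha : (ρ.st a).finished = true) :
    ¬ UnderGo T ρ a := by
  rintro ⟨z, y, hc, hg, hy⟩
  have hf : (ρ.st y).finished = true := by
    clear hc hg
    induction hy using Relation.ReflTransGen.head_induction_on with
    | refl => exact ha
    | head hc _ ih => exact (h.finished_parent hc ih).1
  simp [(h.finished_parent hc hf).2.2] at hg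

/-- A registered node is finished; carrying this up to the root shows that the topmost edge of the
path, if there is one, is dirty. -/
theorem RegInv.dirty_root (h : RegInv T ρ) {b : V} (hb : (ρ.st b).status = .registered) :
    (∃ w, (ρ.st T.root).mark w = .dirty) ∨ (ρ.st T.root).status = .registered := by
  have key : ∀ v ∈ T.nodes, (ρ.st v).finished = true →
      v = T.root ∨ ∃ w, (ρ.st T.root).mark w = .dirty := by
    refine T.induction_down (fun _ => Or.inl rfl) ?_
    intro u w hc ih hw
    obtain ⟨h1, h2, _⟩ := h.finished_parent hc hw
    rcases ih h1 with rfl | ih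
    · exact Or.inr ⟨w, h2⟩
    · exact Or.inr ih
  have hn := h.node b
  rcases key b (hn.mem (by simp [hb])) (hn.registered hb) with rfl | hd
  · exact Or.inr hb
  · exact Or.inl hd

/-- As long as a node `b` stays registered, a node to which no Go-Ahead is on its way does not
get one. -/
theorem RegInv.not_free_step (h : RegInv T ρ) (h' : RegInv T ρ') (hs : RegConfig.Step T ρ ρ')
    {a b : V} (hb : (ρ'.st b).status = .registered)
    (ha : ¬ UnderGo T ρ a ∧ (ρ.st a).status ≠ .free) :
    ¬ UnderGo T ρ' a ∧ (ρ'.st a).status ≠ .free := by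
  have hroot := h'.dirty_root hb
  rcases hs.nodeEvent with rfl | ⟨x, r, hev, hst, hch⟩
  · exact ha
  have he := h.effect hev
  have hx : ρ'.st x = r.1 := by rw [hst]; simp
  have horigin : ((∃ w, .go ∈ r.2 w) ∨ r.1.status = .free ∧ (ρ.st x).status ≠ .free) →
      ∃ u, T.IsChild u x ∧ .go ∈ ρ.ch u x := by
    intro h1
    -- A Go-Ahead created at the root is impossible: after the step `b` is registered, so the root
    -- still sees a dirty edge or is registered itself.
    rcases he.go_origin h1 with h2 | ⟨rfl, h2, h3⟩
    · exact h2
    · rw [hx] at hroot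
      exact (hroot.elim h2 h3).elim
  constructor
  · rintro ⟨z, y, hc, hg, hy⟩
    rcases hch z y _ hg with h1 | ⟨rfl, h1⟩
    · exact ha.1 ⟨z, y, hc, h1, hy⟩
    · obtain ⟨u, hu, hgu⟩ := horigin (Or.inl ⟨y, h1⟩)
      exact ha.1 ⟨u, z, hu, hgu, .head hc hy⟩
  · by_cases hax : a = x
    · subst hax
      intro hfree
      rw [hx] at hfree
      obtain ⟨u, hu, hgu⟩ := horigin (Or.inr ⟨hfree, ha.2⟩)
      exact ha.1 ⟨u, a, hu, hgu, .refl⟩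
    · rw [hst, Function.update_of_ne hax]; exact ha.2

/-- The status of a node never moves backwards. Ranking the statuses turns this into monotonicity,
from which stability and statements about intermediate times follow by comparing numbers. -/
def RegStatus.rank : RegStatus → ℕ
  | .idle => 0
  | .registering => 1
  | .registered => 2
  | .deregistered => 3
  | .free => 4

theorem RegInv.rank_le (h : RegInv T ρ) (hs : RegConfig.Step T ρ ρ') (v : V) :
    (ρ.st v).status.rank ≤ (ρ'.st v).status.rank := by
  rcases hs.nodeEvent with rfl | ⟨x, r, hev, hst, hch⟩
  · rfl
  by_cases hvx : v = x
  · subst hvx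
    have he := (h.effect hev).status
    have hx : ρ'.st v = r.1 := by rw [hst]; simp
    rw [hx]
    rcases he with he | ⟨h1, h2 | h2⟩ | ⟨h1, h2⟩ | ⟨h1, h2 | h2⟩ | ⟨h1, h2⟩ <;>
      simp [RegStatus.rank, *]
  · rw [hst, Function.update_of_ne hvx]

/-! ### Runs of the registration protocol -/

/-- A run in which all signals are delivered eventually. -/
structure IsRegRun (T : Cluster G) (ρ : ℕ → RegConfig V) : Prop where
  start : ρ 0 = RegConfig.start T
  next : ∀ n, RegConfig.Step T (ρ n) (ρ (n + 1))
  fair : ∀ u v n, ∃ m, n ≤ m ∧ ((ρ m).ch u v = [] ∨ ∃ x rest, (ρ m).ch u v = x :: rest ∧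
    ρ (m + 1) = ((ρ m).pop u v rest).send G v (((ρ m).st v).receive T v u x))

namespace IsRegRun

variable {ρ : ℕ → RegConfig V}

theorem inv (h : IsRegRun T ρ) (n : ℕ) : RegInv T (ρ n) := by
  induction n with
  | zero => rw [h.start]; exact RegInv.start T
  | succ n ih => exact ih.step (h.next n)

theorem rank_mono (h : IsRegRun T ρ) (v : V) : Monotone fun n => ((ρ n).st v).status.rank :=
  monotone_nat_of_le_succ fun n => (h.inv n).rank_le (h.next n) v

/-- If `b` is registered when `a` has not been deregistered yet, then `a` gets no Go-Ahead before
`b` is deregistered. -/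
theorem not_free (h : IsRegRun T ρ) {a b : V} {n m : ℕ} (hnm : n ≤ m)
    (ha : ((ρ n).st a).status = .registered)
    (hb : ((ρ n).st b).status = .registered) (hb' : ((ρ m).st b).status = .registered) :
    ((ρ m).st a).status ≠ .free := by
  suffices ∀ k, n ≤ k → k ≤ m → ¬ UnderGo T (ρ k) a ∧ ((ρ k).st a).status ≠ .free from
    (this m hnm le_rfl).2
  intro k hk
  induction k, hk using Nat.le_induction with
  | base =>
    intro _
    exact ⟨(h.inv n).not_underGo (((h.inv n).node a).registered ha), by simp [ha]⟩
  | succ k hk ih =>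
    intro hkm
    refine (h.inv k).not_free_step (b := b) (h.inv (k + 1)) (h.next k) ?_ (ih (by omega))
    -- The rank of `b` is the same at both ends, so `b` is registered at all times in between.
    have h1 := h.rank_mono b (show n ≤ k + 1 by omega)
    have h2 := h.rank_mono b hkm
    simp only [hb, hb'] at h1 h2
    cases hs : ((ρ (k + 1)).st b).status <;> simp [hs, RegStatus.rank] at h1 h2 ⊢

end IsRegRun

end

/-! ### Delivery of signals and termination of the registration procedure -/

section

open Filter
variable {V : Type*} {G : SimpleGraph V} {T : Cluster G}

/-- The queue discipline: in one step a channel either grows at its end or loses its head, and the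
latter is exactly the delivery of that head. -/
theorem RegConfig.Step.chan {ρ ρ' : RegConfig V} (h : RegConfig.Step T ρ ρ') (a b : V) :
    (∃ out, ρ'.ch a b = ρ.ch a b ++ out) ∨
      ∃ m rest, ρ.ch a b = m :: rest ∧ ρ'.ch a b = rest ∧
        ρ' = (ρ.pop a b rest).send G b ((ρ.st b).receive T b a m) := by
  have key : ∀ (x : V) (r : RegState V × (V → List RegSignal)),
      ∃ out, (ρ.send G x r).ch a b = ρ.ch a b ++ out := by
    intro x r
    simp only [RegConfig.send]
    split_ifs
    · exact ⟨_, rfl⟩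
    · exact ⟨[], by simp⟩
  cases h with
  | stay => exact Or.inl ⟨[], by simp⟩
  | register u hu hi => exact Or.inl (key _ _)
  | deregister u hu hi => exact Or.inl (key _ _)
  | deliver u v m rest hm =>
    by_cases hab : a = u ∧ b = v
    · obtain ⟨rfl, rfl⟩ := hab
      refine Or.inr ⟨m, rest, hm, ?_, rfl⟩
      simp only [RegConfig.send, RegConfig.pop, and_self, if_true]
      rw [if_neg]
      rintro ⟨rfl, h⟩
      exact G.loopless.irrefl _ h
    · left
      simp only [RegConfig.send, RegConfig.pop, if_neg hab]
      split_ifs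
      · exact ⟨_, rfl⟩
      · exact ⟨[], by simp⟩

namespace IsRegRun

variable {ρ : ℕ → RegConfig V}

/-- Every signal is delivered eventually. -/
theorem delivered (h : IsRegRun T ρ) {u v : V} {x : RegSignal} {n : ℕ} (hx : x ∈ (ρ n).ch u v) :
    ∃ m, n ≤ m ∧ ∃ rest, (ρ m).ch u v = x :: rest ∧ (ρ (m + 1)).ch u v = rest ∧
      ρ (m + 1) = ((ρ m).pop u v rest).send G v (((ρ m).st v).receive T v u x) := by
  obtain ⟨l₁, l₂, hl⟩ := List.append_of_mem hx
  clear hx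
  -- The induction is on the number of signals in front of `x`. Until its head leaves, the channel
  -- only grows at the end; fairness makes the head leave.
  induction hk : l₁.length generalizing n l₁ l₂ with
  | zero =>
    have hl₁ := List.length_eq_zero_iff.1 hk
    subst hl₁
    by_contra! hcon
    have hstay : ∀ m, n ≤ m → ∃ l, (ρ m).ch u v = x :: l := by
      intro m hm
      induction m, hm using Nat.le_induction with
      | base => exact ⟨l₂, hl⟩
      | succ m hm ih =>
        obtain ⟨l, hl⟩ := ih
        rcases (h.next m).chan u v with ⟨out, ho⟩ | ⟨y, rest, h1, h2, h3⟩
        · exact ⟨l ++ out, by rw [ho, hl]; rfl⟩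
        · rw [hl] at h1
          obtain ⟨rfl, rfl⟩ := List.cons.inj h1
          exact (hcon m hm l hl h2 h3).elim
    obtain ⟨m, hm, hf⟩ := h.fair u v n
    obtain ⟨l, hl'⟩ := hstay m hm
    rcases hf with hf | ⟨y, rest, h1, h2⟩
    · simp [hl'] at hf
    · rw [hl'] at h1
      obtain ⟨rfl, rfl⟩ := List.cons.inj h1
      refine hcon m hm l hl' ?_ h2
      rw [h2]
      simp only [RegConfig.send, RegConfig.pop, and_self, if_true]
      rw [if_neg]
      rintro ⟨rfl, h⟩
      exact G.loopless.irrefl _ h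
  | succ k ih =>
    by_contra! hcon
    obtain ⟨y, l₁', rfl⟩ := List.exists_cons_of_length_eq_add_one hk
    have hstep : ∀ m, n ≤ m → ∀ l, (ρ m).ch u v = y :: l₁' ++ x :: l →
        ∃ l, (ρ (m + 1)).ch u v = y :: l₁' ++ x :: l := by
      intro m hm l hl
      rcases (h.next m).chan u v with ⟨out, ho⟩ | ⟨z, rest, h1, h2, h3⟩
      · exact ⟨l ++ out, by rw [ho, hl]; simp⟩
      · rw [hl] at h1
        simp only [List.cons_append, List.cons.injEq] at h1
        rw [← h1.2] at h2
        obtain ⟨m', h4, h5⟩ := ih (n := m + 1) l₁' l h2 (by simpa using hk)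
        obtain ⟨rest, h6, h7, h8⟩ := h5
        exact (hcon m' (by omega) rest h6 h7 h8).elim
    have hstay : ∀ m, n ≤ m → ∃ l, (ρ m).ch u v = y :: l₁' ++ x :: l := by
      intro m hm
      induction m, hm using Nat.le_induction with
      | base => exact ⟨l₂, hl⟩
      | succ m hm ih =>
        obtain ⟨l, hl⟩ := ih
        exact hstep m hm l hl
    obtain ⟨m, hm, hf⟩ := h.fair u v n
    obtain ⟨l, hl'⟩ := hstay m hm
    rcases hf with hf | ⟨z, rest, h1, h2⟩
    · simp [hl'] at hf
    · have h3 : (ρ (m + 1)).ch u v = rest := by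
        rw [h2]
        simp only [RegConfig.send, RegConfig.pop, and_self, if_true]
        rw [if_neg]
        rintro ⟨rfl, h⟩
        exact G.loopless.irrefl _ h
      rw [hl'] at h1
      simp only [List.cons_append, List.cons.injEq] at h1
      rw [← h1.2] at h3
      obtain ⟨m', h4, rest, h6, h7, h8⟩ := ih (n := m + 1) l₁' l h3 (by simpa using hk)
      exact (hcon m' (by omega) rest h6 h7 h8).elim

/-- That `y` is unfinished matters: only a finished node sends `cancel`, which clears the dirty
flag. -/
theorem dirtyUp_step (h : IsRegRun T ρ) {y : V} {n : ℕ} (hd : ((ρ n).st y).dirtyUp = true)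
    (hf : ((ρ n).st y).finished = false) : ((ρ (n + 1)).st y).dirtyUp = true := by
  rcases (h.next n).nodeEvent with he | ⟨x, r, hev, hst, hch⟩
  · rw [he]; exact hd
  by_cases hx : y = x
  · subst hx
    rw [hst, Function.update_self]
    exact ((h.inv n).effect hev).dirtyUp hd hf
  · rw [hst, Function.update_of_ne hx]; exact hd

/-- Together with the two lemmas that follow, this says when no new signal of a given kind enters a
channel. Once the last old one is delivered, the channel then stays free of that kind. -/
theorem mem_of_invoke (h : IsRegRun T ρ) {y z : V} {n : ℕ} (hd : ((ρ n).st y).dirtyUp = true)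
    (hi : .invoke ∈ (ρ (n + 1)).ch y z) : .invoke ∈ (ρ n).ch y z := by
  rcases (h.next n).nodeEvent with he | ⟨x, r, hev, hst, hch⟩
  · rwa [he] at hi
  rcases hch y z _ hi with h1 | ⟨rfl, h1⟩
  · exact h1
  · have := (((h.inv n).effect hev).invoke z h1).1
    simp [hd] at this

theorem mem_of_cancel (h : IsRegRun T ρ) {y z : V} {n : ℕ} (hd : ((ρ n).st y).dirtyUp = false)
    (hi : .cancel ∈ (ρ (n + 1)).ch y z) : .cancel ∈ (ρ n).ch y z := by
  rcases (h.next n).nodeEvent with he | ⟨x, r, hev, hst, hch⟩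
  · rwa [he] at hi
  rcases hch y z _ hi with h1 | ⟨rfl, h1⟩
  · exact h1
  · have := ((h.inv n).effect hev).cancel z h1
    simp [hd] at this

/-- The upward channel must be empty because the root may answer a `cancel` with `go` in the same
event, so that the mark is never seen as `waiting` in between. -/
theorem mem_of_go (h : IsRegRun T ρ) {y z : V} {n : ℕ} (hm : ((ρ n).st z).mark y ≠ .waiting)
    (hup : (ρ n).ch y z = []) (hi : .go ∈ (ρ (n + 1)).ch z y) : .go ∈ (ρ n).ch z y := by
  rcases (h.next n).nodeEvent with he | ⟨x, r, hev, hst, hch⟩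
  · rwa [he] at hi
  rcases hch z y _ hi with h1 | ⟨rfl, h1⟩
  · exact h1
  · exact ((((h.inv n).effect hev).go y h1).elim hm (fun h => h hup)).elim

/-- The registration procedure always comes to an end. -/
theorem eventually_finished (h : IsRegRun T ρ) : ∀ y ∈ T.nodes, ∀ n,
    ((ρ n).st y).dirtyUp = true → ∃ m, n ≤ m ∧ ((ρ m).st y).finished = true := by
  refine T.induction_down (fun n _ => ⟨n, le_rfl, (((h.inv n).node _).root rfl).1⟩) ?_
  intro z y hc ih n hd
  by_contra! hcon
  simp only [ne_eq, Bool.not_eq_true] at hcon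
  have hdirty : ∀ m, n ≤ m → ((ρ m).st y).dirtyUp = true := by
    intro m hm
    induction m, hm using Nat.le_induction with
    | base => exact hd
    | succ m hm ihm => exact h.dirtyUp_step ihm (hcon m hm)
  -- No stage has two signals `invoke` in the upward channel, so delivering one leaves none.
  have hup : ∃ m, n ≤ m ∧ .invoke ∉ (ρ m).ch y z := by
    by_cases hi : .invoke ∈ (ρ n).ch y z
    · obtain ⟨m, hm, rest, h1, h2, h3⟩ := h.delivered hi
      refine ⟨m + 1, by omega, ?_⟩
      have he := (h.inv m).edge y z hc
      rw [h2]
      simp only [EdgeInv, h1] at he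
      grind
    · exact ⟨n, le_rfl, hi⟩
  obtain ⟨m, hm, hi⟩ := hup
  have hup : ∀ k, m ≤ k → .invoke ∉ (ρ k).ch y z := by
    intro k hk
    induction k, hk using Nat.le_induction with
    | base => exact hi
    | succ k hk ihk => exact fun hcon => ihk (h.mem_of_invoke (hdirty k (by omega)) hcon)
  -- With `y` dirty, unfinished and without `invoke` in transit, the edge is in stage 3 or 4. In
  -- stage 3 the parent is dirty, so it finishes by induction, and from then on only stage 4 is
  -- possible: `done` is on its way.
  have hdone : ∃ k, m ≤ k ∧ .done ∈ (ρ k).ch z y := by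
    have hz : ∃ k, m ≤ k ∧ ((ρ k).st z).finished = true := by
      have he := (h.inv m).edge y z hc
      have h1 := hdirty m hm
      have h2 := hcon m hm
      cases hzf : ((ρ m).st z).finished with
      | true => exact ⟨m, le_rfl, hzf⟩
      | false =>
        refine ih m ?_
        simp only [EdgeInv] at he
        grind
    obtain ⟨k, hk, hzf⟩ := hz
    refine ⟨k, hk, ?_⟩
    have he := (h.inv k).edge y z hc
    have h1 := hdirty k (by omega)
    have h2 := hcon k (by omega)
    have h3 := hup k hk
    simp only [EdgeInv] at he
    grind
  obtain ⟨k, hk, hd⟩ := hdone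
  obtain ⟨l, hl, rest, h1, h2, h3⟩ := h.delivered hd
  have := hcon (l + 1) (by omega)
  rw [h3] at this
  simp [RegConfig.send, RegConfig.pop, RegState.receive, RegState.complete] at this

theorem eventually_registered (h : IsRegRun T ρ) (v : V) (n : ℕ)
    (hn : ((ρ n).st v).status = .registering) :
    ∃ m, n ≤ m ∧ ((ρ m).st v).status ≠ .registering := by
  obtain ⟨m, hm, hf⟩ := h.eventually_finished v (((h.inv n).node v).mem (by simp [hn])) n
    (((h.inv n).node v).registering hn).2
  refine ⟨m, hm, fun hr => ?_⟩
  simp [(((h.inv m).node v).registering hr).1] at hf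

end IsRegRun

end

/-! ### Quiescence of a cluster tree and arrival of the Go-Aheads -/

section

open Filter
variable {V : Type*} {G : SimpleGraph V} {T : Cluster G}

namespace IsRegRun

variable {ρ : ℕ → RegConfig V}

/-- Once no node is registering or registered any more, all tree edges stop being dirty. -/
theorem eventually_quiet [Finite V] (h : IsRegRun T ρ)
    (hq : ∀ᶠ n in atTop, ∀ u, ((ρ n).st u).status ≠ .registering ∧
      ((ρ n).st u).status ≠ .registered) :
    ∀ y ∈ T.nodes, ∀ᶠ n in atTop, y ≠ T.root →
      ((ρ n).st y).dirtyUp = false ∧ (ρ n).ch y (T.parent y) = [] := by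
  refine T.induction_up ?_
  intro y hy ih
  by_cases hr : y = T.root
  · simp [hr]
  have hc := Cluster.isChild_parent hy hr
  have hchild : ∀ᶠ n in atTop, ∀ w, T.IsChild y w →
      ((ρ n).st w).dirtyUp = false ∧ (ρ n).ch w y = [] := by
    rw [eventually_all]
    intro w
    by_cases hw : T.IsChild y w
    · filter_upwards [ih w hw] with n hn _
      have := hn hw.2.1
      rwa [hw.2.2] at this
    · simp [hw]
  obtain ⟨N, hN⟩ := eventually_atTop.1 (hchild.and hq)
  -- The local invariant `inner` demands a reason for a dirty upward edge: a dirty child edge, or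
  -- the node itself registering or registered. All three are gone after time `N`.
  have hd : ∀ n, N ≤ n → ((ρ n).st y).dirtyUp = false := by
    intro n hn
    obtain ⟨h1, h2⟩ := hN n hn
    by_contra hd
    rw [Bool.not_eq_false] at hd
    rcases ((h.inv n).node y).inner hr hd with ⟨w, hw⟩ | h3 | h3
    · by_cases hwc : T.IsChild y w
      · have he := (h.inv n).edge w y hwc
        obtain ⟨h3, h4⟩ := h1 w hwc
        simp [EdgeInv, h3, h4, hw] at he
      · simp [((h.inv n).node y).mark_clean w hwc] at hw
    · exact (h2 y).1 h3
    · exact (h2 y).2 h3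
  have hnil : ∀ n, N ≤ n → .cancel ∉ (ρ n).ch y (T.parent y) → (ρ n).ch y (T.parent y) = [] := by
    intro n hn hnc
    have he := (h.inv n).edge y _ hc
    have := hd n hn
    simp only [EdgeInv] at he
    grind
  -- A remaining `cancel` is delivered, and no new one is sent because `y` is no longer dirty.
  have hup : ∃ m, N ≤ m ∧ .cancel ∉ (ρ m).ch y (T.parent y) := by
    by_cases hi : .cancel ∈ (ρ N).ch y (T.parent y)
    · obtain ⟨m, hm, rest, h1, h2, h3⟩ := h.delivered hi
      refine ⟨m + 1, by omega, ?_⟩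
      have he := (h.inv m).edge y _ hc
      rw [h2]
      simp only [EdgeInv, h1] at he
      grind
    · exact ⟨N, le_rfl, hi⟩
  obtain ⟨m, hm, hi⟩ := hup
  have hup : ∀ k, m ≤ k → .cancel ∉ (ρ k).ch y (T.parent y) := by
    intro k hk
    induction k, hk using Nat.le_induction with
    | base => exact hi
    | succ k hk ihk => exact fun hcon => ihk (h.mem_of_cancel (hd k (by omega)) hcon)
  filter_upwards [eventually_ge_atTop m] with n hn _
  exact ⟨hd n (by omega), hnil n (by omega) (hup n hn)⟩

/-- Once no node is registering or registered any more, every deregistered node gets a Go-Ahead. -/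
theorem eventually_free [Finite V] (h : IsRegRun T ρ)
    (hq : ∀ᶠ n in atTop, ∀ u, ((ρ n).st u).status ≠ .registering ∧
      ((ρ n).st u).status ≠ .registered) (v : V) :
    ∀ᶠ n in atTop, ((ρ n).st v).status ≠ .deregistered := by
  have hquiet : ∀ᶠ n in atTop, ∀ z y, T.IsChild z y →
      ((ρ n).st y).dirtyUp = false ∧ (ρ n).ch y z = [] := by
    rw [eventually_all]
    intro z
    rw [eventually_all]
    intro y
    by_cases hw : T.IsChild z y
    · filter_upwards [h.eventually_quiet hq y hw.1] with n hn _
      have := hn hw.2.1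
      rwa [hw.2.2] at this
    · simp [hw]
  -- Descent from the root, which in a quiet tree has no excuse for being pending. If the parent
  -- owes nothing, the edge is not waiting, so a pending child has a `go` in transit; its delivery
  -- settles the debt, and no further `go` enters the channel.
  have key : ∀ y ∈ T.nodes, ∀ᶠ n in atTop, ¬ ((ρ n).st y).Pending := by
    refine T.induction_down ?_ ?_
    · filter_upwards [hquiet, hq] with n h1 h2
      rcases (((h.inv n).node _).root rfl).2 with ⟨w, hw⟩ | h3 | h3
      · by_cases hwc : T.IsChild T.root w
        · have he := (h.inv n).edge w _ hwc
          obtain ⟨h3, h4⟩ := h1 _ w hwc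
          simp [EdgeInv, h3, h4, hw] at he
        · simp [((h.inv n).node _).mark_clean w hwc] at hw
      · exact ((h2 _).2 h3).elim
      · exact h3
    · intro z y hc ih
      obtain ⟨N, hN⟩ := eventually_atTop.1 (hquiet.and ih)
      have hedge : ∀ n, N ≤ n → ((ρ n).st z).mark y ≠ .waiting ∧ (ρ n).ch y z = [] ∧
          ((ρ n).ch z y = [.go] ∨ ¬ ((ρ n).st y).Pending) := by
        intro n hn
        have he := (h.inv n).edge y z hc
        obtain ⟨h1, h2⟩ := hN n hn
        obtain ⟨h3, h4⟩ := h1 z y hc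
        have hw : ((ρ n).st z).mark y ≠ .waiting := fun e => h2 (Or.inr ⟨y, e⟩)
        refine ⟨hw, h4, ?_⟩
        simp only [EdgeInv] at he
        grind
      have hgo : ∃ m, N ≤ m ∧ .go ∉ (ρ m).ch z y := by
        by_cases hi : .go ∈ (ρ N).ch z y
        · obtain ⟨m, hm, rest, h1, h2, h3⟩ := h.delivered hi
          refine ⟨m + 1, by omega, ?_⟩
          have he := (h.inv m).edge y _ hc
          rw [h2]
          simp only [EdgeInv, h1] at he
          grind
        · exact ⟨N, le_rfl, hi⟩
      obtain ⟨m, hm, hi⟩ := hgo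
      have hgo : ∀ k, m ≤ k → .go ∉ (ρ k).ch z y := by
        intro k hk
        induction k, hk using Nat.le_induction with
        | base => exact hi
        | succ k hk ihk =>
          obtain ⟨h1, h2, _⟩ := hedge k (by omega)
          exact fun hcon => ihk (h.mem_of_go h1 h2 hcon)
      filter_upwards [eventually_ge_atTop m] with n hn
      rcases (hedge n (by omega)).2.2 with h1 | h1
      · have := hgo n hn
        simp [h1] at this
      · exact h1
  by_cases hv : v ∈ T.nodes
  · filter_upwards [key v hv] with n hn hs
    exact hn (Or.inl hs)
  · refine Eventually.of_forall fun n hs => hv (((h.inv n).node v).mem ?_)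
    simp [hs]

end IsRegRun

end

section

open Filter
open AsyncAlgorithm
variable {V κ : Type*} {J : ℕ}

/-! ## Transitions of the whole algorithm -/

abbrev Conf (V κ : Type*) := AsyncAlgorithm.Config V (Proc κ) (Msg κ) (NodeState V κ)

/-- The oldest message of a channel is removed. -/
def popChan (c : Conf V κ) (u v : V) (π : Proc κ) (rest : List (Msg κ)) : Conf V κ :=
  { c with chan := fun a b ρ => if a = u ∧ b = v ∧ ρ = π then rest else c.chan a b ρ }

/-- Node `v` enters the state `r.1` and sends the messages `r.2`. -/
def emit (G : SimpleGraph V) (v : V) (r : NodeState V κ × (V → List (Msg κ))) (c : Conf V κ) :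
    Conf V κ where
  state := Function.update c.state v r.1
  chan := fun a b π =>
    if a = v ∧ G.Adj a b then c.chan a b π ++ (r.2 b).filter (fun m => decide (m.proc = π))
    else c.chan a b π

/-- One time step of an execution. -/
inductive Trans (G : SimpleGraph V) (s : V) (t : ℕ) (L : LayeredCover G κ J) (c : Conf V κ) :
    Conf V κ → Prop
  | stay : Trans G s t L c c
  | recv (u v : V) (m : Msg κ) (rest : List (Msg κ)) (h : c.chan u v m.proc = m :: rest)
      (hadj : G.Adj u v) :
      Trans G s t L c
        (emit G v (onReceive G L v u m (c.state v)) (popChan c u v m.proc rest))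
  | act (v : V) (a : Act κ) (r : NodeState V κ × (V → List (Msg κ)))
      (h : onAct G s t L v a (c.state v) = some r) : Trans G s t L c (emit G v r c)

/-- Every message is in the channel of its procedure, and channels follow edges. -/
def ChanOK (G : SimpleGraph V) (c : Conf V κ) : Prop :=
  ∀ a b π m, m ∈ c.chan a b π → m.proc = π ∧ G.Adj a b

variable {G : SimpleGraph V} {s : V} {t : ℕ} {L : LayeredCover G κ J} {c c' : Conf V κ}

theorem ChanOK.emit (h : ChanOK G c) (v : V) (r : NodeState V κ × (V → List (Msg κ))) :
    ChanOK G (emit G v r c) := by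
  intro a b π m hm
  simp only [PulseBFS.emit] at hm
  split_ifs at hm with hab
  · rcases List.mem_append.1 hm with hm | hm
    · exact h a b π m hm
    · simp only [List.mem_filter, decide_eq_true_eq] at hm
      exact ⟨hm.2, hab.2⟩
  · exact h a b π m hm

theorem ChanOK.popChan (h : ChanOK G c) {u v : V} {π : Proc κ} {m : Msg κ} {rest : List (Msg κ)}
    (hm : c.chan u v π = m :: rest) : ChanOK G (popChan c u v π rest) := by
  intro a b π' m' hm'
  simp only [PulseBFS.popChan] at hm'
  split_ifs at hm' with hab
  · refine h a b π' m' ?_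
    rw [hab.1, hab.2.1, hab.2.2, hm]
    exact List.mem_cons_of_mem _ hm'
  · exact h a b π' m' hm'

theorem ChanOK.trans (h : ChanOK G c) (ht : Trans G s t L c c') : ChanOK G c' := by
  cases ht with
  | stay => exact h
  | recv u v m rest hm hadj => exact (h.popChan hm).emit _ _
  | act v a r ha => exact h.emit _ _

theorem trans_of_step (h : ChanOK G c) {e : Event V (Proc κ) (Act κ)}
    (he : step G (algorithm G s t L) c e = some c') : Trans G s t L c c' := by
  cases e with
  | deliver u v π =>
    simp only [step] at he
    split at he
    · simp at he
    · rename_i m rest hm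
      obtain ⟨rfl, hadj⟩ := h u v π m (by simp [hm])
      rw [Option.some.injEq] at he
      subst he
      exact Trans.recv u v m rest hm hadj
  | internal v a =>
    simp only [step, Option.map_eq_some_iff] at he
    obtain ⟨r, hr, rfl⟩ := he
    exact Trans.act v a r hr

section Execution

variable {σ : ℕ → Conf V κ}

theorem exec_chanOK (hσ : IsFairExecution G (algorithm G s t L) σ) (n : ℕ) : ChanOK G (σ n) := by
  induction n with
  | zero => rw [hσ.start]; intro a b π m hm; simp [AsyncAlgorithm.initial] at hm
  | succ n ih =>
    rcases hσ.next n with h | ⟨e, he⟩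
    · rw [h]; exact ih
    · exact ih.trans (trans_of_step ih he)

theorem exec_trans (hσ : IsFairExecution G (algorithm G s t L) σ)
    (n : ℕ) : Trans G s t L (σ n) (σ (n + 1)) := by
  rcases hσ.next n with h | ⟨e, he⟩
  · rw [h]; exact .stay
  · exact trans_of_step (exec_chanOK hσ n) he

/-- An internal action that is enabled is either performed or disabled later. -/
theorem exec_act_fair (hσ : IsFairExecution G (algorithm G s t L) σ)
    (v : V) (a : Act κ) (n : ℕ) : ∃ m, n ≤ m ∧
    (onAct G s t L v a ((σ m).state v) = none ∨
      ∃ r, onAct G s t L v a ((σ m).state v) = some r ∧ σ (m + 1) = emit G v r (σ m)) := by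
  obtain ⟨m, hm, h⟩ := hσ.fair (.internal v a) n
  refine ⟨m, hm, ?_⟩
  rcases h with h | h
  · left
    simpa [step, algorithm] using h
  · right
    simp only [step, Option.map_eq_some_iff] at h
    obtain ⟨r, hr, h⟩ := h
    exact ⟨r, hr, h.symm⟩

theorem exec_recv_fair (hσ : IsFairExecution G (algorithm G s t L) σ)
    (u v : V) (π : Proc κ) (n : ℕ) : ∃ m, n ≤ m ∧
    ((σ m).chan u v π = [] ∨ ∃ x rest, (σ m).chan u v π = x :: rest ∧ x.proc = π ∧ G.Adj u v ∧
      σ (m + 1) = emit G v (onReceive G L v u x ((σ m).state v)) (popChan (σ m) u v π rest)) := by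
  obtain ⟨m, hm, h⟩ := hσ.fair (.deliver u v π) n
  refine ⟨m, hm, ?_⟩
  rcases hc : (σ m).chan u v π with _ | ⟨x, rest⟩
  · exact Or.inl rfl
  · right
    obtain ⟨h1, h2⟩ := exec_chanOK hσ m u v π x (by simp [hc])
    refine ⟨x, rest, rfl, h1, h2, ?_⟩
    rcases h with h | h
    · simp [step, hc] at h
    · simp only [step, hc, Option.some.injEq] at h
      exact h.symm

end Execution

/-! ### The search for the execution tree -/

/-- The part of a configuration that belongs to the search. -/
@[ext] structure SearchConfig (V κ : Type*) where
  pulse : V → Option ℕ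
  parent : V → Option V
  sent : V → Bool
  answer : V → V → Option Bool
  ch : V → V → List (Msg κ)

namespace SearchConfig

def start (s : V) : SearchConfig V κ where
  pulse := fun u => if u = s then some 0 else none
  parent := fun _ => none
  sent := fun _ => false
  answer := fun _ _ => none
  ch := fun _ _ => []

/-- `propose` does not ask for a Go-Ahead. The invariants of the search hold for any timing of the
proposals; only the correctness of pulses depends on the timing. -/
inductive Step (G : SimpleGraph V) (τ : ℕ) (x : SearchConfig V κ) : SearchConfig V κ → Prop
  | stay : Step G τ x x
  | propose (v : V) (k : ℕ) (hp : x.pulse v = some k) (hs : x.sent v = false) (hk : k < τ) :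
      Step G τ x { x with
        sent := Function.update x.sent v true
        ch := fun a b => if a = v ∧ G.Adj a b then x.ch a b ++ [.join k] else x.ch a b }
  | accept (u v : V) (k : ℕ) (rest : List (Msg κ)) (h : x.ch u v = .join k :: rest)
      (hadj : G.Adj u v) (hp : x.pulse v = none) :
      Step G τ x { x with
        pulse := Function.update x.pulse v (some (k + 1))
        parent := Function.update x.parent v (some u)
        ch := fun a b => if a = u ∧ b = v then rest else
          if a = v ∧ b = u then x.ch a b ++ [.answer true] else x.ch a b }
  | decline (u v : V) (k : ℕ) (rest : List (Msg κ)) (h : x.ch u v = .join k :: rest)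
      (hadj : G.Adj u v) (hp : x.pulse v ≠ none) :
      Step G τ x { x with
        ch := fun a b => if a = u ∧ b = v then rest else
          if a = v ∧ b = u then x.ch a b ++ [.answer false] else x.ch a b }
  | answer (u v : V) (e : Bool) (rest : List (Msg κ)) (h : x.ch u v = .answer e :: rest)
      (hadj : G.Adj u v) :
      Step G τ x { x with
        answer := Function.update x.answer v (Function.update (x.answer v) u (some e))
        ch := fun a b => if a = u ∧ b = v then rest else x.ch a b }

end SearchConfig

def searchView (c : Conf V κ) : SearchConfig V κ where
  pulse := fun v => (c.state v).pulse
  parent := fun v => (c.state v).parent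
  sent := fun v => (c.state v).sent
  answer := fun v => (c.state v).answer
  ch := fun a b => c.chan a b .search

theorem searchView_emit (v : V) (r : NodeState V κ × (V → List (Msg κ))) :
    searchView (emit G v r c) =
      { pulse := Function.update (searchView c).pulse v r.1.pulse
        parent := Function.update (searchView c).parent v r.1.parent
        sent := Function.update (searchView c).sent v r.1.sent
        answer := Function.update (searchView c).answer v r.1.answer
        ch := fun a b => if a = v ∧ G.Adj a b then (searchView c).ch a b ++
          (r.2 b).filter (fun m => decide (m.proc = .search)) else (searchView c).ch a b } := by
  ext1
  all_goals first
    | rfl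
    | (funext w; by_cases hw : w = v <;> [subst hw; skip] <;> simp [searchView, emit, *])

theorem searchView_emit_of_frame {v : V} {r : NodeState V κ × (V → List (Msg κ))}
    (h1 : r.1.pulse = (c.state v).pulse) (h2 : r.1.parent = (c.state v).parent)
    (h3 : r.1.sent = (c.state v).sent) (h4 : r.1.answer = (c.state v).answer)
    (h5 : ∀ w, ∀ m ∈ r.2 w, m.proc ≠ .search) : searchView (emit G v r c) = searchView c := by
  have h6 : ∀ w, (r.2 w).filter (fun m => decide (m.proc = .search)) = [] := by
    intro w; simpa using h5 w
  rw [searchView_emit, h1, h2, h3, h4]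
  simp only [h6, List.append_nil, ite_self]
  ext1
  · exact Function.update_eq_self _ _
  · exact Function.update_eq_self _ _
  · exact Function.update_eq_self _ _
  · exact Function.update_eq_self _ _
  · rfl

theorem searchView_popChan {u v : V} {π : Proc κ} {rest : List (Msg κ)} :
    searchView (popChan c u v π rest) = { searchView c with
      ch := fun a b => if a = u ∧ b = v ∧ .search = π then rest else (searchView c).ch a b } := rfl

/-- The projection is exact on proposals and answers, and every other event leaves this part of the
configuration alone. -/
theorem Trans.search (h : Trans G s t L c c') :
    (searchView c).Step G (2 ^ t) (searchView c') := by
  have hof : ∀ {y z : SearchConfig V κ}, (searchView c).Step G (2 ^ t) y → z = y →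
      (searchView c).Step G (2 ^ t) z := fun h e => e ▸ h
  have hstay : ∀ {c' : Conf V κ}, searchView c' = searchView c →
      (searchView c).Step G (2 ^ t) (searchView c') := fun h => hof .stay h
  cases h with
  | stay => exact .stay
  | recv u v m rest hm hadj =>
    have hne : ¬ (v = u) := fun e => G.loopless.irrefl _ (e ▸ hadj)
    cases m with
    | join k =>
      by_cases hp : (c.state v).pulse = none
      · refine hof (SearchConfig.Step.accept (τ := 2 ^ t) (x := searchView c) u v k rest hm hadj hp) ?_
        rw [searchView_emit, searchView_popChan]
        simp only [onReceive, hp, if_true, Msg.proc]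
        ext1
        · rfl
        · rfl
        · exact Function.update_eq_self _ _
        · exact Function.update_eq_self _ _
        · funext a b
          by_cases ha : a = v <;> by_cases hb : b = u <;> simp [ha, hb, hadj.symm, hne]
      · refine hof (SearchConfig.Step.decline (τ := 2 ^ t) (x := searchView c) u v k rest hm hadj hp) ?_
        rw [searchView_emit, searchView_popChan]
        simp only [onReceive, hp, if_false, Msg.proc]
        ext1
        · exact Function.update_eq_self _ _
        · exact Function.update_eq_self _ _
        · exact Function.update_eq_self _ _
        · exact Function.update_eq_self _ _
        · funext a b
          by_cases ha : a = v <;> by_cases hb : b = u <;> simp [ha, hb, hadj.symm, hne]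
    | answer e =>
      refine hof (SearchConfig.Step.answer (τ := 2 ^ t) (x := searchView c) u v e rest hm hadj) ?_
      rw [searchView_emit, searchView_popChan]
      simp only [onReceive, Msg.proc]
      ext1
      · exact Function.update_eq_self _ _
      · exact Function.update_eq_self _ _
      · exact Function.update_eq_self _ _
      · rfl
      · simp
    | report p e =>
      apply hstay
      rw [searchView_emit_of_frame] <;> simp [onReceive, popChan, searchView, Msg.proc]
    | goAhead p =>
      apply hstay
      rw [searchView_emit_of_frame] <;>
        simp +contextual [onReceive, popChan, searchView, Msg.proc, NodeState.takeGoAhead]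
    | reg p d sig =>
      apply hstay
      rw [searchView_emit_of_frame] <;>
        simp [onReceive, popChan, searchView, Msg.proc, NodeState.withReg]
    | checkUp d =>
      apply hstay
      rw [searchView_emit_of_frame] <;> simp [onReceive, popChan, searchView, Msg.proc]
    | checkDown d =>
      apply hstay
      rw [searchView_emit_of_frame] <;>
        simp [onReceive, popChan, searchView, Msg.proc, NodeState.takeConfirmation]
  | act v a r h =>
    cases a with
    | propose =>
      simp only [onAct] at h
      split at h
      · simp at h
      · rename_i k hk
        rw [Option.ite_none_right_eq_some, Option.some.injEq] at h
        obtain ⟨⟨h1, h2, h3⟩, rfl⟩ := h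
        refine hof (SearchConfig.Step.propose (τ := 2 ^ t) (x := searchView c) v k hk h1 h2) ?_
        rw [searchView_emit]
        ext1
        · exact Function.update_eq_self _ _
        · exact Function.update_eq_self _ _
        · rfl
        · exact Function.update_eq_self _ _
        · funext a b
          by_cases hab : a = v ∧ G.Adj a b
          · obtain ⟨rfl, hb⟩ := hab
            simp [hb, Msg.proc]
          · simp [hab]
    | _ =>
      simp only [onAct] at h
      rw [Option.ite_none_right_eq_some, Option.some.injEq] at h
      obtain ⟨_, rfl⟩ := h
      apply hstay
      apply searchView_emit_of_frame <;>
        simp +contextual [Msg.proc, NodeState.withReg, NodeState.takeGoAhead,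
          NodeState.takeConfirmation]

end

/-! ### The search invariant -/

section

open Filter
variable {V κ : Type*} {G : SimpleGraph V} {s : V}

def Msg.isJoin : Msg κ → Bool
  | .join _ => true
  | _ => false

def Msg.isAnswer : Msg κ → Bool
  | .answer _ => true
  | _ => false

@[simp] theorem Msg.isJoin_join (k : ℕ) : (Msg.join k : Msg κ).isJoin = true := rfl
@[simp] theorem Msg.isJoin_answer (e : Bool) : (Msg.answer e : Msg κ).isJoin = false := rfl
@[simp] theorem Msg.isAnswer_join (k : ℕ) : (Msg.join k : Msg κ).isAnswer = false := rfl
@[simp] theorem Msg.isAnswer_answer (e : Bool) : (Msg.answer e : Msg κ).isAnswer = true := rfl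

/-- Invariants of the search. -/
structure SearchInv (G : SimpleGraph V) (s : V) (τ : ℕ) (x : SearchConfig V κ) : Prop where
  adj : ∀ a b, ∀ m ∈ x.ch a b, G.Adj a b
  /-- every proposal is either on its way, or answered with the answer on its way or received -/
  count : ∀ u v, (x.ch u v).countP Msg.isJoin + (x.ch v u).countP Msg.isAnswer +
    (if x.answer u v = none then 0 else 1) = if x.sent u = true ∧ G.Adj u v then 1 else 0
  join : ∀ u v k, .join k ∈ x.ch u v → x.pulse u = some k
  answer_chan : ∀ u v e, .answer e ∈ x.ch v u →
    x.pulse v ≠ none ∧ (e = true ↔ x.parent v = some u)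
  answer_eq : ∀ u v e, x.answer u v = some e →
    x.pulse v ≠ none ∧ (e = true ↔ x.parent v = some u)
  parent : ∀ u v, x.parent v = some u → ∃ k, x.pulse u = some k ∧ x.pulse v = some (k + 1) ∧
    x.sent u = true ∧ G.Adj u v ∧ (x.ch u v).countP Msg.isJoin = 0
  source : x.pulse s = some 0 ∧ x.parent s = none
  orphan : ∀ v, x.parent v = none → v ≠ s → x.pulse v = none
  sent : ∀ v, x.sent v = true → ∃ k, x.pulse v = some k ∧ k < τ

variable {τ : ℕ} {x y : SearchConfig V κ}

theorem SearchInv.start (G : SimpleGraph V) (s : V) (τ : ℕ) :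
    SearchInv G s τ (SearchConfig.start s : SearchConfig V κ) := by
  constructor <;> simp +contextual [SearchConfig.start]

/-- The equation `count` carries the argument: a proposal along an ordered edge is a single token,
which is successively a `join` in transit, an `answer` in transit and a recorded answer. Seeing the
token in one form excludes the other two. -/
theorem SearchInv.step (h : SearchInv G s τ x) (hs : x.Step G τ y) : SearchInv G s τ y := by
  obtain ⟨h1, h2, h3, h4, h5, h6, h7, h8, h9⟩ := h
  cases hs with
  | stay => exact ⟨h1, h2, h3, h4, h5, h6, h7, h8, h9⟩
  | propose v k hp hs hk =>
    constructor
    · intro a b m hm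
      simp only at hm
      split_ifs at hm with hab
      · exact hab.2
      · exact h1 a b m hm
    · intro a b
      have := h2 a b
      by_cases ha : a = v
      · subst ha
        by_cases hb : G.Adj a b
        · have hba := hb.ne'
          simp only [hs, hb, hba, Function.update_self, and_self, true_and, and_true, false_and,
            if_true, if_false, List.countP_append, List.countP_cons, List.countP_nil,
            Msg.isJoin_join, Bool.false_eq_true] at this ⊢
          omega
        · have hb' : ¬ G.Adj b a := fun h => hb h.symm
          simp only [hs, hb, hb', and_false, if_false, Bool.false_eq_true] at this ⊢
          exact this
      · by_cases hb : b = v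
        · subst hb
          simp only [ha, false_and, if_false, Function.update_of_ne ha, ← this]
          split_ifs <;> simp
        · simpa [ha, hb] using this
    · intro a b k' hm
      simp only at hm
      split_ifs at hm with hab
      · rcases List.mem_append.1 hm with hm | hm
        · exact h3 a b k' hm
        · simp at hm; rw [hab.1, hm]; exact hp
      · exact h3 a b k' hm
    · intro a b e hm
      refine h4 a b e ?_
      simp only at hm
      split_ifs at hm with hab
      · simpa using hm
      · exact hm
    · exact h5
    · intro a b hab
      obtain ⟨k', a1, a2, a3, a4, a5⟩ := h6 a b hab
      have hav : a ≠ v := by rintro rfl; simp [hs] at a3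
      exact ⟨k', a1, a2, by simpa [hav] using a3, a4, by simpa [hav] using a5⟩
    · exact h7
    · exact h8
    · intro w hw
      by_cases hwv : w = v
      · exact ⟨k, hwv ▸ hp, hk⟩
      · exact h9 w (by simpa [hwv] using hw)
  | accept u v k rest hm hadj hp =>
    have huv : u ≠ v := hadj.ne
    have hvs : v ≠ s := by rintro rfl; simp [h7.1] at hp
    have hpar : x.parent v = none := by
      by_contra hne
      obtain ⟨w, hw⟩ := Option.ne_none_iff_exists'.1 hne
      obtain ⟨_, _, a2, _⟩ := h6 w v hw
      simp [hp] at a2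
    have hpu : x.pulse u = some k := h3 u v k (by simp [hm])
    have hcount := h2 u v
    rw [hm] at hcount
    simp only [List.countP_cons, Msg.isJoin_join, if_true] at hcount
    -- The token of `(u, v)` is the `join` being delivered, so there is no second `join` and no
    -- answer to it yet.
    obtain ⟨hsent, hanswer, hrest, hans⟩ : x.sent u = true ∧ x.answer u v = none ∧
        rest.countP Msg.isJoin = 0 ∧ (x.ch v u).countP Msg.isAnswer = 0 := by
      split_ifs at hcount with c1 c2 c2
      · exact ⟨c2.1, c1, by omega, by omega⟩
      all_goals omega
    have hno : ∀ e, .answer e ∉ x.ch v u := by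
      rw [List.countP_eq_zero] at hans
      intro e he
      simpa using hans _ he
    -- A node without a pulse has never answered anyone, so the new parent contradicts no earlier
    -- answer of `v`.
    have hno' : ∀ w e, x.answer w v ≠ some e := by
      intro w e he
      exact (h5 w v e he).1 hp
    have hno'' : ∀ w e, .answer e ∉ x.ch v w := fun w e he => (h4 w v e he).1 hp
    constructor
    · intro a b m hm'
      simp only at hm'
      split_ifs at hm' with hab hab'
      · exact hab.1 ▸ hab.2 ▸ hadj
      · exact hab'.1 ▸ hab'.2 ▸ hadj.symm
      · exact h1 a b m hm'
    · intro a b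
      have hab := h2 a b
      by_cases c1 : a = u ∧ b = v
      · obtain ⟨rfl, rfl⟩ := c1
        rw [hm] at hab
        simp only [huv, huv.symm, and_self, if_true, if_false, List.countP_append,
          List.countP_cons, List.countP_nil, Msg.isJoin_join, Msg.isAnswer_join,
          Msg.isJoin_answer, Msg.isAnswer_answer, Bool.false_eq_true] at hab ⊢
        omega
      · by_cases c2 : a = v ∧ b = u
        · obtain ⟨rfl, rfl⟩ := c2
          rw [hm] at hab
          simp only [huv, huv.symm, and_self, if_true, if_false, List.countP_append,
            List.countP_cons, List.countP_nil, Msg.isJoin_join, Msg.isAnswer_join,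
            Msg.isJoin_answer, Msg.isAnswer_answer, Bool.false_eq_true] at hab ⊢
          omega
        · simp only [c1, c2, if_false, and_comm (a := b = u), and_comm (a := b = v)]
          exact hab
    · intro a b k' hm'
      have hold : x.pulse a = some k' := by
        simp only at hm'
        split_ifs at hm' with hab hab'
        · exact h3 a b k' (by rw [hab.1, hab.2, hm]; exact List.mem_cons_of_mem _ hm')
        · exact h3 a b k' (by simpa using hm')
        · exact h3 a b k' hm'
      have : a ≠ v := by rintro rfl; simp [hp] at hold
      simpa [this] using hold
    · intro a b e hm'
      by_cases hbv : b = v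
      · subst hbv
        simp only [huv.symm, false_and, if_false, true_and] at hm'
        split_ifs at hm' with hab
        · simp [hno'' a e] at hm'
          simp [hm', hab]
        · exact absurd hm' (hno'' a e)
      · have hold : .answer e ∈ x.ch b a := by
          simp only [hbv, false_and, if_false] at hm'
          split_ifs at hm' with hab
          · rw [hab.1, hab.2, hm]; exact List.mem_cons_of_mem _ hm'
          · exact hm'
        simpa [hbv] using h4 a b e hold
    · intro a b e he
      have hbv : b ≠ v := by rintro rfl; exact hno' a e he
      simpa [hbv] using h5 a b e he
    · intro a b hab
      by_cases hbv : b = v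
      · subst hbv
        simp only [Function.update_self, Option.some.injEq] at hab
        subst hab
        exact ⟨k, by simpa [huv] using hpu, by simp, hsent, hadj, by simpa using hrest⟩
      · simp only [Function.update_of_ne hbv] at hab
        obtain ⟨k', a1, a2, a3, a4, a5⟩ := h6 a b hab
        have hav : a ≠ v := by rintro rfl; simp [hp] at a1
        exact ⟨k', by simpa [hav] using a1, by simpa [hbv] using a2, a3, a4,
          by simpa [hav, hbv] using a5⟩
    · simpa [hvs.symm] using h7
    · intro w hw hws
      by_cases hwv : w = v
      · subst hwv; simp at hw
      · simp only [Function.update_of_ne hwv] at hw ⊢; exact h8 w hw hws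
    · intro w hw
      obtain ⟨k', a1, a2⟩ := h9 w hw
      have : w ≠ v := by rintro rfl; simp [hp] at a1
      exact ⟨k', by simpa [this] using a1, a2⟩
  | decline u v k rest hm hadj hp =>
    have huv : u ≠ v := hadj.ne
    have hcount := h2 u v
    rw [hm] at hcount
    simp only [List.countP_cons, Msg.isJoin_join, if_true] at hcount
    -- The parent's proposal has been consumed, whereas that of `u` is still in the channel; hence
    -- the answer `false` is consistent.
    have hparent : x.parent v ≠ some u := by
      intro hc
      obtain ⟨_, _, _, _, _, a5⟩ := h6 u v hc
      simp [hm] at a5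
    constructor
    · intro a b m hm'
      simp only at hm'
      split_ifs at hm' with hab hab'
      · exact hab.1 ▸ hab.2 ▸ hadj
      · exact hab'.1 ▸ hab'.2 ▸ hadj.symm
      · exact h1 a b m hm'
    · intro a b
      have hab := h2 a b
      by_cases c1 : a = u ∧ b = v
      · obtain ⟨rfl, rfl⟩ := c1
        rw [hm] at hab
        simp only [huv, huv.symm, and_self, if_true, if_false, List.countP_append,
          List.countP_cons, List.countP_nil, Msg.isJoin_join, Msg.isAnswer_join,
          Msg.isJoin_answer, Msg.isAnswer_answer, Bool.false_eq_true] at hab ⊢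
        omega
      · by_cases c2 : a = v ∧ b = u
        · obtain ⟨rfl, rfl⟩ := c2
          rw [hm] at hab
          simp only [huv, huv.symm, and_self, if_true, if_false, List.countP_append,
            List.countP_cons, List.countP_nil, Msg.isJoin_join, Msg.isAnswer_join,
            Msg.isJoin_answer, Msg.isAnswer_answer, Bool.false_eq_true] at hab ⊢
          omega
        · simp only [c1, c2, if_false, and_comm (a := b = u), and_comm (a := b = v)]
          exact hab
    · intro a b k' hm'
      simp only at hm'
      split_ifs at hm' with hab hab'
      · exact h3 a b k' (by rw [hab.1, hab.2, hm]; exact List.mem_cons_of_mem _ hm')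
      · exact h3 a b k' (by simpa using hm')
      · exact h3 a b k' hm'
    · intro a b e hm'
      simp only at hm'
      split_ifs at hm' with hab hab'
      · exact h4 a b e (by rw [hab.1, hab.2, hm]; exact List.mem_cons_of_mem _ hm')
      · rcases List.mem_append.1 hm' with hm' | hm'
        · exact h4 a b e hm'
        · simp at hm'
          rw [hab'.1, hab'.2, hm']
          exact ⟨hp, by simpa using hparent⟩
      · exact h4 a b e hm'
    · exact h5
    · intro a b hab
      obtain ⟨k', a1, a2, a3, a4, a5⟩ := h6 a b hab
      refine ⟨k', a1, a2, a3, a4, ?_⟩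
      simp only
      split_ifs with c1 c2
      · exact (hparent (c1.1 ▸ c1.2 ▸ hab)).elim
      · simpa using a5
      · exact a5
    · exact h7
    · exact h8
    · exact h9
  | answer u v e rest hm hadj =>
    have huv : u ≠ v := hadj.ne
    have hcount := h2 v u
    rw [hm] at hcount
    simp only [List.countP_cons, Msg.isAnswer_answer, if_true] at hcount
    -- The token is in transit as an answer, so nothing has been recorded and nothing will be
    -- overwritten.
    have hanswer : x.answer v u = none := by
      by_contra hc
      rw [if_neg hc] at hcount
      split_ifs at hcount <;> omega
    have hsub : ∀ a b m, (m ∈ if a = u ∧ b = v then rest else x.ch a b) → m ∈ x.ch a b := by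
      intro a b m hm'
      split_ifs at hm' with hab
      · rw [hab.1, hab.2, hm]; exact List.mem_cons_of_mem _ hm'
      · exact hm'
    constructor
    · exact fun a b m hm' => h1 a b m (hsub _ _ _ hm')
    · intro a b
      have hab := h2 a b
      by_cases c1 : a = u ∧ b = v
      · obtain ⟨rfl, rfl⟩ := c1
        rw [hm] at hab
        simp only [huv, huv.symm, Function.update_of_ne huv, and_self, if_true, if_false, List.countP_append,
          List.countP_cons, List.countP_nil, Msg.isJoin_join, Msg.isAnswer_join,
          Msg.isJoin_answer, Msg.isAnswer_answer, Bool.false_eq_true] at hab ⊢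
        omega
      · by_cases c2 : a = v ∧ b = u
        · obtain ⟨rfl, rfl⟩ := c2
          rw [hm] at hab
          simp only [huv, huv.symm, hanswer, and_self, if_true, if_false, List.countP_append,
            List.countP_cons, List.countP_nil, Msg.isJoin_join, Msg.isAnswer_join,
            Msg.isJoin_answer, Msg.isAnswer_answer, Bool.false_eq_true, Function.update_self,
            reduceCtorEq] at hab ⊢
          omega
        · have c3 : Function.update x.answer v (Function.update (x.answer v) u (some e)) a b =
              x.answer a b := by
            by_cases hav : a = v
            · subst hav
              have : b ≠ u := fun e => c2 ⟨rfl, e⟩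
              simp [this]
            · simp [hav]
          simp only [c1, c2, c3, if_false, and_comm (a := b = u), and_comm (a := b = v)]
          exact hab
    · exact fun a b k' hm' => h3 a b k' (hsub _ _ _ hm')
    · exact fun a b k' hm' => h4 a b k' (hsub _ _ _ hm')
    · intro a b e' he
      by_cases c2 : a = v ∧ b = u
      · obtain ⟨rfl, rfl⟩ := c2
        simp at he
        subst he
        exact h4 a b e (by simp [hm])
      · refine h5 a b e' ?_
        by_cases hav : a = v
        · subst hav
          have : b ≠ u := fun e => c2 ⟨rfl, e⟩
          simpa [this] using he
        · simpa [hav] using he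
    · intro a b hab
      obtain ⟨k', a1, a2, a3, a4, a5⟩ := h6 a b hab
      refine ⟨k', a1, a2, a3, a4, ?_⟩
      rw [List.countP_eq_zero] at a5 ⊢
      exact fun m hm' => a5 m (hsub _ _ _ hm')
    · exact h7
    · exact h8
    · exact h9

end

/-! ### Monotonicity of the search, and projections to the single registrations -/

section

open Filter
open AsyncAlgorithm
variable {V κ : Type*} {J : ℕ} {G : SimpleGraph V} {s : V} {t : ℕ} {L : LayeredCover G κ J}
  {c c' : Conf V κ}

/-- Pulses, parents, proposals and answers never change again. -/
structure SearchMono (x y : SearchConfig V κ) : Prop where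
  pulse : ∀ v k, x.pulse v = some k → y.pulse v = some k
  parent : ∀ v, x.pulse v ≠ none → y.parent v = x.parent v
  sent : ∀ v, x.sent v = true → y.sent v = true
  answer : ∀ u v e, x.answer u v = some e → y.answer u v = some e

theorem SearchInv.mono {τ : ℕ} {x y : SearchConfig V κ} (h : SearchInv G s τ x)
    (hs : x.Step G τ y) : SearchMono x y := by
  cases hs with
  | stay => exact ⟨fun _ _ h => h, fun _ _ => rfl, fun _ h => h, fun _ _ _ h => h⟩
  | propose v k hp hs hk =>
    refine ⟨fun _ _ h => h, fun _ _ => rfl, fun w h => ?_, fun _ _ _ h => h⟩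
    by_cases hw : w = v <;> simp [hw, h]
  | accept u v k rest hm hadj hp =>
    refine ⟨fun w k h => ?_, fun w h => ?_, fun _ h => h, fun _ _ _ h => h⟩
    · have : w ≠ v := by rintro rfl; simp [hp] at h
      simpa [this] using h
    · have : w ≠ v := by rintro rfl; exact h hp
      simp [this]
  | decline u v k rest hm hadj hp =>
    exact ⟨fun _ _ h => h, fun _ _ => rfl, fun _ h => h, fun _ _ _ h => h⟩
  | answer u v e rest hm hadj =>
    refine ⟨fun _ _ h => h, fun _ _ => rfl, fun _ h => h, fun a b e' h' => ?_⟩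
    have hcount := h.count v u
    rw [hm] at hcount
    simp only [List.countP_cons, Msg.isAnswer_answer, if_true] at hcount
    -- An answer that arrives and one already recorded would be two tokens for one proposal.
    have hne : ¬ (a = v ∧ b = u) := by
      rintro ⟨rfl, rfl⟩
      simp only [h', reduceCtorEq, if_false] at hcount
      split_ifs at hcount <;> omega
    by_cases hav : a = v
    · subst hav
      have : b ≠ u := fun e => hne ⟨rfl, e⟩
      simpa [this] using h'
    · simpa [hav] using h'

/-! ### The registration processes as parts of the algorithm -/

def Msg.sig : Msg κ → Option RegSignal
  | .reg _ _ x => some x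
  | _ => none

/-- The part of a configuration that belongs to the registration for pulse `p` in cluster `d`. -/
def regView (p : ℕ) (d : κ) (c : Conf V κ) : RegConfig V where
  st := fun v => (c.state v).reg p d
  ch := fun a b => (c.chan a b (.reg p d)).filterMap Msg.sig

theorem regView_emit (p : ℕ) (d : κ) (v : V) (r : NodeState V κ × (V → List (Msg κ))) :
    regView p d (emit G v r c) = (regView p d c).send G v (r.1.reg p d, fun b =>
      ((r.2 b).filter (fun m => decide (m.proc = .reg p d))).filterMap Msg.sig) := by
  ext1
  · funext w
    by_cases hw : w = v <;> [subst hw; skip] <;> simp [regView, emit, RegConfig.send, *]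
  · funext a b
    simp only [regView, emit, RegConfig.send]
    split_ifs <;> simp

theorem regView_popChan (p : ℕ) (d : κ) {u v : V} {π : Proc κ} {rest : List (Msg κ)}
    (hne : π ≠ .reg p d) : regView p d (popChan c u v π rest) = regView p d c := by
  simp [regView, popChan, hne.symm]

theorem regView_popChan_self (p : ℕ) (d : κ) {u v : V} {rest : List (Msg κ)} :
    regView p d (popChan c u v (.reg p d) rest) =
      (regView p d c).pop u v (rest.filterMap Msg.sig) := by
  ext1
  · rfl
  · funext a b
    simp only [regView, popChan, RegConfig.pop, and_true]
    split_ifs <;> rfl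

theorem regView_emit_of_frame (p : ℕ) (d : κ) {v : V} {r : NodeState V κ × (V → List (Msg κ))}
    (h1 : r.1.reg p d = (c.state v).reg p d) (h5 : ∀ w, ∀ m ∈ r.2 w, m.proc ≠ .reg p d) :
    regView p d (emit G v r c) = regView p d c := by
  have h6 : ∀ w, (r.2 w).filter (fun m => decide (m.proc = .reg p d)) = [] := by
    intro w; simpa using h5 w
  rw [regView_emit, h1]
  simp only [h6, RegConfig.send, List.filterMap_nil, List.append_nil, ite_self]
  ext1
  · exact Function.update_eq_self _ _
  · rfl

theorem regView_withReg (p : ℕ) (d : κ) (v : V) (x : NodeState V κ)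
    (r : RegState V × (V → List RegSignal)) :
    regView p d (emit G v (x.withReg p d r) c) = (regView p d c).send G v r := by
  rw [regView_emit]
  simp only [NodeState.withReg, Function.update_self]
  congr 2
  funext b
  induction r.2 b with
  | nil => rfl
  | cons y l ih => simpa [Msg.proc, Msg.sig] using ih

theorem regView_withReg_of_ne (p : ℕ) (d : κ) (v : V) (p' : ℕ) (d' : κ)
    (hne : ¬ (p' = p ∧ d' = d)) (r : RegState V × (V → List RegSignal)) :
    regView p d (emit G v ((c.state v).withReg p' d' r) c) = regView p d c := by
  apply regView_emit_of_frame
  · simp only [NodeState.withReg]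
    by_cases hp : p = p'
    · subst hp
      have : d ≠ d' := fun e => hne ⟨rfl, e.symm⟩
      simp [this]
    · simp [hp]
  · intro w m hm
    simp only [NodeState.withReg, List.mem_map] at hm
    obtain ⟨y, _, rfl⟩ := hm
    simpa [Msg.proc] using hne

theorem regView_recv (p : ℕ) (d : κ) {u v : V} {y : RegSignal} {rest : List (Msg κ)} :
    regView p d (emit G v (onReceive G L v u (.reg p d y) (c.state v))
        (popChan c u v (.reg p d) rest)) =
      ((regView p d c).pop u v (rest.filterMap Msg.sig)).send G v
        (((regView p d c).st v).receive (L.cluster d) v u y) := by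
  simp only [onReceive]
  rw [regView_withReg, regView_popChan_self]
  rfl

theorem Trans.reg (p : ℕ) (d : κ) (h : Trans G s t L c c') :
    RegConfig.Step (L.cluster d) (regView p d c) (regView p d c') := by
  have hof : ∀ {y z : RegConfig V}, RegConfig.Step (L.cluster d) (regView p d c) y → z = y →
      RegConfig.Step (L.cluster d) (regView p d c) z := fun h e => e ▸ h
  cases h with
  | stay => exact .stay
  | recv u v m rest hm hadj =>
    cases m with
    | reg p' d' y =>
      by_cases hpd : p' = p ∧ d' = d
      · obtain ⟨rfl, rfl⟩ := hpd
        refine hof (.deliver u v y (rest.filterMap Msg.sig) ?_) (regView_recv p' d')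
        simp only [Msg.proc] at hm
        simp [regView, hm, Msg.sig]
      · have hne : (Msg.reg p' d' y : Msg κ).proc ≠ .reg p d := by simpa [Msg.proc] using hpd
        have := regView_withReg_of_ne (G := G)
          (c := popChan c u v (Msg.reg p' d' y : Msg κ).proc rest) p d v p' d' hpd
            (((c.state v).reg p' d').receive (L.cluster d') v u y)
        rw [regView_popChan p d hne] at this
        exact hof .stay this
    | join k =>
      refine hof .stay ?_
      by_cases hp : (c.state v).pulse = none
      · rw [regView_emit_of_frame, regView_popChan] <;>
          simp +contextual [onReceive, hp, popChan, Msg.proc]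
      · rw [regView_emit_of_frame, regView_popChan] <;>
          simp +contextual [onReceive, hp, popChan, Msg.proc]
    | _ =>
      refine hof .stay ?_
      rw [regView_emit_of_frame, regView_popChan] <;>
        simp +contextual [onReceive, popChan, Msg.proc, NodeState.takeGoAhead,
          NodeState.takeConfirmation]
  | act v a r h =>
    cases a with
    | propose =>
      simp only [onAct] at h
      split at h
      · simp at h
      · rw [Option.ite_none_right_eq_some, Option.some.injEq] at h
        obtain ⟨_, rfl⟩ := h
        refine hof .stay ?_
        apply regView_emit_of_frame <;> simp +contextual [Msg.proc]
    | register p' d' =>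
      simp only [onAct] at h
      rw [Option.ite_none_right_eq_some, Option.some.injEq] at h
      obtain ⟨⟨_, _, _, h4, h5, _⟩, rfl⟩ := h
      by_cases hpd : p' = p ∧ d' = d
      · obtain ⟨rfl, rfl⟩ := hpd
        exact hof (.register v h4.2 h5) (regView_withReg _ _ _ _ _)
      · exact hof .stay (regView_withReg_of_ne _ _ _ _ _ hpd _)
    | deregister p' d' =>
      simp only [onAct] at h
      rw [Option.ite_none_right_eq_some, Option.some.injEq] at h
      obtain ⟨⟨_, _, _, h4, h5, _⟩, rfl⟩ := h
      by_cases hpd : p' = p ∧ d' = d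
      · obtain ⟨rfl, rfl⟩ := hpd
        exact hof (.deregister v h4.2 h5) (regView_withReg _ _ _ _ _)
      · exact hof .stay (regView_withReg_of_ne _ _ _ _ _ hpd _)
    | _ =>
      simp only [onAct] at h
      rw [Option.ite_none_right_eq_some, Option.some.injEq] at h
      obtain ⟨_, rfl⟩ := h
      refine hof .stay ?_
      apply regView_emit_of_frame <;>
        simp +contextual [Msg.proc, NodeState.takeGoAhead, NodeState.takeConfirmation]

section Execution

variable {σ : ℕ → Conf V κ}

theorem exec_search (hσ : IsFairExecution G (algorithm G s t L) σ) (n : ℕ) :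
    SearchInv G s (2 ^ t) (searchView (σ n)) := by
  induction n with
  | zero =>
    rw [hσ.start]
    exact SearchInv.start G s (2 ^ t)
  | succ n ih => exact ih.step (exec_trans hσ n).search

/-- Each registration has channels of its own, so the head of the projected channel is the head of
the real one, and fairness of deliveries carries over. No fairness is required of the members'
decisions to register or deregister. -/
theorem exec_reg (hσ : IsFairExecution G (algorithm G s t L) σ) (p : ℕ) (d : κ) :
    IsRegRun (L.cluster d) (fun n => regView p d (σ n)) where
  start := by rw [hσ.start]; rfl
  next n := (exec_trans hσ n).reg p d
  fair u v n := by
    obtain ⟨m, hm, h⟩ := exec_recv_fair hσ u v (.reg p d) n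
    refine ⟨m, hm, ?_⟩
    rcases h with h | ⟨x, rest, h1, h2, h3, h4⟩
    · left; simp [regView, h]
    · right
      cases x with
      | reg p' d' y =>
        simp only [Msg.proc, Proc.reg.injEq] at h2
        obtain ⟨rfl, rfl⟩ := h2
        refine ⟨y, rest.filterMap Msg.sig, by simp [regView, h1, Msg.sig], ?_⟩
        simp only [h4]
        exact regView_recv p' d'
      | _ => simp [Msg.proc] at h2

end Execution

end

section

open Filter
open AsyncAlgorithm
variable {V κ : Type*} {J : ℕ} {G : SimpleGraph V} {s : V} {t : ℕ} {L : LayeredCover G κ J}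
  {c c' : Conf V κ}

/-! ### Reports along the execution tree -/

/-- The part of a configuration that belongs to the reports for pulse `p`. -/
@[ext] structure ReportConfig (V κ : Type*) where
  reported : V → Bool
  /-- `report u w` is what `u` knows from `w` -/
  report : V → V → Option Bool
  ch : V → V → List (Msg κ)

def reportView (p : ℕ) (c : Conf V κ) : ReportConfig V κ where
  reported := fun v => (c.state v).reported p
  report := fun u w => (c.state u).report w p
  ch := fun a b => c.chan a b (.safety p)

/-- Unlike the views of search and registration, this one is not a closed system: sending a report
depends on safety, emptiness and registrations, so the step relation starts from the whole
configuration. -/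
inductive ReportStep (G : SimpleGraph V) (t : ℕ) (L : LayeredCover G κ J) (p : ℕ) (c : Conf V κ) :
    ReportConfig V κ → Prop
  | stay : ReportStep G t L p c (reportView p c)
  | send (v : V) (h0 : (c.state v).reported p = false) (hp : p ≤ 2 ^ t)
      (h1 : ∃ k, (c.state v).pulse = some k ∧ prev (prev p) < k ∧ k ≤ p)
      (h2 : (c.state v).KnowsSafe G v p)
      (h3 : (c.state v).KnowsEmpty G v p ∨ ∀ q, 0 < q → q ≤ 2 ^ t → prev q = p →
        (c.state v).pulse = some (prev (prev q)) → (c.state v).IsRegistered L v q) :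
      ReportStep G t L p c { reportView p c with
        reported := Function.update (reportView p c).reported v true
        ch := fun a b => if a = v ∧ G.Adj a b then (reportView p c).ch a b ++
            (if (c.state v).parent = some b then
              [.report p (decide ((c.state v).KnowsEmpty G v p))] else [])
          else (reportView p c).ch a b }
  | recv (u v : V) (e : Bool) (rest : List (Msg κ))
      (h : (reportView p c).ch u v = .report p e :: rest) :
      ReportStep G t L p c { reportView p c with
        report := fun a b => if a = v ∧ b = u then some e else (reportView p c).report a b
        ch := fun a b => if a = u ∧ b = v then rest else (reportView p c).ch a b }

theorem reportView_emit_of_frame (p : ℕ) {v : V} {r : NodeState V κ × (V → List (Msg κ))}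
    (h1 : r.1.reported p = (c.state v).reported p)
    (h2 : ∀ w, r.1.report w p = (c.state v).report w p)
    (h5 : ∀ w, ∀ m ∈ r.2 w, m.proc ≠ .safety p) :
    reportView p (emit G v r c) = reportView p c := by
  have h6 : ∀ w, (r.2 w).filter (fun m => decide (m.proc = .safety p)) = [] := by
    intro w; simpa using h5 w
  ext1
  · funext w
    by_cases hw : w = v <;> [subst hw; skip] <;> simp [reportView, emit, *]
  · funext w z
    by_cases hw : w = v <;> [subst hw; skip] <;> simp [reportView, emit, *]
  · funext a b
    simp [reportView, emit, h6]

theorem reportView_popChan (p : ℕ) {u v : V} {π : Proc κ} {rest : List (Msg κ)}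
    (hne : π ≠ .safety p) : reportView p (popChan c u v π rest) = reportView p c := by
  simp [reportView, popChan, hne.symm]

theorem Trans.report (p : ℕ) (h : Trans G s t L c c') :
    ReportStep G t L p c (reportView p c') := by
  have hof : ∀ {y z : ReportConfig V κ}, ReportStep G t L p c y → z = y →
      ReportStep G t L p c z := fun h e => e ▸ h
  cases h with
  | stay => exact .stay
  | recv u v m rest hm hadj =>
    cases m with
    | report p' e =>
      by_cases hpp : p' = p
      · subst hpp
        refine hof (.recv u v e rest hm) ?_
        ext1
        · funext w
          by_cases hw : w = v <;> [subst hw; skip] <;>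
            simp [reportView, emit, onReceive, popChan, *]
        · funext w z
          by_cases hw : w = v
          · subst hw
            by_cases hz : z = u
            · subst hz
              simp [reportView, emit, onReceive, popChan]
            · simp [reportView, emit, onReceive, popChan, hz]
          · simp [reportView, emit, onReceive, popChan, hw]
        · funext a b
          simp [reportView, emit, onReceive, popChan, Msg.proc]
      · refine hof .stay ?_
        have hpp' : p ≠ p' := fun e => hpp e.symm
        rw [reportView_emit_of_frame, reportView_popChan]
        · simpa [Msg.proc] using hpp
        · simp [onReceive, popChan]
        · intro w
          by_cases hw : w = u <;> simp [onReceive, popChan, hw, hpp']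
        · simp [onReceive, popChan]
    | join k =>
      refine hof .stay ?_
      by_cases hp : (c.state v).pulse = none
      · rw [reportView_emit_of_frame, reportView_popChan] <;>
          simp +contextual [onReceive, hp, popChan, Msg.proc]
      · rw [reportView_emit_of_frame, reportView_popChan] <;>
          simp +contextual [onReceive, hp, popChan, Msg.proc]
    | _ =>
      refine hof .stay ?_
      rw [reportView_emit_of_frame, reportView_popChan] <;>
        simp +contextual [onReceive, popChan, Msg.proc, NodeState.takeGoAhead,
          NodeState.takeConfirmation, NodeState.withReg]
  | act v a r h =>
    cases a with
    | propose =>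
      simp only [onAct] at h
      split at h
      · simp at h
      · rw [Option.ite_none_right_eq_some, Option.some.injEq] at h
        obtain ⟨_, rfl⟩ := h
        refine hof .stay ?_
        apply reportView_emit_of_frame <;> simp +contextual [Msg.proc]
    | report p' =>
      simp only [onAct] at h
      rw [Option.ite_none_right_eq_some, Option.some.injEq] at h
      obtain ⟨⟨h0, h1, h2, h3, h4⟩, rfl⟩ := h
      by_cases hpp : p' = p
      · subst hpp
        refine hof (.send v h0 h1 h2 h3 h4) ?_
        ext1
        · funext w
          by_cases hw : w = v <;> [subst hw; skip] <;> simp [reportView, emit, *]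
        · funext w z
          by_cases hw : w = v <;> [subst hw; skip] <;> simp [reportView, emit, *]
        · funext a b
          simp only [reportView, emit]
          split_ifs <;> simp [Msg.proc]
      · refine hof .stay ?_
        have hpp' : p ≠ p' := fun e => hpp e.symm
        apply reportView_emit_of_frame
        · simp [hpp']
        · simp
        · intro w m hm
          simp only at hm
          split_ifs at hm
          · simp only [List.mem_singleton] at hm
            subst hm
            simpa [Msg.proc] using hpp
          · simp at hm
    | _ =>
      simp only [onAct] at h
      rw [Option.ite_none_right_eq_some, Option.some.injEq] at h
      obtain ⟨_, rfl⟩ := h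
      refine hof .stay ?_
      apply reportView_emit_of_frame <;>
        simp +contextual [Msg.proc, NodeState.takeGoAhead, NodeState.takeConfirmation,
          NodeState.withReg]

/-- Invariants of the reports for pulse `p`. -/
structure ReportInv (G : SimpleGraph V) (t : ℕ) (L : LayeredCover G κ J) (p : ℕ) (c : Conf V κ) :
    Prop where
  count : ∀ u w, (c.chan w u (.safety p)).length + (if (c.state u).report w p = none then 0 else 1)
    = if (c.state w).reported p = true ∧ (c.state w).parent = some u then 1 else 0
  chan : ∀ u w, .report p true ∈ c.chan w u (.safety p) → (c.state w).KnowsEmpty G w p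
  report : ∀ u w, (c.state u).report w p = some true → (c.state w).KnowsEmpty G w p
  reported : ∀ w, (c.state w).reported p = true → (c.state w).KnowsSafe G w p ∧
    ((c.state w).KnowsEmpty G w p ∨ ∀ q, 0 < q → q ≤ 2 ^ t → prev q = p →
      (c.state w).pulse = some (prev (prev q)) → (c.state w).IsRegistered L w q)
  pulse : ∀ w, (c.state w).reported p = true → (c.state w).pulse ≠ none

/-- The invariants of the algorithm that only concern the past of a single procedure. -/
structure Inv (G : SimpleGraph V) (s : V) (t : ℕ) (L : LayeredCover G κ J) (c : Conf V κ) :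
    Prop where
  chanOK : ChanOK G c
  search : SearchInv G s (2 ^ t) (searchView c)
  reg : ∀ p d, RegInv (L.cluster d) (regView p d c)
  report : ∀ p, ReportInv G t L p c

/-- By `count`, a report is a single token as well, so a received report is never overwritten. -/
theorem ReportInv.mono {p : ℕ} (h : ReportInv G t L p c) (ht : Trans G s t L c c') {u w : V}
    {e : Bool} (he : (c.state u).report w p = some e) : (c'.state u).report w p = some e := by
  have hs := ht.report p
  have key : ∀ y, ReportStep G t L p c y → y.report u w = some e := by
    intro y hy
    cases hy with
    | stay => exact he
    | send v h0 hp h1 h2 h3 => exact he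
    | recv a v e' rest hm =>
      have hne : ¬ (u = v ∧ w = a) := by
        rintro ⟨rfl, rfl⟩
        have := h.count u w
        have hm' : c.chan w u (.safety p) = .report p e' :: rest := hm
        rw [hm', he] at this
        simp only [List.length_cons, reduceCtorEq, if_false] at this
        split_ifs at this <;> omega
      simp only [hne, if_false]
      exact he
  exact key _ hs

/-- A node with all its answers gets no new tree children, and recorded reports persist. The second
conclusion says that the set of children does not grow, which is also needed for the stability of
emptiness. -/
theorem Inv.knowsSafe_mono (h : Inv G s t L c) (ht : Trans G s t L c c')
    (h' : SearchInv G s (2 ^ t) (searchView c')) {u : V} {p : ℕ}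
    (hs : (c.state u).KnowsSafe G u p) : (c'.state u).KnowsSafe G u p ∧
      ((c.state u).pulse ≠ some p → ∀ w, (c'.state u).IsExecChild w → (c.state u).IsExecChild w) := by
  have hm := h.search.mono ht.search
  obtain ⟨k, hk, hc⟩ := hs
  have hk' := hm.pulse u k hk
  rcases hc with rfl | ⟨h1, h2, h3, h4⟩
  · exact ⟨⟨k, hk', Or.inl rfl⟩, fun h => (h hk).elim⟩
  · have hchild : ∀ w, (c'.state u).IsExecChild w → (c.state u).IsExecChild w := by
      intro w hw
      have hw' : (c'.state u).answer w = some true := hw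
      have hadj : G.Adj u w := by
        have := h'.count u w
        by_contra hc
        simp [searchView, hw', hc] at this
      obtain ⟨e, he⟩ := Option.ne_none_iff_exists'.1 (h3 w hadj)
      have := hm.answer u w e he
      rw [show (searchView c').answer u w = (c'.state u).answer w from rfl, hw'] at this
      rw [← this] at he
      exact he
    refine ⟨⟨k, hk', Or.inr ⟨h1, hm.sent u h2, ?_, ?_⟩⟩, fun _ => hchild⟩
    · intro w hadj
      obtain ⟨e, he⟩ := Option.ne_none_iff_exists'.1 (h3 w hadj)
      exact Option.ne_none_iff_exists'.2 ⟨e, hm.answer u w e he⟩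
    · intro w hw
      obtain ⟨e, he⟩ := Option.ne_none_iff_exists'.1 (h4 w (hchild w hw))
      rw [(h.report p).mono ht he]
      simp

theorem Inv.knowsEmpty_mono (h : Inv G s t L c) (ht : Trans G s t L c c')
    (h' : SearchInv G s (2 ^ t) (searchView c')) {u : V} {p : ℕ}
    (hs : (c.state u).KnowsEmpty G u p) : (c'.state u).KnowsEmpty G u p := by
  obtain ⟨h1, h2, h3⟩ := hs
  obtain ⟨h4, h5⟩ := h.knowsSafe_mono ht h' h1
  refine ⟨h4, ?_, fun w hw => (h.report p).mono ht (h3 w (h5 h2 w hw))⟩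
  obtain ⟨k, hk, _⟩ := h1
  have hk' : (c'.state u).pulse = some k := (h.search.mono ht.search).pulse u k hk
  rw [hk', ← hk]
  exact h2

theorem Inv.isRegistered_mono (h : Inv G s t L c) (ht : Trans G s t L c c') {u : V} {q : ℕ}
    (hr : (c.state u).IsRegistered L u q) : (c'.state u).IsRegistered L u q := by
  intro d hd
  have h1 := (h.reg q d).rank_le (ht.reg q d) u
  obtain ⟨h2, h3⟩ := hr d hd
  simp only [regView] at h1
  cases hs : ((c.state u).reg q d).status <;> cases hs' : ((c'.state u).reg q d).status <;>
    simp_all [RegStatus.rank]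

/-- Everything a report attests is stable: knowledge of safety and emptiness, registrations, pulses
and parents. Hence its content stays true in transit and after receipt. -/
theorem Inv.report_step (h : Inv G s t L c) (ht : Trans G s t L c c')
    (h' : SearchInv G s (2 ^ t) (searchView c')) (p : ℕ) : ReportInv G t L p c' := by
  have hm := h.search.mono ht.search
  have hS := fun u (hu : (c.state u).KnowsSafe G u p) => (h.knowsSafe_mono ht h' hu).1
  have hE := fun u (hu : (c.state u).KnowsEmpty G u p) => h.knowsEmpty_mono ht h' hu
  have hR := fun u q (hu : (c.state u).IsRegistered L u q) => h.isRegistered_mono ht hu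
  obtain ⟨i1, i2, i3, i4, i5⟩ := h.report p
  have hpulse : ∀ w k, (c.state w).pulse = some k → (c'.state w).pulse = some k := hm.pulse
  have hpar : ∀ w, (c.state w).pulse ≠ none → (c'.state w).parent = (c.state w).parent := hm.parent
  have hQ : ∀ w, (c.state w).pulse ≠ none → (c.state w).KnowsSafe G w p ∧
      ((c.state w).KnowsEmpty G w p ∨ ∀ q, 0 < q → q ≤ 2 ^ t → prev q = p →
      (c.state w).pulse = some (prev (prev q)) → (c.state w).IsRegistered L w q) →
      (c'.state w).KnowsSafe G w p ∧
      ((c'.state w).KnowsEmpty G w p ∨ ∀ q, 0 < q → q ≤ 2 ^ t → prev q = p →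
      (c'.state w).pulse = some (prev (prev q)) → (c'.state w).IsRegistered L w q) := by
    rintro w hw ⟨a1, a2⟩
    refine ⟨hS w a1, ?_⟩
    rcases a2 with a2 | a2
    · exact Or.inl (hE w a2)
    · right
      intro q q1 q2 q3 q4
      obtain ⟨k, hk⟩ := Option.ne_none_iff_exists'.1 hw
      rw [hpulse w k hk, ← hk] at q4
      exact hR w q (a2 q q1 q2 q3 q4)
  have hcount : ∀ u w, (c.state w).reported p = true ∧ (c'.state w).parent = some u ↔
      (c.state w).reported p = true ∧ (c.state w).parent = some u := by
    intro u w
    refine and_congr_right fun hw => ?_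
    rw [hpar w (i5 w hw)]
  have hs := ht.report p
  generalize hy : reportView p c' = y at hs
  have e1 : ∀ v, (c'.state v).reported p = y.reported v := fun v => by rw [← hy]; rfl
  have e2 : ∀ u w, (c'.state u).report w p = y.report u w := fun u w => by rw [← hy]; rfl
  have e3 : ∀ a b, c'.chan a b (.safety p) = y.ch a b := fun a b => by rw [← hy]; rfl
  cases hs with
  | stay =>
    simp only [reportView] at e1 e2 e3
    constructor
    · intro u w; rw [e1, e2, e3]; simp only [hcount]; exact i1 u w
    · intro u w hm'; rw [e3] at hm'; exact hE w (i2 u w hm')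
    · intro u w hm'; rw [e2] at hm'; exact hE w (i3 u w hm')
    · intro w hw; rw [e1] at hw; exact hQ w (i5 w hw) (i4 w hw)
    · intro w hw; rw [e1] at hw
      obtain ⟨k, hk⟩ := Option.ne_none_iff_exists'.1 (i5 w hw)
      simp [hpulse w k hk]
  | send v h0 hp h1 h2 h3 =>
    simp only [reportView] at e1 e2 e3
    obtain ⟨k, hk, -, -⟩ := h1
    have hpv : (c.state v).pulse ≠ none := by simp [hk]
    constructor
    · intro u w
      have := i1 u w
      rw [e1, e2, e3]
      by_cases hw : w = v
      · subst hw
        simp only [h0, Bool.false_eq_true, false_and, if_false] at this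
        simp only [Function.update_self, true_and, hpar w hpv]
        by_cases hpu : (c.state w).parent = some u
        · obtain ⟨_, _, _, _, hadj, _⟩ := h.search.parent u w hpu
          simp only [hadj.symm, hpu, if_true, List.length_append, List.length_cons,
            List.length_nil]
          omega
        · simp only [hpu, if_false, List.append_nil, ite_self]
          exact this
      · simp only [hw, Function.update_of_ne, ne_eq, not_false_eq_true, false_and, if_false,
          hcount]
        exact this
    · intro u w hm'
      rw [e3] at hm'
      split_ifs at hm' with c1 c2
      · rcases List.mem_append.1 hm' with hm' | hm'
        · exact hE w (i2 u w hm')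
        · simp at hm'
          rw [c1.1]
          exact hE v hm'
      · simp at hm'
        exact hE w (i2 u w hm')
      · exact hE w (i2 u w hm')
    · intro u w hm'; rw [e2] at hm'; exact hE w (i3 u w hm')
    · intro w hw
      by_cases hwv : w = v
      · subst hwv
        exact hQ w hpv ⟨h2, h3⟩
      · rw [e1] at hw
        simp only [Function.update_of_ne hwv] at hw
        exact hQ w (i5 w hw) (i4 w hw)
    · intro w hw
      by_cases hwv : w = v
      · rw [hwv]
        simp [hpulse v k hk]
      · rw [e1] at hw
        simp only [Function.update_of_ne hwv] at hw
        obtain ⟨k, hk⟩ := Option.ne_none_iff_exists'.1 (i5 w hw)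
        simp [hpulse w k hk]
  | recv a v e rest hm' =>
    simp only [reportView] at e1 e2 e3 hm'
    have hcnt := i1 v a
    rw [hm'] at hcnt
    simp only [List.length_cons] at hcnt
    constructor
    · intro u w
      have := i1 u w
      rw [e1, e2, e3]
      by_cases hc : w = a ∧ u = v
      · obtain ⟨rfl, rfl⟩ := hc
        simp only [and_self, if_true, reduceCtorEq, if_false, hcount]
        split_ifs at hcnt ⊢ <;> omega
      · simp only [hc, and_comm (a := u = v), if_false, hcount]
        exact this
    · intro u w hm''
      rw [e3] at hm''
      split_ifs at hm'' with c1
      · refine hE w (i2 u w ?_)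
        rw [c1.1, c1.2, hm']
        exact List.mem_cons_of_mem _ hm''
      · exact hE w (i2 u w hm'')
    · intro u w hm''
      rw [e2] at hm''
      split_ifs at hm'' with c1
      · simp only [Option.some.injEq] at hm''
        refine hE w (i2 v w ?_)
        rw [c1.2, hm', hm'']
        exact List.mem_cons_self
      · exact hE w (i3 u w hm'')
    · intro w hw; rw [e1] at hw; exact hQ w (i5 w hw) (i4 w hw)
    · intro w hw; rw [e1] at hw
      obtain ⟨k, hk⟩ := Option.ne_none_iff_exists'.1 (i5 w hw)
      simp [hpulse w k hk]

theorem exec_inv {σ : ℕ → Conf V κ} (hσ : IsFairExecution G (algorithm G s t L) σ) (n : ℕ) :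
    Inv G s t L (σ n) := by
  induction n with
  | zero =>
    refine ⟨exec_chanOK hσ 0, exec_search hσ 0, fun p d => (exec_reg hσ p d).inv 0, fun p => ?_⟩
    rw [hσ.start]
    constructor <;> simp [AsyncAlgorithm.initial, algorithm, initState]
  | succ n ih =>
    exact ⟨exec_chanOK hσ _, exec_search hσ _, fun p d => (exec_reg hσ p d).inv _,
      ih.report_step (exec_trans hσ n) (exec_search hσ _)⟩

end

section

open Filter
open AsyncAlgorithm NodeState
variable {V κ : Type*} {J : ℕ} {G : SimpleGraph V} {s : V} {t : ℕ} {L : LayeredCover G κ J}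
  {c c' : Conf V κ}

/-! ### Effects of a transition on single fields -/

/-- The first two conditions describe when a node may register for `p` in the cluster `d`. -/
theorem Trans.regState (h : Trans G s t L c c') (u : V) (p : ℕ) (d : κ) :
    (c'.state u).reg p d = (c.state u).reg p d ∨
    (∃ w y, (c'.state u).reg p d = (((c.state u).reg p d).receive (L.cluster d) u w y).1) ∨
    ((0 < p ∧ p ≤ 2 ^ t ∧ (c.state u).pulse = some (prev (prev p)) ∧ RegCluster L u p d ∧
        ((c.state u).reg p d).status = .idle ∧
        (c.state u).KnowsSafe G u (prev p) ∧ ¬ (c.state u).KnowsEmpty G u (prev p)) ∧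
      (c'.state u).reg p d = (((c.state u).reg p d).register (L.cluster d) u).1) ∨
    ((((c.state u).reg p d).status = .registered ∧ (c.state u).KnowsSafe G u p) ∧
      (c'.state u).reg p d = (((c.state u).reg p d).deregister (L.cluster d) u).1) := by
  have hwith : ∀ (x : NodeState V κ) (p' : ℕ) (d' : κ) (r : RegState V × (V → List RegSignal)),
      (x.withReg p' d' r).1.reg p d = if p' = p ∧ d' = d then r.1 else x.reg p d := by
    intro x p' d' r
    simp only [NodeState.withReg]
    by_cases hp : p = p'
    · subst hp
      by_cases hd : d = d'
      · subst hd; simp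
      · have : ¬ d' = d := fun e => hd e.symm
        simp [hd, this]
    · have : ¬ p' = p := fun e => hp e.symm
      simp [hp, this]
  cases h with
  | stay => exact Or.inl rfl
  | recv w v m rest hm hadj =>
    by_cases huv : u = v
    · subst huv
      simp only [emit, Function.update_self]
      cases m with
      | reg p' d' y =>
        simp only [onReceive, hwith]
        split_ifs with hpd
        · obtain ⟨rfl, rfl⟩ := hpd
          exact Or.inr (Or.inl ⟨w, y, rfl⟩)
        · exact Or.inl rfl
      | join k =>
        left
        by_cases hp : (c.state u).pulse = none <;> simp [onReceive, hp]
      | _ => left; simp [onReceive, NodeState.takeGoAhead, NodeState.takeConfirmation]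
    · left; simp [emit, huv, popChan]
  | act v a r h =>
    by_cases huv : u = v
    · subst huv
      simp only [emit, Function.update_self]
      cases a with
      | propose =>
        simp only [onAct] at h
        split at h
        · simp at h
        · rw [Option.ite_none_right_eq_some, Option.some.injEq] at h
          obtain ⟨_, rfl⟩ := h
          exact Or.inl rfl
      | register p' d' =>
        simp only [onAct] at h
        rw [Option.ite_none_right_eq_some, Option.some.injEq] at h
        obtain ⟨hreg, rfl⟩ := h
        rw [hwith]
        split_ifs with hpd
        · obtain ⟨rfl, rfl⟩ := hpd
          exact Or.inr (Or.inr (Or.inl ⟨hreg, rfl⟩))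
        · exact Or.inl rfl
      | deregister p' d' =>
        simp only [onAct] at h
        rw [Option.ite_none_right_eq_some, Option.some.injEq] at h
        obtain ⟨⟨h1, h2, h3, h4, h5, _, h6⟩, rfl⟩ := h
        rw [hwith]
        split_ifs with hpd
        · obtain ⟨rfl, rfl⟩ := hpd
          exact Or.inr (Or.inr (Or.inr ⟨⟨h5, h6⟩, rfl⟩))
        · exact Or.inl rfl
      | _ =>
        simp only [onAct] at h
        rw [Option.ite_none_right_eq_some, Option.some.injEq] at h
        obtain ⟨_, rfl⟩ := h
        left; simp [NodeState.takeGoAhead, NodeState.takeConfirmation]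
    · left; simp [emit, huv]

/-- Signals alone neither start a registration nor end one; both take an action of the node, whose
guard can then be quoted. -/
theorem RegState.receive_status (T : Cluster G) (u w : V) (x : RegState V) (y : RegSignal) :
    (x.status = .idle → (x.receive T u w y).1.status = .idle) ∧
    (x.status = .registered → (x.receive T u w y).1.status = .registered) := by
  cases y <;>
    simp only [RegState.receive, RegState.runRegister, RegState.runDeregister, RegState.complete,
      RegState.runGo] <;>
    split_ifs <;> simp_all

/-- `go' v` for the nodes that have the Go-Ahead for `p`, and the messages that carry it. -/
theorem Trans.go (h : Trans G s t L c c') (p : ℕ) :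
    ((∀ v, (c'.state v).go p = (c.state v).go p) ∧
      ∀ a b, c'.chan a b (.release p) = c.chan a b (.release p)) ∨
    ∃ v, ((0 < p ∧ p ≤ 2 ^ t ∧ (c.state v).pulse = some (prev (prev p)) ∧
          ∀ d, RegCluster L v p d → ((c.state v).reg p d).status = .free) ∨
        ∃ u, .goAhead p ∈ c.chan u v (.release p)) ∧
      (∀ w, (c'.state w).go p = if w = v then true else (c.state w).go p) ∧
      (∀ a b m, m ∈ c'.chan a b (.release p) → m ∈ c.chan a b (.release p) ∨
        a = v ∧ (c.state v).IsExecChild b ∧ ∃ k, (c.state v).pulse = some k ∧ k < p) ∧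
      (∀ a b, b ≠ v → ∀ m ∈ c.chan a b (.release p), m ∈ c'.chan a b (.release p)) ∧
      ∀ b, (c.state v).IsExecChild b → G.Adj v b → (∃ k, (c.state v).pulse = some k ∧ k < p) →
        .goAhead p ∈ c'.chan v b (.release p) := by
  have hframe : ∀ (c₁ : Conf V κ) (v : V) (r : NodeState V κ × (V → List (Msg κ))),
      (∀ a b, c₁.chan a b (.release p) = c.chan a b (.release p)) → c₁.state = c.state →
      r.1.go p = (c.state v).go p → (∀ w, ∀ m ∈ r.2 w, m.proc ≠ .release p) →
      (∀ w, ((emit G v r c₁).state w).go p = (c.state w).go p) ∧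
      ∀ a b, (emit G v r c₁).chan a b (.release p) = c.chan a b (.release p) := by
    intro c₁ v r h1 h2 h3 h4
    constructor
    · intro w
      by_cases hw : w = v
      · subst hw; simpa [emit] using h3
      · simp [emit, hw, h2]
    · intro a b
      have h6 : (r.2 b).filter (fun m => decide (m.proc = .release p)) = [] := by simpa using h4 b
      simp [emit, h6, h1]
  cases h with
  | stay => exact Or.inl ⟨fun _ => rfl, fun _ _ => rfl⟩
  | recv u v m rest hm hadj =>
    cases m with
    | goAhead p' =>
      by_cases hpp : p' = p
      · subst hpp
        right
        simp only [Msg.proc] at hm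
        have hsub : ∀ a b m, m ∈ (popChan c u v (.release p') rest).chan a b (.release p') →
            m ∈ c.chan a b (.release p') := by
          intro a b m hm'
          simp only [popChan, and_true] at hm'
          split_ifs at hm' with hab
          · rw [hab.1, hab.2, hm]; exact List.mem_cons_of_mem _ hm'
          · exact hm'
        refine ⟨v, Or.inr ⟨u, by simp [hm]⟩, ?_, ?_, ?_, ?_⟩
        · intro w
          by_cases hw : w = v
          · subst hw; simp [emit, onReceive, NodeState.takeGoAhead]
          · simp [emit, hw, popChan]
        · intro a b m hm'
          simp only [emit, Msg.proc] at hm'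
          split_ifs at hm' with hab
          · rcases List.mem_append.1 hm' with hm' | hm'
            · exact Or.inl (hsub a b m hm')
            · right
              simp only [onReceive, NodeState.takeGoAhead] at hm'
              split_ifs at hm' with hk
              · exact ⟨hab.1, hk.2, hk.1⟩
              · simp at hm'
          · exact Or.inl (hsub a b m hm')
        · intro a b hb m hm'
          have : m ∈ (popChan c u v (.release p') rest).chan a b (.release p') := by
            simpa [popChan, hb] using hm'
          simp only [emit, Msg.proc]
          split_ifs
          · exact List.mem_append_left _ this
          · exact this
        · intro b hb hadj' hk
          simp only [emit, hadj', and_self, if_true, onReceive, NodeState.takeGoAhead]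
          apply List.mem_append_right
          rw [if_pos ⟨hk, hb⟩]
          simp [Msg.proc]
      · left
        refine hframe _ _ _ ?_ rfl ?_ ?_
        · intro a b
          have : ¬ p = p' := fun e => hpp e.symm
          simp [popChan, Msg.proc, this]
        · have : p ≠ p' := fun e => hpp e.symm
          simp [onReceive, NodeState.takeGoAhead, this]
        · intro w m hm'
          simp only [onReceive, NodeState.takeGoAhead] at hm'
          split_ifs at hm'
          · simp only [List.mem_singleton] at hm'
            simp [hm', Msg.proc, hpp]
          · simp at hm'
    | join k =>
      left
      by_cases hp : (c.state v).pulse = none <;>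
        refine hframe _ _ _ ?_ rfl ?_ ?_ <;>
          simp +contextual [onReceive, hp, popChan, Msg.proc]
    | _ =>
      left
      refine hframe _ _ _ ?_ rfl ?_ ?_ <;>
        simp +contextual [onReceive, popChan, Msg.proc, NodeState.takeGoAhead,
          NodeState.takeConfirmation, NodeState.withReg]
  | act v a r h =>
    cases a with
    | propose =>
      simp only [onAct] at h
      split at h
      · simp at h
      · rw [Option.ite_none_right_eq_some, Option.some.injEq] at h
        obtain ⟨_, rfl⟩ := h
        left
        refine hframe _ _ _ (fun _ _ => rfl) rfl ?_ ?_ <;> simp +contextual [Msg.proc]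
    | release p' =>
      simp only [onAct] at h
      rw [Option.ite_none_right_eq_some, Option.some.injEq] at h
      obtain ⟨⟨h0, h1, h2, h3, h4⟩, rfl⟩ := h
      by_cases hpp : p' = p
      · subst hpp
        right
        refine ⟨v, Or.inl ⟨h0, h1, h2, h4⟩, ?_, ?_, ?_, ?_⟩
        · intro w
          by_cases hw : w = v
          · subst hw; simp [emit, NodeState.takeGoAhead]
          · simp [emit, hw]
        · intro a b m hm'
          simp only [emit] at hm'
          split_ifs at hm' with hab
          · rcases List.mem_append.1 hm' with hm' | hm'
            · exact Or.inl hm'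
            · right
              simp only [NodeState.takeGoAhead] at hm'
              split_ifs at hm' with hk
              · exact ⟨hab.1, hk.2, hk.1⟩
              · simp at hm'
          · exact Or.inl hm'
        · intro a b hb m hm'
          simp only [emit]
          split_ifs
          · exact List.mem_append_left _ hm'
          · exact hm'
        · intro b hb hadj' hk
          simp only [emit, hadj', and_self, if_true, NodeState.takeGoAhead]
          apply List.mem_append_right
          rw [if_pos ⟨hk, hb⟩]
          simp [Msg.proc]
      · left
        refine hframe _ _ _ (fun _ _ => rfl) rfl ?_ ?_
        · have : p ≠ p' := fun e => hpp e.symm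
          simp [NodeState.takeGoAhead, this]
        · intro w m hm'
          simp only [NodeState.takeGoAhead] at hm'
          split_ifs at hm'
          · simp only [List.mem_singleton] at hm'
            simp [hm', Msg.proc, hpp]
          · simp at hm'
    | _ =>
      simp only [onAct] at h
      rw [Option.ite_none_right_eq_some, Option.some.injEq] at h
      obtain ⟨_, rfl⟩ := h
      left
      refine hframe _ _ _ (fun _ _ => rfl) rfl ?_ ?_ <;>
        simp +contextual [Msg.proc, NodeState.takeGoAhead, NodeState.takeConfirmation,
          NodeState.withReg]

theorem Trans.sent (h : Trans G s t L c c') {v : V} (hv : (c'.state v).sent = true) :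
    (c.state v).sent = true ∨
      ∃ k, (c.state v).pulse = some k ∧ (k = 0 ∨ (c.state v).go k = true) := by
  cases h with
  | stay => exact Or.inl hv
  | recv w u m rest hm hadj =>
    left
    by_cases huv : v = u
    · subst huv
      simp only [emit, Function.update_self] at hv
      cases m with
      | join k => by_cases hp : (c.state v).pulse = none <;> simpa [onReceive, hp] using hv
      | _ => simpa [onReceive, NodeState.takeGoAhead, NodeState.takeConfirmation,
          NodeState.withReg] using hv
    · simpa [emit, huv, popChan] using hv
  | act u a r h =>
    by_cases huv : v = u
    · subst huv
      simp only [emit, Function.update_self] at hv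
      cases a with
      | propose =>
        simp only [onAct] at h
        split at h
        · simp at h
        · rename_i k hk
          rw [Option.ite_none_right_eq_some, Option.some.injEq] at h
          exact Or.inr ⟨k, hk, h.1.2.2⟩
      | _ =>
        left
        simp only [onAct] at h
        rw [Option.ite_none_right_eq_some, Option.some.injEq] at h
        obtain ⟨_, rfl⟩ := h
        simpa [NodeState.takeGoAhead, NodeState.takeConfirmation, NodeState.withReg] using hv
    · left; simpa [emit, huv] using hv

theorem Trans.output (h : Trans G s t L c c') (v : V) :
    ((c'.state v).output = (c.state v).output ∧ (c'.state v).pulse = (c.state v).pulse) ∨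
    ((c.state v).pulse = none ∧ ∃ k, (c'.state v).pulse = some k ∧
      (c'.state v).output = some (k : ℕ∞)) ∨
    ((c.state v).pulse = none ∧ (c'.state v).pulse = none ∧ (c.state v).output = none ∧
      (c'.state v).output = some ⊤ ∧
      ∀ d, L.level d = t → v ∈ (L.cluster d).members → (c.state v).confirmed d = true) := by
  cases h with
  | stay => exact Or.inl ⟨rfl, rfl⟩
  | recv w u m rest hm hadj =>
    by_cases huv : v = u
    · subst huv
      simp only [emit, Function.update_self]
      cases m with
      | join k =>
        by_cases hp : (c.state v).pulse = none
        · right; left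
          simp [onReceive, hp]
        · left
          simp [onReceive, hp]
      | _ => left; simp [onReceive, NodeState.takeGoAhead, NodeState.takeConfirmation,
          NodeState.withReg]
    · left; simp [emit, huv, popChan]
  | act u a r h =>
    by_cases huv : v = u
    · subst huv
      simp only [emit, Function.update_self]
      cases a with
      | propose =>
        simp only [onAct] at h
        split at h
        · simp at h
        · rename_i k hk
          rw [Option.ite_none_right_eq_some, Option.some.injEq] at h
          obtain ⟨_, rfl⟩ := h
          left; exact ⟨rfl, rfl⟩
      | conclude =>
        simp only [onAct] at h
        rw [Option.ite_none_right_eq_some, Option.some.injEq] at h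
        obtain ⟨⟨h1, h2, h3⟩, rfl⟩ := h
        right; right
        exact ⟨h1, h1, h2, rfl, h3⟩
      | _ =>
        left
        simp only [onAct] at h
        rw [Option.ite_none_right_eq_some, Option.some.injEq] at h
        obtain ⟨_, rfl⟩ := h
        simp [NodeState.takeGoAhead, NodeState.takeConfirmation, NodeState.withReg]
    · left; simp [emit, huv]

end

/-! ### Transitions of the checking stage -/

section

open Filter
open AsyncAlgorithm NodeState
variable {V κ : Type*} {J : ℕ} {G : SimpleGraph V} {s : V} {t : ℕ} {L : LayeredCover G κ J}
  {c c' : Conf V κ}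

/-- The effect of a transition on the checking stage in the cluster `d`. -/
theorem Trans.check (h : Trans G s t L c c') (d : κ) :
    ((∀ v w, (c'.state v).checkedChild d w = (c.state v).checkedChild d w) ∧
      (∀ v, (c'.state v).checkSent d = (c.state v).checkSent d) ∧
      (∀ v, (c'.state v).confirmed d = (c.state v).confirmed d) ∧
      ∀ a b, c'.chan a b (.check d) = c.chan a b (.check d)) ∨
    (∃ v, (SubtreeDone G s t L v (c.state v) d ∧ v ≠ (L.cluster d).root) ∧
      (∀ v w, (c'.state v).checkedChild d w = (c.state v).checkedChild d w) ∧
      (∀ w, (c'.state w).checkSent d = if w = v then true else (c.state w).checkSent d) ∧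
      (∀ v, (c'.state v).confirmed d = (c.state v).confirmed d) ∧
      (∀ a b m, m ∈ c'.chan a b (.check d) → m ∈ c.chan a b (.check d) ∨
        a = v ∧ m = .checkUp d) ∧
      (∀ a b m, m ∈ c.chan a b (.check d) → m ∈ c'.chan a b (.check d)) ∧
      (G.Adj v ((L.cluster d).parent v) →
        .checkUp d ∈ c'.chan v ((L.cluster d).parent v) (.check d))) ∨
    (∃ v, ((SubtreeDone G s t L v (c.state v) d ∧ v = (L.cluster d).root) ∨
        ∃ u, .checkDown d ∈ c.chan u v (.check d)) ∧
      (∀ v w, (c'.state v).checkedChild d w = (c.state v).checkedChild d w) ∧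
      (∀ v, (c'.state v).checkSent d = (c.state v).checkSent d) ∧
      (∀ w, (c'.state w).confirmed d = if w = v then true else (c.state w).confirmed d) ∧
      (∀ a b m, m ∈ c'.chan a b (.check d) → m ∈ c.chan a b (.check d) ∨
        a = v ∧ m = .checkDown d) ∧
      (∀ a b m, m ∈ c.chan a b (.check d) → m ∈ c'.chan a b (.check d) ∨
        b = v ∧ m = .checkDown d) ∧
      ∀ w, (L.cluster d).IsChild v w → .checkDown d ∈ c'.chan v w (.check d)) ∨
    ∃ u v, .checkUp d ∈ c.chan u v (.check d) ∧
      (∀ a b, (c'.state a).checkedChild d b =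
        if a = v ∧ b = u then true else (c.state a).checkedChild d b) ∧
      (∀ v, (c'.state v).checkSent d = (c.state v).checkSent d) ∧
      (∀ v, (c'.state v).confirmed d = (c.state v).confirmed d) ∧
      (∀ a b m, m ∈ c'.chan a b (.check d) → m ∈ c.chan a b (.check d)) ∧
      (∀ a b m, m ∈ c.chan a b (.check d) → m ∈ c'.chan a b (.check d) ∨
        a = u ∧ b = v ∧ m = .checkUp d) := by
  have hframe : ∀ (c₁ : Conf V κ) (v : V) (r : NodeState V κ × (V → List (Msg κ))),
      (∀ a b, c₁.chan a b (.check d) = c.chan a b (.check d)) → c₁.state = c.state →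
      r.1.checkedChild d = (c.state v).checkedChild d →
      r.1.checkSent d = (c.state v).checkSent d →
      r.1.confirmed d = (c.state v).confirmed d →
      (∀ w, ∀ m ∈ r.2 w, m.proc ≠ .check d) →
      (∀ u w, ((emit G v r c₁).state u).checkedChild d w = (c.state u).checkedChild d w) ∧
      (∀ u, ((emit G v r c₁).state u).checkSent d = (c.state u).checkSent d) ∧
      (∀ u, ((emit G v r c₁).state u).confirmed d = (c.state u).confirmed d) ∧
      ∀ a b, (emit G v r c₁).chan a b (.check d) = c.chan a b (.check d) := by
    intro c₁ v r h1 h2 h3 h4 h5 h6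
    refine ⟨?_, ?_, ?_, ?_⟩
    · intro u w
      by_cases hw : u = v
      · subst hw; simp [emit, h3]
      · simp [emit, hw, h2]
    · intro u
      by_cases hw : u = v
      · subst hw; simp [emit, h4]
      · simp [emit, hw, h2]
    · intro u
      by_cases hw : u = v
      · subst hw; simp [emit, h5]
      · simp [emit, hw, h2]
    · intro a b
      have h6 : (r.2 b).filter (fun m => decide (m.proc = .check d)) = [] := by simpa using h6 b
      simp [emit, h6, h1]
  cases h with
  | stay => exact Or.inl ⟨fun _ _ => rfl, fun _ => rfl, fun _ => rfl, fun _ _ => rfl⟩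
  | recv u v m rest hm hadj =>
    cases m with
    | checkUp d' =>
      by_cases hdd : d' = d
      · subst hdd
        right; right; right
        simp only [Msg.proc] at hm
        have hch : ∀ a b m, m ∈ (emit G v (onReceive G L v u (.checkUp d') (c.state v))
            (popChan c u v (.check d') rest)).chan a b (.check d') ↔
            m ∈ if a = u ∧ b = v then rest else c.chan a b (.check d') := by
          intro a b m
          simp [emit, onReceive, popChan]
        refine ⟨u, v, by simp [hm], ?_, ?_, ?_, ?_, ?_⟩
        · intro a b
          by_cases ha : a = v
          · subst ha
            by_cases hb : b = u <;> simp [emit, onReceive, hb]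
          · simp [emit, popChan, ha]
        · intro a
          by_cases ha : a = v <;> [subst ha; skip] <;> simp [emit, onReceive, popChan, *]
        · intro a
          by_cases ha : a = v <;> [subst ha; skip] <;> simp [emit, onReceive, popChan, *]
        · intro a b m hm'
          simp only [Msg.proc] at hm'
          rw [hch] at hm'
          split_ifs at hm' with hab
          · rw [hab.1, hab.2, hm]; exact List.mem_cons_of_mem _ hm'
          · exact hm'
        · intro a b m hm'
          simp only [Msg.proc]
          rw [hch]
          split_ifs with hab
          · rw [hab.1, hab.2, hm] at hm'
            rcases List.mem_cons.1 hm' with rfl | hm'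
            · exact Or.inr ⟨hab.1, hab.2, rfl⟩
            · exact Or.inl hm'
          · exact Or.inl hm'
      · left
        have hdd' : ¬ d = d' := fun e => hdd e.symm
        refine hframe _ _ _ ?_ rfl ?_ ?_ ?_ ?_ <;> simp [onReceive, popChan, Msg.proc, hdd']
    | checkDown d' =>
      by_cases hdd : d' = d
      · subst hdd
        right; right; left
        simp only [Msg.proc] at hm
        refine ⟨v, Or.inr ⟨u, by simp [hm]⟩, ?_, ?_, ?_, ?_, ?_, ?_⟩
        · intro a b
          by_cases ha : a = v <;> [subst ha; skip] <;>
            simp [emit, onReceive, popChan, takeConfirmation, *]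
        · intro a
          by_cases ha : a = v <;> [subst ha; skip] <;>
            simp [emit, onReceive, popChan, takeConfirmation, *]
        · intro a
          by_cases ha : a = v <;> [subst ha; skip] <;>
            simp [emit, onReceive, popChan, takeConfirmation, *]
        · intro a b m hm'
          have hsub : m ∈ (popChan c u v (.check d') rest).chan a b (.check d') →
              m ∈ c.chan a b (.check d') := by
            intro hm'
            simp only [popChan, and_true] at hm'
            split_ifs at hm' with hab
            · rw [hab.1, hab.2, hm]; exact List.mem_cons_of_mem _ hm'
            · exact hm'
          simp only [emit, Msg.proc] at hm'
          split_ifs at hm' with hab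
          · rcases List.mem_append.1 hm' with hm' | hm'
            · exact Or.inl (hsub hm')
            · right
              simp only [onReceive, takeConfirmation] at hm'
              split_ifs at hm' with hk
              · simp [Msg.proc] at hm'
                exact ⟨hab.1, hm'⟩
              · simp at hm'
          · exact Or.inl (hsub hm')
        · intro a b m hm'
          have hsub : m ∈ (popChan c u v (.check d') rest).chan a b (.check d') ∨
              b = v ∧ m = .checkDown d' := by
            simp only [popChan, and_true]
            split_ifs with hab
            · rw [hab.1, hab.2, hm] at hm'
              rcases List.mem_cons.1 hm' with rfl | hm'
              · exact Or.inr ⟨hab.2, rfl⟩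
              · exact Or.inl hm'
            · exact Or.inl hm'
          refine hsub.imp (fun hsub => ?_) id
          simp only [emit, Msg.proc]
          split_ifs
          · exact List.mem_append_left _ hsub
          · exact hsub
        · intro w hw
          simp only [emit, hw.adj, and_self, if_true, onReceive, takeConfirmation, hw, Msg.proc]
          apply List.mem_append_right
          simp [Msg.proc]
      · left
        have hdd' : ¬ d = d' := fun e => hdd e.symm
        refine hframe _ _ _ ?_ rfl ?_ ?_ ?_ ?_ <;>
          simp +contextual [onReceive, popChan, Msg.proc, hdd', hdd, takeConfirmation]
    | join k =>
      left
      by_cases hp : (c.state v).pulse = none <;>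
        refine hframe _ _ _ ?_ rfl ?_ ?_ ?_ ?_ <;>
          simp +contextual [onReceive, hp, popChan, Msg.proc]
    | _ =>
      left
      refine hframe _ _ _ ?_ rfl ?_ ?_ ?_ ?_ <;>
        simp +contextual [onReceive, popChan, Msg.proc, takeGoAhead, withReg]
  | act v a r h =>
    cases a with
    | propose =>
      simp only [onAct] at h
      split at h
      · simp at h
      · rw [Option.ite_none_right_eq_some, Option.some.injEq] at h
        obtain ⟨_, rfl⟩ := h
        left
        refine hframe _ _ _ (fun _ _ => rfl) rfl ?_ ?_ ?_ ?_ <;> simp +contextual [Msg.proc]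
    | checkUp d' =>
      simp only [onAct] at h
      rw [Option.ite_none_right_eq_some, Option.some.injEq] at h
      obtain ⟨⟨h0, h1, h2⟩, rfl⟩ := h
      by_cases hdd : d' = d
      · subst hdd
        right; left
        refine ⟨v, ⟨h0, h1⟩, ?_, ?_, ?_, ?_, ?_, ?_⟩
        · intro a b
          by_cases ha : a = v <;> [subst ha; skip] <;> simp [emit, *]
        · intro a
          by_cases ha : a = v <;> [subst ha; skip] <;> simp [emit, *]
        · intro a
          by_cases ha : a = v <;> [subst ha; skip] <;> simp [emit, *]
        · intro a b m hm'
          simp only [emit] at hm'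
          split_ifs at hm' with hab
          · rcases List.mem_append.1 hm' with hm' | hm'
            · exact Or.inl hm'
            · simp [Msg.proc] at hm'
              exact Or.inr ⟨hab.1, hm'⟩
          · simp at hm'; exact Or.inl hm'
          · exact Or.inl hm'
        · intro a b m hm'
          simp only [emit]
          split_ifs
          · exact List.mem_append_left _ hm'
          · exact List.mem_append_left _ hm'
          · exact hm'
        · intro hadj
          simp [emit, hadj, Msg.proc]
      · left
        have hdd' : ¬ d = d' := fun e => hdd e.symm
        refine hframe _ _ _ (fun _ _ => rfl) rfl ?_ ?_ ?_ ?_ <;>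
          simp +contextual [Msg.proc, hdd', hdd]
    | checkRoot d' =>
      simp only [onAct] at h
      rw [Option.ite_none_right_eq_some, Option.some.injEq] at h
      obtain ⟨⟨h0, h1, h2⟩, rfl⟩ := h
      by_cases hdd : d' = d
      · subst hdd
        right; right; left
        refine ⟨v, Or.inl ⟨h0, h1⟩, ?_, ?_, ?_, ?_, ?_, ?_⟩
        · clear h0 h1; intro a b
          by_cases ha : a = v <;> [subst ha; skip] <;> simp [emit, takeConfirmation, *]
        · clear h0 h1; intro a
          by_cases ha : a = v <;> [subst ha; skip] <;> simp [emit, takeConfirmation, *]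
        · clear h0 h1; intro a
          by_cases ha : a = v <;> [subst ha; skip] <;> simp [emit, takeConfirmation, *]
        · intro a b m hm'
          simp only [emit, takeConfirmation] at hm'
          split_ifs at hm' with hab hk
          · rcases List.mem_append.1 hm' with hm' | hm'
            · exact Or.inl hm'
            · simp [Msg.proc] at hm'
              exact Or.inr ⟨hab.1, hm'⟩
          · simp at hm'; exact Or.inl hm'
          · exact Or.inl hm'
        · intro a b m hm'
          left
          simp only [emit]
          split_ifs
          · exact List.mem_append_left _ hm'
          · exact hm'
        · intro w hw
          simp [emit, hw.adj, takeConfirmation, hw, Msg.proc]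
      · left
        have hdd' : ¬ d = d' := fun e => hdd e.symm
        refine hframe _ _ _ (fun _ _ => rfl) rfl ?_ ?_ ?_ ?_ <;>
          simp +contextual [Msg.proc, hdd', hdd, takeConfirmation]
    | _ =>
      simp only [onAct] at h
      rw [Option.ite_none_right_eq_some, Option.some.injEq] at h
      obtain ⟨_, rfl⟩ := h
      left
      refine hframe _ _ _ (fun _ _ => rfl) rfl ?_ ?_ ?_ ?_ <;>
        simp +contextual [Msg.proc, takeGoAhead, withReg]

end

section

open Filter
open AsyncAlgorithm NodeState

/-! ### Arithmetic of pulses -/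

theorem two_pow_level_dvd (p : ℕ) : 2 ^ level p ∣ p := pow_padicValNat_dvd

theorem two_pow_level_le {p : ℕ} (hp : 0 < p) : 2 ^ level p ≤ p :=
  Nat.le_of_dvd hp (two_pow_level_dvd p)

theorem level_eq {l m : ℕ} (hm : m % 2 = 1) : level (2 ^ l * m) = l := by
  have h1 : m ≠ 0 := by rintro rfl; simp at hm
  rw [level, padicValNat.mul (by positivity) h1, padicValNat.prime_pow,
    padicValNat.eq_zero_of_not_dvd (by omega)]
  rfl

theorem prev_zero : prev 0 = 0 := rfl

theorem prev_add_le {p : ℕ} (hp : 0 < p) : prev p + 2 ^ level p ≤ p := by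
  have h1 := two_pow_level_le hp
  have h2 : prev p ≤ p - 2 ^ level p := by
    rw [prev, if_neg hp.ne']
    exact Nat.findGreatest_le _
  omega

theorem prev_le (p : ℕ) : prev p ≤ p := by
  rcases Nat.eq_zero_or_pos p with rfl | hp
  · rfl
  · exact (Nat.le_add_right _ _).trans (prev_add_le hp)

theorem prev_lt {p : ℕ} (hp : 0 < p) : prev p < p := by
  have := prev_add_le hp
  have : 0 < 2 ^ level p := by positivity
  omega

theorem level_prev {p : ℕ} (h : 0 < prev p) : level (prev p) = level p + 1 := by
  have hp : p ≠ 0 := by rintro rfl; simp [prev_zero] at h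
  rw [prev, if_neg hp] at h ⊢
  exact (Nat.findGreatest_of_ne_zero rfl h.ne').2

/-- Write `p` as `2 ^ l * m` with `m` odd. One of (m - 1) / 2 and (m - 3) / 2 is odd, so one of `2 ^
l * (m - 1)` and `2 ^ l * (m - 3)` has level l + 1, unless it is zero. If `m ≤ 3`, the bound holds
even for `prev p = 0`. -/
theorem le_prev_add (p : ℕ) : p ≤ prev p + 3 * 2 ^ level p := by
  rcases Nat.eq_zero_or_pos p with rfl | hp
  · simp
  obtain ⟨m, hm⟩ := two_pow_level_dvd p
  have hodd : m % 2 = 1 := by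
    by_contra hc
    have h2 : 2 ∣ m := by omega
    have : 2 ^ (level p + 1) ∣ p := by
      rw [pow_succ]
      nth_rewrite 2 [hm]
      exact mul_dvd_mul_left _ h2
    exact pow_succ_padicValNat_not_dvd hp.ne' this
  generalize hl : level p = l at hm
  have hpos : 0 < 2 ^ l := by positivity
  have key : ∀ q, 0 < q → level q = l + 1 → q + 2 ^ l ≤ p → q ≤ prev p := by
    intro q h1 h2 h3
    rw [prev, if_neg hp.ne', hl]
    exact Nat.le_findGreatest (by omega) ⟨h1, h2⟩
  have hfac : ∀ r, 2 ^ (l + 1) * r = 2 ^ l * (2 * r) := fun r => by ring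
  by_cases hm3 : m ≤ 3
  · have : 2 ^ l * m ≤ 2 ^ l * 3 := Nat.mul_le_mul_left _ hm3
    omega
  · by_cases h4 : m % 4 = 3
    · have h5 := key (2 ^ (l + 1) * (m / 2)) (by have : 0 < m / 2 := by omega
                                                 positivity) (level_eq (by omega)) (by
        rw [hfac, show 2 * (m / 2) = m - 1 by omega, Nat.mul_sub, hm]
        have := Nat.mul_le_mul_left (2 ^ l) (show 1 ≤ m by omega)
        omega)
      rw [hfac, show 2 * (m / 2) = m - 1 by omega, Nat.mul_sub, ← hm] at h5
      omega
    · have h5 := key (2 ^ (l + 1) * (m / 2 - 1)) (by have : 0 < m / 2 - 1 := by omega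
                                                     positivity) (level_eq (by omega)) (by
        rw [hfac, show 2 * (m / 2 - 1) = m - 3 by omega, Nat.mul_sub, hm]
        have := Nat.mul_le_mul_left (2 ^ l) (show 3 ≤ m by omega)
        omega)
      rw [hfac, show 2 * (m / 2 - 1) = m - 3 by omega, Nat.mul_sub, ← hm] at h5
      omega

theorem prev_prev_lt {p : ℕ} (hp : 0 < p) : prev (prev p) < p :=
  (prev_le _).trans_lt (prev_lt hp)

/-- The second step is taken one level higher, so it costs twice as much: 3 + 2 * 3 = 9. -/
theorem le_prev_prev_add (p : ℕ) : p ≤ prev (prev p) + 9 * 2 ^ level p := by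
  have h1 := le_prev_add p
  rcases Nat.eq_zero_or_pos (prev p) with h | h
  · omega
  · have h2 := le_prev_add (prev p)
    rw [level_prev h, pow_succ] at h2
    omega

theorem level_le_of_le_two_pow {p t : ℕ} (hp : 0 < p) (h : p ≤ 2 ^ t) : level p ≤ t :=
  (Nat.pow_le_pow_iff_right (by norm_num)).1 ((two_pow_level_le hp).trans h)

/-! ### Distances -/

section Distance

variable {V : Type*} {G : SimpleGraph V}

theorem edist_le_add_one {x y : V} (h : G.Adj x y) (z : V) : G.edist x z ≤ G.edist y z + 1 := by
  have h1 := SimpleGraph.edist_triangle (G := G) (u := x) (v := y) (w := z)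
  rw [SimpleGraph.edist_eq_one_iff_adj.2 h] at h1
  rwa [add_comm] at h1

/-- A node at distance `i + 1` has a neighbour at distance `i`. -/
theorem exists_adj_edist {x s : V} {i : ℕ} (h : G.edist x s = ((i + 1 : ℕ) : ℕ∞)) :
    ∃ y, G.Adj x y ∧ G.edist y s = (i : ℕ∞) := by
  obtain ⟨w, hw⟩ := SimpleGraph.exists_walk_of_edist_ne_top (G := G) (u := x) (v := s)
    (by rw [h]; exact ENat.natCast_ne_top _)
  rw [h] at hw
  have hw' : w.length = i + 1 := by exact_mod_cast hw
  cases w with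
  | nil => simp at hw'
  | @cons _ y _ hadj w =>
    refine ⟨y, hadj, le_antisymm ?_ ?_⟩
    · have h1 := w.edist_le
      simp only [SimpleGraph.Walk.length_cons, Nat.add_right_cancel_iff] at hw'
      rwa [hw'] at h1
    · have h1 := edist_le_add_one hadj s
      rw [h] at h1
      push_cast at h1
      exact (ENat.add_le_add_iff_right (by simp)).1 h1

end Distance

end

section

open Filter
open AsyncAlgorithm NodeState
variable {V κ : Type*} {J : ℕ} {G : SimpleGraph V} {s : V} {t : ℕ} {L : LayeredCover G κ J}
  {c c' : Conf V κ}

/-! ### Consequences of the invariants in one configuration -/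

/-- The node has sent its proposals and received all answers. -/
def Answered (G : SimpleGraph V) (c : Conf V κ) (u : V) : Prop :=
  (c.state u).sent = true ∧ ∀ w, G.Adj u w → (c.state u).answer w ≠ none

theorem answered_of_knowsSafe {u : V} {p : ℕ} (h : (c.state u).KnowsSafe G u p)
    (hp : (c.state u).pulse ≠ some p) : Answered G c u := by
  obtain ⟨k, hk, rfl | ⟨_, h2, h3, _⟩⟩ := h
  · exact (hp hk).elim
  · exact ⟨h2, h3⟩

namespace Inv

/-- Only nodes with a pulse answer: a node without one accepts the proposal and thereby obtains it.
This is how safety of one node yields pulses at all its neighbours. -/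
theorem pulse_of_answered (h : Inv G s t L c) {u w : V} (hu : Answered G c u)
    (hadj : G.Adj u w) : (c.state w).pulse ≠ none := by
  obtain ⟨e, he⟩ := Option.ne_none_iff_exists'.1 (hu.2 w hadj)
  exact (h.search.answer_eq u w e he).1

theorem parent_spec (h : Inv G s t L c) {u v : V} (hp : (c.state v).parent = some u) :
    ∃ k, (c.state u).pulse = some k ∧ (c.state v).pulse = some (k + 1) ∧
      (c.state u).sent = true ∧ G.Adj u v ∧ k < 2 ^ t := by
  obtain ⟨k, h1, h2, h3, h4, _⟩ := h.search.parent u v hp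
  obtain ⟨k', h5, h6⟩ := h.search.sent u h3
  rw [h1, Option.some.injEq] at h5
  exact ⟨k, h1, h2, h3, h4, h5 ▸ h6⟩

theorem exists_parent (h : Inv G s t L c) {v : V} (hv : (c.state v).pulse ≠ none) (hs : v ≠ s) :
    ∃ u, (c.state v).parent = some u :=
  Option.ne_none_iff_exists'.1 fun hn => hv (h.search.orphan v hn hs)

theorem pulse_le (h : Inv G s t L c) {v : V} {k : ℕ} (hv : (c.state v).pulse = some k) :
    k ≤ 2 ^ t := by
  by_cases hs : v = s
  · have h1 : (c.state s).pulse = some 0 := h.search.source.1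
    rw [hs, h1, Option.some.injEq] at hv
    exact hv ▸ Nat.zero_le _
  · obtain ⟨u, hu⟩ := h.exists_parent (by simp [hv]) hs
    obtain ⟨k', _, h2, _, _, h3⟩ := h.parent_spec hu
    rw [hv, Option.some.injEq] at h2
    omega

theorem answer_of_child (h : Inv G s t L c) {u v : V} (hu : Answered G c u)
    (hp : (c.state v).parent = some u) : (c.state u).IsExecChild v := by
  obtain ⟨k, _, _, _, hadj, _⟩ := h.parent_spec hp
  obtain ⟨e, he⟩ := Option.ne_none_iff_exists'.1 (hu.2 v hadj)
  have := (h.search.answer_eq u v e he).2.2 hp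
  rw [IsExecChild, he, this]

theorem parent_of_execChild (h : Inv G s t L c) {u v : V} (hp : (c.state u).IsExecChild v) :
    (c.state v).parent = some u :=
  (h.search.answer_eq u v true hp).2.1 rfl

/-- Every child of a node that knows to be `p`-safe has reported for `p`. -/
theorem reported_of_report (h : Inv G s t L c) {u v : V} {p : ℕ}
    (hr : (c.state u).report v p ≠ none) :
    (c.state v).reported p = true ∧ (c.state v).parent = some u := by
  have := (h.report p).count u v
  by_contra hc
  simp [hr, hc] at this

/-- To know its safety, the parent needs the reports of all its children, and a child reports only
what it knows itself. -/
theorem child_safe (h : Inv G s t L c) {u v : V} {p : ℕ} (hu : (c.state u).KnowsSafe G u p)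
    (hk : (c.state u).pulse ≠ some p) (hp : (c.state v).parent = some u) :
    (c.state v).reported p = true ∧ (c.state v).KnowsSafe G v p := by
  have ha := h.answer_of_child (answered_of_knowsSafe hu hk) hp
  obtain ⟨k, h1, rfl | ⟨_, _, _, h4⟩⟩ := hu
  · exact (hk h1).elim
  · have hr := (h.reported_of_report (h4 v ha)).1
    exact ⟨hr, ((h.report p).reported v hr).1⟩

theorem child_empty (h : Inv G s t L c) {u v : V} {p : ℕ} (hu : (c.state u).KnowsEmpty G u p)
    (hp : (c.state v).parent = some u) : (c.state v).KnowsEmpty G v p := by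
  have ha := h.answer_of_child (answered_of_knowsSafe hu.1 hu.2.1) hp
  exact (h.report p).report u v (hu.2.2 v ha)

end Inv

/-- The ancestor relation of the execution tree. -/
def ExecAnc (c : Conf V κ) : V → V → Prop :=
  Relation.ReflTransGen fun u w => (c.state w).parent = some u

/-- Pulses grow by one along tree edges, so the pulse difference is the length of the tree path and
bounds the distance in the graph, even before pulses are known to be correct. -/
theorem ExecAnc.pulse (h : Inv G s t L c) {a v : V} (hav : ExecAnc c a v) {i : ℕ}
    (ha : (c.state a).pulse = some i) :
    ∃ d, (c.state v).pulse = some (i + d) ∧ G.edist a v ≤ (d : ℕ∞) := by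
  induction hav with
  | refl => exact ⟨0, ha, by simp⟩
  | tail _ hp ih =>
    rename_i b e _
    obtain ⟨d, h1, h2⟩ := ih
    obtain ⟨k, h3, h4, _, hadj, _⟩ := h.parent_spec hp
    rw [h1, Option.some.injEq] at h3
    refine ⟨d + 1, by rw [h4, ← h3]; rfl, ?_⟩
    have h5 := edist_le_add_one hadj.symm a
    rw [SimpleGraph.edist_comm] at h5
    refine h5.trans ?_
    push_cast
    rw [SimpleGraph.edist_comm]
    gcongr

/-- The tree path from `a` to `v` meets all pulses in between. -/
theorem ExecAnc.exists_pulse (h : Inv G s t L c) {a v : V} (hav : ExecAnc c a v) {i j : ℕ}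
    (ha : (c.state a).pulse = some i) (hv : (c.state v).pulse = some j) {l : ℕ} (hil : i ≤ l)
    (hlj : l ≤ j) : ∃ x, (c.state x).pulse = some l ∧ ExecAnc c a x ∧ ExecAnc c x v := by
  induction hav using Relation.ReflTransGen.head_induction_on generalizing i with
  | refl =>
    rw [ha, Option.some.injEq] at hv
    have : l = i := by omega
    exact ⟨v, this ▸ ha, .refl, .refl⟩
  | @head a b hp hbv ih =>
    rcases hil.eq_or_lt with rfl | hlt
    · exact ⟨a, ha, .refl, .head hp hbv⟩
    · obtain ⟨k, h3, h4, _⟩ := h.parent_spec hp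
      rw [ha, Option.some.injEq] at h3
      subst h3
      obtain ⟨x, h5, h6, h7⟩ := ih h4 hlt
      exact ⟨x, h5, .head hp h6, h7⟩

/-- Emptiness is inherited by all descendants, and a node of pulse `p` itself is never `p`-empty. -/
theorem ExecAnc.not_empty (h : Inv G s t L c) {a v : V} (hav : ExecAnc c a v) {p : ℕ}
    (hv : (c.state v).pulse = some p) : ¬ (c.state a).KnowsEmpty G a p := by
  intro ha
  suffices (c.state v).KnowsEmpty G v p from this.2.1 hv
  clear hv
  induction hav with
  | refl => exact ha
  | tail _ hp ih => exact h.child_empty ih hp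

/-! ### Stability in executions -/

section Execution

variable {σ : ℕ → Conf V κ}

theorem exec_searchMono (hσ : IsFairExecution G (algorithm G s t L) σ) (n : ℕ) :
    SearchMono (searchView (σ n)) (searchView (σ (n + 1))) :=
  (exec_search hσ n).mono (exec_trans hσ n).search

theorem exec_stable {P : ℕ → Prop} (h : ∀ n, P n → P (n + 1)) {n m : ℕ} (hnm : n ≤ m) (hn : P n) :
    P m := by
  induction m, hnm using Nat.le_induction with
  | base => exact hn
  | succ m _ ih => exact h m ih

variable {n m : ℕ}

theorem exec_pulse (hσ : IsFairExecution G (algorithm G s t L) σ) (hnm : n ≤ m) {v : V} {k : ℕ}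
    (h : ((σ n).state v).pulse = some k) : ((σ m).state v).pulse = some k :=
  exec_stable (P := fun n => ((σ n).state v).pulse = some k)
    (fun n hn => (exec_searchMono hσ n).pulse v k hn) hnm h

theorem exec_parent (hσ : IsFairExecution G (algorithm G s t L) σ) (hnm : n ≤ m) {v u : V}
    (h : ((σ n).state v).parent = some u) : ((σ m).state v).parent = some u := by
  refine exec_stable (P := fun n => ((σ n).state v).parent = some u) (fun n hn => ?_) hnm h
  obtain ⟨k, _, hk, _⟩ := (exec_inv hσ n).parent_spec hn
  have := (exec_searchMono hσ n).parent v (by simp [searchView, hk])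
  exact this.trans hn

/-- A node that has a pulse has its final parent. -/
theorem exec_parent_eq (hσ : IsFairExecution G (algorithm G s t L) σ) (hnm : n ≤ m) {v u : V}
    (hv : ((σ n).state v).pulse ≠ none) (h : ((σ m).state v).parent = some u) :
    ((σ n).state v).parent = some u := by
  have hs : v ≠ s := by
    rintro rfl
    have : ((σ m).state v).parent = none := (exec_search hσ m).source.2
    simp [this] at h
  obtain ⟨w, hw⟩ := (exec_inv hσ n).exists_parent hv hs
  have := exec_parent hσ hnm hw
  rwa [← this.symm.trans h]

theorem exec_knowsSafe (hσ : IsFairExecution G (algorithm G s t L) σ) (hnm : n ≤ m) {u : V}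
    {p : ℕ} (h : ((σ n).state u).KnowsSafe G u p) : ((σ m).state u).KnowsSafe G u p :=
  exec_stable (P := fun n => ((σ n).state u).KnowsSafe G u p) (fun n hn =>
    ((exec_inv hσ n).knowsSafe_mono (exec_trans hσ n) (exec_search hσ _) hn).1) hnm h

theorem exec_knowsEmpty (hσ : IsFairExecution G (algorithm G s t L) σ) (hnm : n ≤ m) {u : V}
    {p : ℕ} (h : ((σ n).state u).KnowsEmpty G u p) : ((σ m).state u).KnowsEmpty G u p :=
  exec_stable (P := fun n => ((σ n).state u).KnowsEmpty G u p) (fun n hn =>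
    (exec_inv hσ n).knowsEmpty_mono (exec_trans hσ n) (exec_search hσ _) hn) hnm h

theorem exec_rank (hσ : IsFairExecution G (algorithm G s t L) σ) (hnm : n ≤ m) (u : V) (p : ℕ)
    (d : κ) : (((σ n).state u).reg p d).status.rank ≤ (((σ m).state u).reg p d).status.rank :=
  (exec_reg hσ p d).rank_mono u hnm

theorem ExecAnc.mono (hσ : IsFairExecution G (algorithm G s t L) σ) (hnm : n ≤ m) {a v : V}
    (h : ExecAnc (σ n) a v) : ExecAnc (σ m) a v :=
  Relation.ReflTransGen.mono (fun _ _ h => exec_parent hσ hnm h) _ _ h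

/-! ### When nodes register and deregister -/

/-- A node registers for `p` only if its pulse is `prev (prev p)`, and in its own clusters. -/
theorem exec_reg_guard (hσ : IsFairExecution G (algorithm G s t L) σ) (n : ℕ) (u : V) (p : ℕ)
    (d : κ) (h : (((σ n).state u).reg p d).status ≠ .idle) :
    0 < p ∧ p ≤ 2 ^ t ∧ ((σ n).state u).pulse = some (prev (prev p)) ∧ RegCluster L u p d := by
  induction n with
  | zero =>
    rw [hσ.start] at h
    simp [AsyncAlgorithm.initial, algorithm, initState, RegState.start] at h
  | succ n ih =>
    have key : (((σ n).state u).reg p d).status ≠ .idle → 0 < p ∧ p ≤ 2 ^ t ∧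
        ((σ (n + 1)).state u).pulse = some (prev (prev p)) ∧ RegCluster L u p d := fun h => by
      obtain ⟨h1, h2, h3, h4⟩ := ih h
      exact ⟨h1, h2, exec_pulse hσ (Nat.le_succ n) h3, h4⟩
    rcases (exec_trans hσ n).regState u p d with h1 | ⟨w, y, h1⟩ | ⟨⟨h1, h2, h3, h4, h5⟩, h6⟩ |
      ⟨⟨h1, _⟩, _⟩
    · rw [h1] at h; exact key h
    · refine key fun hi => h ?_
      rw [h1]
      exact (RegState.receive_status _ _ _ _ _).1 hi
    · exact ⟨h1, h2, exec_pulse hσ (Nat.le_succ n) h3, h4⟩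
    · exact key (by simp [h1])

/-- When a node deregisters, it is still registered and knows that it is `p`-safe. -/
theorem exec_deregister (hσ : IsFairExecution G (algorithm G s t L) σ) (n : ℕ) (u : V) (p : ℕ)
    (d : κ) (h : (((σ n).state u).reg p d).status = .deregistered ∨
      (((σ n).state u).reg p d).status = .free) :
    ∃ m ≤ n, (((σ m).state u).reg p d).status = .registered ∧
      ((σ m).state u).KnowsSafe G u p := by
  induction n with
  | zero =>
    rw [hσ.start] at h
    simp [AsyncAlgorithm.initial, algorithm, initState, RegState.start] at h
  | succ n ih =>
    by_cases h0 : (((σ n).state u).reg p d).status = .deregistered ∨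
        (((σ n).state u).reg p d).status = .free
    · obtain ⟨m, hm, h1⟩ := ih h0
      exact ⟨m, by omega, h1⟩
    · have hrank := (exec_reg hσ p d).inv n
      rcases (exec_trans hσ n).regState u p d with h1 | ⟨w, y, h1⟩ | ⟨⟨h1, h2, h3, h4, h5⟩, h6⟩ |
        ⟨h1, _⟩
      · rw [h1] at h; exact (h0 h).elim
      · exfalso
        cases hs : (((σ n).state u).reg p d).status with
        | idle =>
          rw [h1, (RegState.receive_status _ _ _ _ _).1 hs] at h
          simp at h
        | registered =>
          rw [h1, (RegState.receive_status _ _ _ _ _).2 hs] at h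
          simp at h
        -- The table `Effect.status` lets a registering node only stay as it is or become
        -- registered, so it cannot have deregistered in this step.
        | registering =>
          rcases ((exec_trans hσ n).reg p d).nodeEvent with he | ⟨x, r, hev, hst, _⟩
          · have : ((σ (n + 1)).state u).reg p d = ((σ n).state u).reg p d :=
              congrFun (congrArg RegConfig.st he) u
            rw [this] at h; exact h0 h
          · have hx : ((σ (n + 1)).state u).reg p d =
                Function.update (regView p d (σ n)).st x r.1 u := congrFun hst u
            by_cases hux : u = x
            · subst hux
              rw [Function.update_self] at hx
              have he := (hrank.effect hev).status
              have e1 : ((regView p d (σ n)).st u).status = .registering := hs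
              rw [hx] at h
              rw [e1] at he
              rcases h with h | h <;> rw [h] at he <;> simp at he
            · rw [Function.update_of_ne hux] at hx
              rw [hx] at h
              exact h0 h
        | deregistered => exact h0 (Or.inl hs)
        | free => exact h0 (Or.inr hs)
      · exfalso
        rw [h6] at h
        simp only [RegState.register, RegState.runRegister, RegState.complete] at h
        split_ifs at h <;> simp at h
      · exact ⟨n, by omega, h1⟩

end Execution

end

section

open Filter
open AsyncAlgorithm NodeState
variable {V κ : Type*} {G : SimpleGraph V} {s : V} {t : ℕ}

/-! ### Go-Aheads in the execution tree -/

/-- Node `a` may issue the Go-Ahead for pulse `p`. -/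
def Released {J : ℕ} (t : ℕ) (L : LayeredCover G κ J) (c : Conf V κ) (a : V) (p : ℕ) : Prop :=
  0 < p ∧ p ≤ 2 ^ t ∧ (c.state a).pulse = some (prev (prev p)) ∧
    ∀ d, RegCluster L a p d → ((c.state a).reg p d).status = .free

theorem RegStatus.eq_free_of_rank_le {x : RegStatus} (h : RegStatus.rank .free ≤ x.rank) :
    x = .free := by
  cases x <;> simp [RegStatus.rank] at h ⊢

section Stability

variable {J : ℕ} {L : LayeredCover G κ J} {σ : ℕ → Conf V κ} {n m : ℕ}

theorem exec_status_free (hσ : IsFairExecution G (algorithm G s t L) σ) (hnm : n ≤ m) {a : V}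
    {p : ℕ} {d : κ} (h : (((σ n).state a).reg p d).status = .free) :
    (((σ m).state a).reg p d).status = .free :=
  RegStatus.eq_free_of_rank_le (h ▸ exec_rank hσ hnm a p d)

theorem exec_released (hσ : IsFairExecution G (algorithm G s t L) σ) (hnm : n ≤ m) {a : V} {p : ℕ}
    (h : Released t L (σ n) a p) : Released t L (σ m) a p :=
  ⟨h.1, h.2.1, exec_pulse hσ hnm h.2.2.1, fun d hd => exec_status_free hσ hnm (h.2.2.2 d hd)⟩

theorem exec_go_mono (hσ : IsFairExecution G (algorithm G s t L) σ) (hnm : n ≤ m) {v : V} {p : ℕ}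
    (h : ((σ n).state v).go p = true) : ((σ m).state v).go p = true := by
  refine exec_stable (P := fun n => ((σ n).state v).go p = true) (fun n hn => ?_) hnm h
  rcases (exec_trans hσ n).go p with ⟨h1, _⟩ | ⟨w, _, h1, _⟩
  · rw [h1]; exact hn
  · rw [h1]; split_ifs
    · rfl
    · exact hn

/-- A node of positive pulse `k` that has sent its proposals has the Go-Ahead for `k`. -/
theorem exec_go_of_sent (hσ : IsFairExecution G (algorithm G s t L) σ) (n : ℕ) {v : V} {k : ℕ}
    (hk : 0 < k) (hv : ((σ n).state v).pulse = some k) (hs : ((σ n).state v).sent = true) :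
    ((σ n).state v).go k = true := by
  induction n with
  | zero =>
    rw [hσ.start] at hs
    simp [AsyncAlgorithm.initial, algorithm, initState] at hs
  | succ n ih =>
    rcases (exec_trans hσ n).sent hs with h | ⟨k', h1, h2⟩
    · obtain ⟨k', h1, _⟩ := (exec_search hσ n).sent v h
      have h1' : ((σ n).state v).pulse = some k' := h1
      have h2 := exec_pulse hσ (Nat.le_succ n) h1'
      rw [hv, Option.some.injEq] at h2
      subst h2
      exact exec_go_mono hσ (Nat.le_succ n) (ih h1' h)
    · have h3 := exec_pulse hσ (Nat.le_succ n) h1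
      rw [hv, Option.some.injEq] at h3
      subst h3
      rcases h2 with h2 | h2
      · omega
      · exact exec_go_mono hσ (Nat.le_succ n) h2

/-- What a node that is `p`-safe knows to be its subtree stays its subtree, up to pulse `p`. -/
theorem exec_descendant_safe (hσ : IsFairExecution G (algorithm G s t L) σ) (hnm : n ≤ m) {a x : V}
    {p j : ℕ} (ha : ((σ n).state a).KnowsSafe G a p) (hax : ExecAnc (σ m) a x)
    (hx : ((σ m).state x).pulse = some j) (hj : j ≤ p) :
    ExecAnc (σ n) a x ∧ ((σ n).state x).KnowsSafe G x p := by
  induction hax generalizing j with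
  | refl => exact ⟨.refl, ha⟩
  | @tail b w _ hp ih =>
    obtain ⟨k, h1, h2, _, hadj, _⟩ := (exec_inv hσ m).parent_spec hp
    rw [hx, Option.some.injEq] at h2
    obtain ⟨h3, h4⟩ := ih h1 (by omega)
    obtain ⟨k', h5, _⟩ := id h4
    have h6 := exec_pulse hσ hnm h5
    rw [h1, Option.some.injEq] at h6
    have hne : ((σ n).state b).pulse ≠ some p := by
      rw [h5, Ne, Option.some.injEq]; omega
    -- At time `n` the node `b` already had all its answers, so its neighbour `w` had a pulse and
    -- therefore its final parent.
    have h7 := (exec_inv hσ n).pulse_of_answered (answered_of_knowsSafe h4 hne) hadj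
    have h8 := exec_parent_eq hσ hnm h7 hp
    exact ⟨h3.tail h8, ((exec_inv hσ n).child_safe h4 hne h8).2⟩

end Stability

variable {L : LayeredCover G κ (t + 6)} {σ : ℕ → Conf V κ}

/-- As `level p ≤ t`, the cover with index `level p + 5` is among the given ones. -/
theorem exists_regCluster (L : LayeredCover G κ (t + 6)) {p : ℕ} (hp : 0 < p) (hpt : p ≤ 2 ^ t)
    {a b : V} (hab : G.edist a b ≤ ((2 ^ (level p + 5) : ℕ) : ℕ∞)) :
    ∃ d, RegCluster L a p d ∧ RegCluster L b p d := by
  have := level_le_of_le_two_pow hp hpt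
  obtain ⟨d, h1, h2, h3⟩ := L.covers (level p + 5) (by omega) a b hab
  exact ⟨d, ⟨h1, h2⟩, ⟨h1, h3⟩⟩

/-- The condition on all clusters is not vacuous: the cover property for the pair `(a, a)` supplies
one. Being freed there presupposes a deregistration, which required `p`-safety. -/
theorem Released.knowsSafe (hσ : IsFairExecution G (algorithm G s t L) σ) {n : ℕ} {a : V} {p : ℕ}
    (h : Released t L (σ n) a p) : ((σ n).state a).KnowsSafe G a p := by
  obtain ⟨h1, h2, h3, h4⟩ := h
  obtain ⟨d, hd, _⟩ := exists_regCluster L h1 h2 (a := a) (b := a) (by simp)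
  obtain ⟨m, hm, _, h5⟩ := exec_deregister hσ n a p d (Or.inr (h4 d hd))
  exact exec_knowsSafe hσ hm h5

/-- The invariants of the Go-Aheads for pulse `p`. -/
structure GoInv (t : ℕ) (L : LayeredCover G κ (t + 6)) (c : Conf V κ) (p : ℕ) : Prop where
  go : ∀ v, (c.state v).go p = true → (c.state v).KnowsSafe G v p ∧
    ∃ a, Released t L c a p ∧ ExecAnc c a v
  chan : ∀ u v, .goAhead p ∈ c.chan u v (.release p) → (c.state u).go p = true ∧
    (c.state v).parent = some u ∧ ∃ k, (c.state u).pulse = some k ∧ k < p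
  pass : ∀ u w k, (c.state u).go p = true → (c.state u).pulse = some k → k < p →
    (c.state w).parent = some u → (c.state w).go p = true ∨ .goAhead p ∈ c.chan u w (.release p)

/-- Go-Aheads start at nodes that know they are `p`-safe, and safety is inherited downwards, so each
node they visit has its final set of children whenever its pulse is below `p`. For this reason no
child is missed when the Go-Ahead is relayed. -/
theorem exec_goInv (hσ : IsFairExecution G (algorithm G s t L) σ) (n p : ℕ) :
    GoInv t L (σ n) p := by
  induction n with
  | zero =>
    rw [hσ.start]
    constructor <;> simp [AsyncAlgorithm.initial, algorithm, initState]
  | succ n ih =>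
    have hn := Nat.le_succ n
    have hI := exec_inv hσ n
    have hold : ∀ v, ((σ n).state v).go p = true → ((σ (n + 1)).state v).KnowsSafe G v p ∧
        ∃ a, Released t L (σ (n + 1)) a p ∧ ExecAnc (σ (n + 1)) a v := fun v hv => by
      obtain ⟨h1, a, h2, h3⟩ := ih.go v hv
      exact ⟨exec_knowsSafe hσ hn h1, a, exec_released hσ hn h2, h3.mono hσ hn⟩
    -- A child of `u` after the step was already a child that `u` knew before it, since `u` had
    -- received all its answers.
    have hpar : ∀ u w k, ((σ n).state u).KnowsSafe G u p → ((σ (n + 1)).state u).pulse = some k →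
        k < p → ((σ (n + 1)).state w).parent = some u → ((σ n).state u).pulse = some k ∧
        ((σ n).state w).parent = some u ∧ ((σ n).state u).IsExecChild w ∧ G.Adj u w := by
      intro u w k hu hk hkp hw
      obtain ⟨k', h5, _⟩ := id hu
      have h6 := exec_pulse hσ hn h5
      rw [hk, Option.some.injEq] at h6
      subst h6
      obtain ⟨_, _, _, _, hadj, _⟩ := (exec_inv hσ (n + 1)).parent_spec hw
      have ha := answered_of_knowsSafe hu (by rw [h5, Ne, Option.some.injEq]; omega)
      have h7 := exec_parent_eq hσ hn (hI.pulse_of_answered ha hadj) hw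
      exact ⟨h5, h7, hI.answer_of_child ha h7, hadj⟩
    rcases (exec_trans hσ n).go p with ⟨h1, h2⟩ | ⟨v, h1, h2, h3, h4, h5⟩
    · refine ⟨fun v hv => hold v (by rwa [h1] at hv), fun u v hm => ?_, fun u w k hu hk hkp hw => ?_⟩
      · rw [h2] at hm
        obtain ⟨h3, h4, k, h5, h6⟩ := ih.chan u v hm
        exact ⟨exec_go_mono hσ hn h3, exec_parent hσ hn h4, k, exec_pulse hσ hn h5, h6⟩
      · rw [h1] at hu
        obtain ⟨h5, h7, _⟩ := hpar u w k (ih.go u hu).1 hk hkp hw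
        rw [h1, h2]
        exact ih.pass u w k hu h5 hkp h7
    · have hv : ((σ n).state v).KnowsSafe G v p ∧
          ∃ a, Released t L (σ n) a p ∧ ExecAnc (σ n) a v := by
        rcases h1 with h1 | ⟨u, hu⟩
        · exact ⟨Released.knowsSafe hσ h1, v, h1, .refl⟩
        · obtain ⟨h6, h7, k, h8, h9⟩ := ih.chan u v hu
          obtain ⟨h10, a, h11, h12⟩ := ih.go u h6
          exact ⟨(hI.child_safe h10 (by rw [h8, Ne, Option.some.injEq]; omega) h7).2, a, h11,
            h12.tail h7⟩
      have hgo : ((σ (n + 1)).state v).go p = true := by rw [h2, if_pos rfl]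
      refine ⟨fun w hw => ?_, fun a b hm => ?_, fun u w k hu hk hkp hw => ?_⟩
      · by_cases hwv : w = v
        · subst hwv
          obtain ⟨h6, a, h7, h8⟩ := hv
          exact ⟨exec_knowsSafe hσ hn h6, a, exec_released hσ hn h7, h8.mono hσ hn⟩
        · rw [h2, if_neg hwv] at hw
          exact hold w hw
      · rcases h3 a b _ hm with hm | ⟨rfl, h6, k, h7, h8⟩
        · obtain ⟨h3, h4, k, h5, h6⟩ := ih.chan a b hm
          exact ⟨exec_go_mono hσ hn h3, exec_parent hσ hn h4, k, exec_pulse hσ hn h5, h6⟩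
        · exact ⟨hgo, exec_parent hσ hn (hI.parent_of_execChild h6), k, exec_pulse hσ hn h7, h8⟩
      · by_cases huv : u = v
        · subst huv
          obtain ⟨h6, h7, h8, hadj⟩ := hpar u w k hv.1 hk hkp hw
          exact Or.inr (h5 w h8 hadj ⟨k, h6, hkp⟩)
        · rw [h2, if_neg huv] at hu
          obtain ⟨h6, h7, _⟩ := hpar u w k (ih.go u hu).1 hk hkp hw
          rcases ih.pass u w k hu h6 hkp h7 with h8 | h8
          · exact Or.inl (exec_go_mono hσ hn h8)
          · by_cases hwv : w = v
            · exact Or.inl (hwv ▸ hgo)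
            · exact Or.inr (h4 u w hwv _ h8)

/-! ### Pulses are distances -/

theorem eq_of_edist_eq_zero {a b : V} (h : G.edist a b = ((0 : ℕ) : ℕ∞)) : a = b :=
  SimpleGraph.edist_eq_zero_iff.1 (h.trans Nat.cast_zero)

/-- Every pulse is the distance from the source. -/
def Correct (G : SimpleGraph V) (s : V) (c : Conf V κ) : Prop :=
  ∀ v k, (c.state v).pulse = some k → (k : ℕ∞) = G.edist v s

theorem Correct.of_le (hσ : IsFairExecution G (algorithm G s t L) σ) {n m : ℕ} (hnm : n ≤ m)
    (h : Correct G s (σ m)) : Correct G s (σ n) :=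
  fun v k hv => h v k (exec_pulse hσ hnm hv)

theorem Correct.pulse_eq {c : Conf V κ} (h : Correct G s c) {v : V} {k : ℕ}
    (hv : (c.state v).pulse ≠ none) (hk : G.edist v s = (k : ℕ∞)) : (c.state v).pulse = some k := by
  obtain ⟨k', hk'⟩ := Option.ne_none_iff_exists'.1 hv
  have h1 := h v k' hk'
  rw [hk] at h1
  rw [hk', Nat.cast_injective (R := ℕ∞) h1]

/-- A node that knows to be `p`-safe, or knows to be `q`-empty. -/
def SafeOrEmpty (G : SimpleGraph V) (c : Conf V κ) (p q : ℕ) (u : V) : Prop :=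
  (c.state u).KnowsSafe G u p ∨ (c.state u).KnowsEmpty G u q

section SafeOrEmpty

variable {c : Conf V κ} {p q : ℕ}

/-- Emptiness can replace safety in the spreading argument: a `q`-empty node has all its answers
whatever `p` is, and its descendants are `q`-empty too. -/
theorem SafeOrEmpty.answered {u : V} {k : ℕ} (h : SafeOrEmpty G c p q u)
    (hk : (c.state u).pulse = some k) (hkp : k < p) : Answered G c u := by
  rcases h with h | h
  · exact answered_of_knowsSafe h (by rw [hk, Ne, Option.some.injEq]; omega)
  · exact answered_of_knowsSafe h.1 h.2.1

theorem SafeOrEmpty.child (hI : Inv G s t L c) {u v : V} {k : ℕ} (h : SafeOrEmpty G c p q u)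
    (hk : (c.state u).pulse = some k) (hkp : k < p) (hv : (c.state v).parent = some u) :
    SafeOrEmpty G c p q v := by
  rcases h with h | h
  · exact Or.inl (hI.child_safe h (by rw [hk, Ne, Option.some.injEq]; omega) hv).2
  · exact Or.inr (hI.child_empty h hv)

/-- Pulses and safety spread from the nodes at distance `k` in a ball. -/
theorem Correct.ball (hc : Correct G s c) (hI : Inv G s t L c) {k : ℕ} {v₀ : V} {R : ℕ∞}
    (hbase : ∀ b, G.edist b s = (k : ℕ∞) → G.edist b v₀ ≤ R →
      (c.state b).pulse ≠ none ∧ SafeOrEmpty G c p q b) (j : ℕ) (hj : k + j ≤ p) (x : V)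
    (hx : G.edist x s = ((k + j : ℕ) : ℕ∞)) (hR : G.edist x v₀ + (j : ℕ∞) ≤ R) :
    (c.state x).pulse ≠ none ∧ SafeOrEmpty G c p q x ∧
      (0 < j → ∃ z, (c.state x).parent = some z ∧ (c.state z).pulse = some (k + j - 1) ∧
        SafeOrEmpty G c p q z) := by
  induction j generalizing x with
  | zero =>
    obtain ⟨h1, h2⟩ := hbase x hx (by simpa using hR)
    exact ⟨h1, h2, by simp⟩
  | succ j ih =>
    -- Moving to a neighbour costs at most 1 of the radius, which is what `j` loses; so every
    -- neighbour of `x` that is closer to the source is covered by the induction hypothesis.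
    have hstep : ∀ y, G.Adj x y → G.edist y s = ((k + j : ℕ) : ℕ∞) →
        (c.state y).pulse = some (k + j) ∧ SafeOrEmpty G c p q y := fun y hadj hy => by
      obtain ⟨h1, h2, _⟩ := ih (by omega) y hy (by
        refine le_trans ?_ hR
        have := edist_le_add_one hadj.symm v₀
        calc G.edist y v₀ + (j : ℕ∞) ≤ G.edist x v₀ + 1 + j := by gcongr
          _ = _ := by push_cast; ring)
      exact ⟨hc.pulse_eq h1 hy, h2⟩
    obtain ⟨y, hadj, hy⟩ := exists_adj_edist (i := k + j) hx
    obtain ⟨h1, h2⟩ := hstep y hadj hy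
    have h3 := hI.pulse_of_answered (h2.answered h1 (by omega)) hadj.symm
    have h4 := hc.pulse_eq h3 hx
    have hs : x ≠ s := by
      rintro rfl
      rw [SimpleGraph.edist_self] at hx
      have : (0 : ℕ) = k + (j + 1) := by exact_mod_cast hx
      omega
    -- The tree parent of `x` may differ from `y`, but correct pulses put it at the same distance,
    -- so it too is covered and passes its property on to `x`.
    obtain ⟨z, hz⟩ := hI.exists_parent h3 hs
    obtain ⟨k', h5, h6, _, h7, _⟩ := hI.parent_spec hz
    rw [h4, Option.some.injEq] at h6
    obtain rfl : k' = k + j := by omega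
    obtain ⟨_, h8⟩ := hstep z h7.symm (hc z _ h5).symm
    exact ⟨h3, h8.child hI h5 (by omega) hz, fun _ => ⟨z, hz, h5, h8⟩⟩

end SafeOrEmpty

/-- Around a node of pulse `p` that has the Go-Ahead for `p`, all nodes at distance
`prev (prev p)` from the source know that they are `p`-safe, or that they are `prev p`-empty. -/
theorem exec_covered (hσ : IsFairExecution G (algorithm G s t L) σ) (p : ℕ) :
    ∀ n, Correct G s (σ n) → ∀ v, ((σ n).state v).pulse = some p → ((σ n).state v).go p = true →
      ∀ b, G.edist b s = (prev (prev p) : ℕ∞) → G.edist b v ≤ ((23 * 2 ^ level p : ℕ) : ℕ∞) →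
        ((σ n).state b).pulse ≠ none ∧ SafeOrEmpty G (σ n) p (prev p) b := by
  induction p using Nat.strong_induction_on with
  | _ p ih =>
    intro n hc v hv hgo b hb hbv
    obtain ⟨-, a, hrel, hav⟩ := (exec_goInv hσ n p).go v hgo
    obtain ⟨hp, hpt, hpa, hfree⟩ := id hrel
    -- If `prev (prev p)` is zero, both `a` and `b` are the source, and `a` is `p`-safe.
    rcases Nat.eq_zero_or_pos (prev (prev p)) with hpp | hpp
    · have ha := hc a _ hpa
      rw [hpp] at hb ha
      have ha' : a = s := eq_of_edist_eq_zero ha.symm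
      have hb' : b = s := eq_of_edist_eq_zero hb
      subst hb'
      subst ha'
      exact ⟨by simp [hpa], Or.inl (Released.knowsSafe hσ hrel)⟩
    · have hp1 : 0 < prev p := hpp.trans_le (prev_le _)
      have hlt := prev_lt hp
      have hl1 := level_prev hp1
      have hl2 := level_prev hpp
      have e1 := le_prev_add p
      have e2 := le_prev_prev_add p
      have e3 := le_prev_add (prev (prev p))
      rw [hl2, hl1, pow_succ, pow_succ] at e3
      obtain ⟨D, h1, h2⟩ := hav.pulse (exec_inv hσ n) hpa
      rw [hv, Option.some.injEq] at h1
      -- The tree path from `a` to `v` has length at most `9 * 2 ^ level p`, and `b` is within `23 *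
      -- 2 ^ level p` of `v`: together 32 times, the scale of the cover. This is the upper limit for
      -- the constant 23.
      have hab : G.edist a b ≤ ((2 ^ (level p + 5) : ℕ) : ℕ∞) := by
        refine (SimpleGraph.edist_triangle (v := v)).trans ?_
        rw [SimpleGraph.edist_comm (u := v)]
        refine (add_le_add h2 hbv).trans ?_
        rw [← Nat.cast_add, Nat.cast_le, pow_add]
        omega
      obtain ⟨d, hda, hdb⟩ := exists_regCluster L hp hpt hab
      -- At time `m`, `a` is still registered in `d` and already `p`-safe. The induction hypothesis
      -- is applied at this earlier time, not at `n`.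
      obtain ⟨m, hm, hreg, hsafe⟩ := exec_deregister hσ n a p d (Or.inr (hfree d hda))
      have hcm := hc.of_le hσ hm
      have hIm := exec_inv hσ m
      -- The ancestor `x` of `v` of pulse `prev p` lay below `a` already at time `m` and had sent
      -- its proposals, so it had the Go-Ahead for `prev p`.
      obtain ⟨x, hx, hax, hxv⟩ := hav.exists_pulse (exec_inv hσ n) hpa hv (prev_le (prev p)) hlt.le
      obtain ⟨hax', hxs⟩ := exec_descendant_safe hσ hm hsafe hax hx hlt.le
      obtain ⟨k', hk', -⟩ := id hxs
      have := exec_pulse hσ hm hk'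
      rw [hx, Option.some.injEq] at this
      subst this
      have hxa := answered_of_knowsSafe hxs (by rw [hk', Ne, Option.some.injEq]; omega)
      have hxgo := exec_go_of_sent hσ m hp1 hk' hxa.1
      have hbase := ih (prev p) hlt m hcm x hk' hxgo
      obtain ⟨D', h3, h4⟩ := hxv.pulse (exec_inv hσ n) hx
      rw [hv, Option.some.injEq] at h3
      have hlt3 := prev_lt hpp
      -- In units of `2 ^ level p`: 23 from `b` to `v`, at most 3 from `v` to `x`, and at most 12
      -- for the difference of the pulses `prev (prev p)` and `prev (prev (prev p))`. The sum 38 is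
      -- below the 46 available one level higher.
      have hbx : G.edist b x + ((prev (prev p) - prev (prev (prev p)) : ℕ) : ℕ∞) ≤
          ((23 * 2 ^ level (prev p) : ℕ) : ℕ∞) := by
        calc G.edist b x + ((prev (prev p) - prev (prev (prev p)) : ℕ) : ℕ∞)
            ≤ (G.edist b v + G.edist v x) + ((prev (prev p) - prev (prev (prev p)) : ℕ) : ℕ∞) := by
              gcongr; exact SimpleGraph.edist_triangle
          _ ≤ (((23 * 2 ^ level p : ℕ) : ℕ∞) + (D' : ℕ∞)) +
                ((prev (prev p) - prev (prev (prev p)) : ℕ) : ℕ∞) := by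
              rw [SimpleGraph.edist_comm (u := v)]; gcongr
          _ ≤ _ := by
              rw [← Nat.cast_add, ← Nat.cast_add, Nat.cast_le, hl1, pow_succ]
              omega
      obtain ⟨h5, -, h6⟩ := hcm.ball hIm hbase (prev (prev p) - prev (prev (prev p)))
        (by have := prev_le (prev p); omega) b (by rw [hb]; congr 1; omega) hbx
      have hbp := hcm.pulse_eq h5 hb
      obtain ⟨z, hz, hzp, hzs⟩ := h6 (by omega)
      -- The parent `z` of `b` is not `prev (prev p)`-empty because `b` has that pulse. So `z` is
      -- `prev p`-safe and has received the report of `b`.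
      have hzs' : ((σ m).state z).KnowsSafe G z (prev p) := by
        rcases hzs with h | h
        · exact h
        · exact ((hIm.child_empty h hz).2.1 hbp).elim
      have hrep := (hIm.child_safe hzs' (by
        rw [hzp, Ne, Option.some.injEq]; have := prev_le (prev p); omega) hz).1
      have hbn := exec_pulse hσ hm hbp
      refine ⟨by simp [hbn], ?_⟩
      rcases ((hIm.report (prev p)).reported b hrep).2 with h7 | h7
      · exact Or.inr (exec_knowsEmpty hσ hm h7)
      · left
        obtain ⟨h8, h9⟩ := h7 p hp hpt rfl hbp d hdb
        -- At time `m` both `a` and `b` have registered in `d`. If `b` were still registered at time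
        -- `n`, then `a` could not be free; so `b` has deregistered, being `p`-safe.
        have hnf : (((σ n).state b).reg p d).status ≠ .registered := fun hbr => by
          have hr := exec_rank hσ hm b p d
          cases hs : (((σ m).state b).reg p d).status with
          | idle => exact h8 hs
          | registering => exact h9 hs
          | registered => exact (exec_reg hσ p d).not_free hm hreg hs hbr (hfree d hda)
          | deregistered => rw [hs, hbr] at hr; simp [RegStatus.rank] at hr
          | free => rw [hs, hbr] at hr; simp [RegStatus.rank] at hr
        have hdf : (((σ n).state b).reg p d).status = .deregistered ∨
            (((σ n).state b).reg p d).status = .free := by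
          have hr := exec_rank hσ hm b p d
          cases hs : (((σ n).state b).reg p d).status <;>
            cases hs' : (((σ m).state b).reg p d).status <;>
              simp [hs, hs', RegStatus.rank] at hr hnf h8 h9 ⊢
        obtain ⟨m', hm', -, h10⟩ := exec_deregister hσ n b p d hdf
        exact exec_knowsSafe hσ hm' h10

/-- Induction on time breaks the circle with `exec_covered`, which assumes correct pulses up to the
present. A newly assigned pulse that exceeds the distance would mean that the node lies in the ball
around the proposer where all nodes already had pulses. -/
theorem exec_correct (hσ : IsFairExecution G (algorithm G s t L) σ) (n : ℕ) :
    Correct G s (σ n) := by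
  induction n with
  | zero =>
    rw [hσ.start]
    intro v k hv
    by_cases hs : v = s
    · simp [AsyncAlgorithm.initial, algorithm, initState, hs] at hv
      simp [hs, ← hv]
    · simp [AsyncAlgorithm.initial, algorithm, initState, hs] at hv
  | succ n ih =>
    intro v k hv
    by_cases hvn : ((σ n).state v).pulse = none
    swap
    · obtain ⟨k', hk'⟩ := Option.ne_none_iff_exists'.1 hvn
      have := exec_pulse hσ (Nat.le_succ n) hk'
      rw [hv, Option.some.injEq] at this
      exact ih v k (this ▸ hk')
    have hI := exec_inv hσ n
    have hs : v ≠ s := by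
      rintro rfl
      have : ((σ n).state v).pulse = some 0 := hI.search.source.1
      simp [this] at hvn
    obtain ⟨u, hu⟩ := (exec_inv hσ (n + 1)).exists_parent (by simp [hv]) hs
    obtain ⟨k', h1, h2, hsent, hadj, _⟩ := (exec_inv hσ (n + 1)).parent_spec hu
    rw [hv, Option.some.injEq] at h2
    subst h2
    -- The parent appears in the step that delivers its proposal, so its pulse and the sending of
    -- its proposals date from before that step.
    obtain ⟨hu1, hu2⟩ : ((σ n).state u).pulse = some k' ∧ ((σ n).state u).sent = true := by
      have hst := (exec_trans hσ n).search
      have key : ∀ y : SearchConfig V κ, (searchView (σ n)).Step G (2 ^ t) y → y.pulse u = some k' →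
          y.parent v = some u → (searchView (σ n)).pulse u = some k' ∧
          (searchView (σ n)).sent u = true := by
        intro y hy h1 h2
        have hpn : (searchView (σ n)).parent v ≠ some u := fun h => by
          obtain ⟨_, _, h3, _⟩ := hI.search.parent u v h
          have h4 : (searchView (σ n)).pulse v = none := hvn
          simp [h4] at h3
        cases hy with
        | accept a b i rest hm hab hb =>
          have hbv : v = b := by
            by_contra hne
            exact hpn (by simpa [hne] using h2)
          subst hbv
          obtain rfl : a = u := by simpa using h2
          have h3 : (searchView (σ n)).pulse a = some k' := by simpa [hab.ne] using h1
          refine ⟨h3, ?_⟩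
          have hcnt := hI.search.count a v
          rw [hm] at hcnt
          by_contra hns
          simp [hns] at hcnt
        | _ => exact (hpn h2).elim
      exact key _ hst h1 hu
    have hdu := ih u k' hu1
    have hle : G.edist v s ≤ ((k' + 1 : ℕ) : ℕ∞) := by
      have := edist_le_add_one hadj.symm s
      rw [← hdu] at this
      exact_mod_cast this
    obtain ⟨i, hi⟩ := ENat.ne_top_iff_exists.1 (ne_top_of_le_ne_top (ENat.natCast_ne_top _) hle)
    rw [← hi, Nat.cast_le] at hle
    have hge : k' ≤ i + 1 := by
      have := edist_le_add_one hadj s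
      rw [← hdu, ← hi] at this
      exact_mod_cast this
    rcases hle.eq_or_lt with rfl | hlt
    · exact hi
    exfalso
    rcases Nat.eq_zero_or_pos k' with rfl | hk
    · have : i = 0 := by omega
      subst this
      exact hs (eq_of_edist_eq_zero hi.symm)
    · have hgo := exec_go_of_sent hσ n hk hu1 hu2
      have hbase := exec_covered hσ k' n ih u hu1 hgo
      have e1 := prev_prev_lt hk
      have e2 := le_prev_prev_add k'
      have e3 : 0 < 2 ^ level k' := by positivity
      -- The number of steps is at most `9 * 2 ^ level k'`, plus 1 for the edge from `u` to `v`;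
      -- this is within the radius `23 * 2 ^ level k'`.
      refine (ih.ball hI hbase (i - prev (prev k')) (by omega) v ?_ ?_).1 hvn
      · rw [← hi]; congr 1; omega
      · rw [SimpleGraph.edist_eq_one_iff_adj.2 hadj.symm, ← Nat.cast_one, ← Nat.cast_add,
          Nat.cast_le]
        omega

end

section

open Filter
open AsyncAlgorithm NodeState
variable {V κ : Type*} {G : SimpleGraph V} {s : V} {t : ℕ}

/-! ### The checking stage -/

/-- The invariants of the checking stage in the cluster `d`. -/
structure CheckInv {J : ℕ} (G : SimpleGraph V) (s : V) (t : ℕ) (L : LayeredCover G κ J) (d : κ)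
    (c : Conf V κ) : Prop where
  sent : ∀ v, (c.state v).checkSent d = true → SubtreeDone G s t L v (c.state v) d
  child : ∀ u w, (c.state u).checkedChild d w = true → (c.state w).checkSent d = true
  up : ∀ a b, .checkUp d ∈ c.chan a b (.check d) → (c.state a).checkSent d = true
  confirmed : ∀ v, (c.state v).confirmed d = true →
    SubtreeDone G s t L (L.cluster d).root (c.state (L.cluster d).root) d
  down : ∀ a b, .checkDown d ∈ c.chan a b (.check d) →
    SubtreeDone G s t L (L.cluster d).root (c.state (L.cluster d).root) d
  sent_parent : ∀ v, (c.state v).checkSent d = true → G.Adj v ((L.cluster d).parent v) →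
    (c.state ((L.cluster d).parent v)).checkedChild d v = true ∨
      .checkUp d ∈ c.chan v ((L.cluster d).parent v) (.check d)
  confirmed_child : ∀ u w, (c.state u).confirmed d = true → (L.cluster d).IsChild u w →
    (c.state w).confirmed d = true ∨ .checkDown d ∈ c.chan u w (.check d)

variable {J : ℕ} {L : LayeredCover G κ J} {σ : ℕ → Conf V κ}

theorem exec_subtreeDone_succ (hσ : IsFairExecution G (algorithm G s t L) σ) {n : ℕ} {u : V} {d : κ}
    (h : SubtreeDone G s t L u ((σ n).state u) d) :
    SubtreeDone G s t L u ((σ (n + 1)).state u) d := by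
  obtain ⟨h1, h2, h3, h4⟩ := h
  refine ⟨h1, h2, fun hs => exec_knowsSafe hσ (Nat.le_succ n) (h3 hs), fun w hw => ?_⟩
  have h5 := h4 w hw
  rcases (exec_trans hσ n).check d with ⟨e, _⟩ | ⟨_, _, e, _⟩ | ⟨_, _, e, _⟩ | ⟨_, _, _, e, _⟩
  · rw [e]; exact h5
  · rw [e]; exact h5
  · rw [e]; exact h5
  · rw [e]; split_ifs
    · rfl
    · exact h5

/-- All conditions are stable because flags are only set and safety persists. Soundness of a
confirmation uses the fields up to `down`; the last two say that no message is lost and serve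
liveness. -/
theorem exec_checkInv (hσ : IsFairExecution G (algorithm G s t L) σ) (d : κ) (n : ℕ) :
    CheckInv G s t L d (σ n) := by
  induction n with
  | zero =>
    rw [hσ.start]
    constructor <;> simp [AsyncAlgorithm.initial, algorithm, initState]
  | succ n ih =>
    obtain ⟨h1, h2, h3, h4, h5, h6, h7⟩ := ih
    have hD : ∀ u, SubtreeDone G s t L u ((σ n).state u) d →
        SubtreeDone G s t L u ((σ (n + 1)).state u) d := fun u => exec_subtreeDone_succ hσ
    rcases (exec_trans hσ n).check d with ⟨e1, e2, e3, e4⟩ | ⟨v, ⟨a0, a1⟩, e1, e2, e3, e4, e5, e6⟩ |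
      ⟨v, a0, e1, e2, e3, e4, e5, e6⟩ | ⟨u, v, a0, e1, e2, e3, e4, e5⟩
    · refine ⟨?_, ?_, ?_, ?_, ?_, ?_, ?_⟩ <;> intro a b <;> simp only [e1, e2, e3, e4] at b ⊢
      · exact hD a (h1 a b)
      · exact h2 a b
      · exact h3 a b
      · exact hD _ (h4 a b)
      · exact fun h => hD _ (h5 a b h)
      · exact h6 a b
      · exact h7 a b
    · have hs : ∀ w, ((σ n).state w).checkSent d = true →
          ((σ (n + 1)).state w).checkSent d = true := fun w hw => by
        rw [e2]; split_ifs
        · rfl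
        · exact hw
      refine ⟨fun w hw => ?_, fun a b hab => ?_, fun a b hab => ?_, fun w hw => ?_,
        fun a b hab => ?_, fun w hw hadj => ?_, fun a b hab hc => ?_⟩
      · rw [e2] at hw
        split_ifs at hw with hwv
        · exact hwv ▸ hD v a0
        · exact hD w (h1 w hw)
      · rw [e1] at hab
        exact hs b (h2 a b hab)
      · rcases e4 a b _ hab with hab | ⟨rfl, _⟩
        · exact hs a (h3 a b hab)
        · rw [e2, if_pos rfl]
      · rw [e3] at hw
        exact hD _ (h4 w hw)
      · rcases e4 a b _ hab with hab | ⟨_, h⟩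
        · exact hD _ (h5 a b hab)
        · simp at h
      · by_cases hwv : w = v
        · subst hwv
          exact Or.inr (e6 hadj)
        · rw [e2, if_neg hwv] at hw
          rw [e1]
          exact (h6 w hw hadj).imp id (e5 _ _ _)
      · rw [e3] at hab ⊢
        exact (h7 a b hab hc).imp id (e5 _ _ _)
    · have hs : ∀ w, ((σ n).state w).confirmed d = true →
          ((σ (n + 1)).state w).confirmed d = true := fun w hw => by
        rw [e3]; split_ifs
        · rfl
        · exact hw
      have hroot : SubtreeDone G s t L (L.cluster d).root
          ((σ (n + 1)).state (L.cluster d).root) d := by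
        rcases a0 with ⟨a0, a1⟩ | ⟨u, hu⟩
        · exact a1 ▸ hD v a0
        · exact hD _ (h5 u v hu)
      refine ⟨fun w hw => ?_, fun a b hab => ?_, fun a b hab => ?_, fun w hw => hroot,
        fun a b hab => hroot, fun w hw hadj => ?_, fun a b hab hc => ?_⟩
      · rw [e2] at hw
        exact hD w (h1 w hw)
      · rw [e1] at hab
        rw [e2]
        exact h2 a b hab
      · rw [e2]
        rcases e4 a b _ hab with hab | ⟨_, h⟩
        · exact h3 a b hab
        · simp at h
      · rw [e2] at hw
        rw [e1]
        refine (h6 w hw hadj).imp id fun h => ?_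
        rcases e5 _ _ _ h with h | ⟨_, h⟩
        · exact h
        · simp at h
      · by_cases hav : a = v
        · subst hav
          exact Or.inr (e6 b hc)
        · rw [e3, if_neg hav] at hab
          rcases h7 a b hab hc with h | h
          · exact Or.inl (hs b h)
          · rcases e5 _ _ _ h with h | ⟨rfl, _⟩
            · exact Or.inr h
            · exact Or.inl (by rw [e3, if_pos rfl])
    · refine ⟨fun w hw => ?_, fun a b hab => ?_, fun a b hab => ?_, fun w hw => ?_,
        fun a b hab => ?_, fun w hw hadj => ?_, fun a b hab hc => ?_⟩
      · rw [e2] at hw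
        exact hD w (h1 w hw)
      · rw [e2]
        rw [e1] at hab
        split_ifs at hab with h
        · rw [h.2]; exact h3 _ _ a0
        · exact h2 a b hab
      · rw [e2]
        exact h3 a b (e4 _ _ _ hab)
      · rw [e3] at hw
        exact hD _ (h4 w hw)
      · exact hD _ (h5 a b (e4 _ _ _ hab))
      · rw [e2] at hw
        rw [e1]
        rcases h6 w hw hadj with h | h
        · left
          split_ifs
          · rfl
          · exact h
        · rcases e5 _ _ _ h with h | ⟨rfl, rfl, _⟩
          · exact Or.inr h
          · exact Or.inl (by simp)
      · rw [e3] at hab ⊢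
        refine (h7 a b hab hc).imp id fun h => ?_
        rcases e5 _ _ _ h with h | ⟨_, _, h⟩
        · exact h
        · simp at h

/-- If some node has received the confirmation, all nodes of the cluster tree are done. -/
theorem CheckInv.done {c : Conf V κ} {d : κ} (h : CheckInv G s t L d c) {v : V}
    (hv : (c.state v).confirmed d = true) :
    ∀ w ∈ (L.cluster d).nodes, SubtreeDone G s t L w (c.state w) d :=
  (L.cluster d).induction_down (h.confirmed v hv) fun u w hw hu =>
    h.sent w (h.child u w (hu.2.2.2 w hw))

end

section

open Filter
open AsyncAlgorithm NodeState
variable {V κ : Type*} {G : SimpleGraph V} {s : V} {t : ℕ} {L : LayeredCover G κ (t + 6)}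
  {σ : ℕ → Conf V κ}

/-! ### Outputs are correct -/

/-- When the source knows to be `2 ^ t`-safe, all nodes at distance at most `2 ^ t` have pulses. -/
theorem exec_pulse_of_source_safe (hσ : IsFairExecution G (algorithm G s t L) σ) {n : ℕ}
    (hs : ((σ n).state s).KnowsSafe G s (2 ^ t)) {v : V}
    (hv : G.edist v s ≤ ((2 ^ t : ℕ) : ℕ∞)) : ((σ n).state v).pulse ≠ none := by
  obtain ⟨i, hi⟩ := ENat.ne_top_iff_exists.1 (ne_top_of_le_ne_top (ENat.natCast_ne_top _) hv)
  have hi' : i ≤ 2 ^ t := by rw [← hi, Nat.cast_le] at hv; exact hv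
  -- The ball of infinite radius started at the source alone; `q = 0` is arbitrary since the source
  -- is safe.
  refine ((exec_correct hσ n).ball (exec_inv hσ n) (p := 2 ^ t) (q := 0) (k := 0) (v₀ := s) (R := ⊤)
    (fun b hb _ => ?_) i (by omega) v (by rw [← hi, Nat.zero_add]) le_top).1
  rw [eq_of_edist_eq_zero hb]
  obtain ⟨k, hk, _⟩ := id hs
  exact ⟨by simp [hk], Or.inl hs⟩

/-- The outputs of nodes with and without a pulse. -/
theorem exec_output (hσ : IsFairExecution G (algorithm G s t L) σ) (n : ℕ) (v : V) :
    (∀ k : ℕ, ((σ n).state v).pulse = some k → ((σ n).state v).output = some (k : ℕ∞)) ∧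
    (((σ n).state v).pulse = none → ((σ n).state v).output = none ∨
      ((σ n).state v).output = some ⊤ ∧ ((2 ^ t : ℕ) : ℕ∞) < G.edist v s) := by
  induction n with
  | zero =>
    rw [hσ.start]
    by_cases hs : v = s
    · simp [AsyncAlgorithm.initial, algorithm, initState, hs]
    · simp [AsyncAlgorithm.initial, algorithm, initState, hs]
  | succ n ih =>
    rcases (exec_trans hσ n).output v with ⟨h1, h2⟩ | ⟨-, k, h2, h3⟩ | ⟨h1, h2, h3, h4, h5⟩
    · rw [h1, h2]; exact ih
    · rw [h2, h3]; simp
    · rw [h2, h4]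
      simp only [reduceCtorEq, false_implies, implies_true, true_and, forall_const, false_or]
      by_contra hle
      rw [not_lt] at hle
      -- If `v` were within the threshold, it would share a cluster with the source. The
      -- confirmation there vouches for the safety of the source, so `v` would have a pulse.
      obtain ⟨d, hd, hv, hs⟩ := L.covers t (by omega) v s hle
      exact exec_pulse_of_source_safe hσ (((exec_checkInv hσ d n).done (h5 d hd hv) s
        ((L.cluster d).members_subset hs)).2.2.1 rfl) hle h1

theorem exec_edist_le (hσ : IsFairExecution G (algorithm G s t L) σ) {n : ℕ} {v : V} {k : ℕ}
    (h : ((σ n).state v).pulse = some k) :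
    (k : ℕ∞) = G.edist v s ∧ G.edist v s ≤ ((2 ^ t : ℕ) : ℕ∞) := by
  have h1 := exec_correct hσ n v k h
  refine ⟨h1, ?_⟩
  rw [← h1, Nat.cast_le]
  exact (exec_inv hσ n).pulse_le h

theorem exec_output_eq (hσ : IsFairExecution G (algorithm G s t L) σ) {n : ℕ} {v : V} {e : ℕ∞}
    (h : ((σ n).state v).output = some e) : e = thresholdedDist G s (2 ^ t) v := by
  obtain ⟨h1, h2⟩ := exec_output hσ n v
  rw [thresholdedDist]
  cases hp : ((σ n).state v).pulse with
  | some k =>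
    obtain ⟨h3, h4⟩ := exec_edist_le hσ hp
    rw [h1 k hp, Option.some.injEq] at h
    rw [if_pos h4, ← h3, h]
  | none =>
    rcases h2 hp with h3 | ⟨h3, h4⟩
    · simp [h3] at h
    · rw [h3, Option.some.injEq] at h
      rw [if_neg h4.not_ge, h]

end

section

open Filter
open AsyncAlgorithm NodeState
variable {V κ : Type*} {J : ℕ} {G : SimpleGraph V} {s : V} {t : ℕ} {L : LayeredCover G κ J}
  {c c' : Conf V κ} {σ : ℕ → Conf V κ}

/-! ### Progress: messages are delivered and actions are performed -/

theorem Trans.chan (h : Trans G s t L c c') (a b : V) (π : Proc κ) :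
    (∃ out, c'.chan a b π = c.chan a b π ++ out) ∨
      ∃ m rest, c.chan a b π = m :: rest ∧ m.proc = π ∧
        c' = emit G b (onReceive G L b a m (c.state b)) (popChan c a b π rest) := by
  have key : ∀ (c₁ : Conf V κ) (x : V) (r : NodeState V κ × (V → List (Msg κ))),
      ∃ out, (emit G x r c₁).chan a b π = c₁.chan a b π ++ out := by
    intro c₁ x r
    simp only [emit]
    split_ifs
    · exact ⟨_, rfl⟩
    · exact ⟨[], by simp⟩
  cases h with
  | stay => exact Or.inl ⟨[], by simp⟩
  | act v a r h => exact Or.inl (key _ _ _)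
  | recv u v m rest hm hadj =>
    by_cases hab : a = u ∧ b = v ∧ π = m.proc
    · obtain ⟨rfl, rfl, rfl⟩ := hab
      exact Or.inr ⟨m, rest, hm, rfl, rfl⟩
    · left
      obtain ⟨out, ho⟩ := key (popChan c u v m.proc rest) v (onReceive G L v u m (c.state v))
      exact ⟨out, by rw [ho]; simp [popChan, hab]⟩

theorem popChan_chan_self {u v : V} {π : Proc κ} {rest : List (Msg κ)}
    {r : NodeState V κ × (V → List (Msg κ))} (huv : u ≠ v) :
    (emit G v r (popChan c u v π rest)).chan u v π = rest := by
  simp [emit, popChan, huv]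

/-- Every message is delivered eventually. -/
theorem exec_delivered (hσ : IsFairExecution G (algorithm G s t L) σ) {u v : V} {π : Proc κ}
    {x : Msg κ} {n : ℕ} (hx : x ∈ (σ n).chan u v π) : ∃ m, n ≤ m ∧ ∃ rest,
      (σ m).chan u v π = x :: rest ∧ x.proc = π ∧ G.Adj u v ∧
      σ (m + 1) = emit G v (onReceive G L v u x ((σ m).state v)) (popChan (σ m) u v π rest) := by
  obtain ⟨hπ, hadj⟩ := exec_chanOK hσ n u v π x hx
  obtain ⟨l₁, l₂, hl⟩ := List.append_of_mem hx
  clear hx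
  induction hk : l₁.length generalizing n l₁ l₂ with
  | zero =>
    have hl₁ := List.length_eq_zero_iff.1 hk
    subst hl₁
    by_contra! hcon
    have hstay : ∀ m, n ≤ m → ∃ l, (σ m).chan u v π = x :: l := by
      intro m hm
      induction m, hm using Nat.le_induction with
      | base => exact ⟨l₂, hl⟩
      | succ m hm ih =>
        obtain ⟨l, hl⟩ := ih
        rcases (exec_trans hσ m).chan u v π with ⟨out, ho⟩ | ⟨y, rest, h1, h2, h3⟩
        · exact ⟨l ++ out, by rw [ho, hl]; rfl⟩
        · rw [hl] at h1
          obtain ⟨rfl, rfl⟩ := List.cons.inj h1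
          exact (hcon m hm l hl hπ hadj h3).elim
    obtain ⟨m, hm, hf⟩ := exec_recv_fair hσ u v π n
    obtain ⟨l, hl'⟩ := hstay m hm
    rcases hf with hf | ⟨y, rest, h1, -, -, h2⟩
    · simp [hl'] at hf
    · rw [hl'] at h1
      obtain ⟨rfl, rfl⟩ := List.cons.inj h1
      exact hcon m hm l hl' hπ hadj h2
  | succ k ih =>
    obtain ⟨y, l₁', rfl⟩ := List.exists_cons_of_length_eq_add_one hk
    suffices ∃ m, n ≤ m ∧ ∃ l, (σ m).chan u v π = l₁' ++ x :: l by
      obtain ⟨m, hm, l, hl⟩ := this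
      obtain ⟨m', hm', h⟩ := ih l₁' l hl (by simpa using hk)
      exact ⟨m', hm.trans hm', h⟩
    by_contra! hcon
    have hstay : ∀ m, n ≤ m → ∃ l, (σ m).chan u v π = y :: l₁' ++ x :: l := by
      intro m hm
      induction m, hm using Nat.le_induction with
      | base => exact ⟨l₂, hl⟩
      | succ m hm ih =>
        obtain ⟨l, hl⟩ := ih
        rcases (exec_trans hσ m).chan u v π with ⟨out, ho⟩ | ⟨z, rest, h1, h2, h3⟩
        · exact ⟨l ++ out, by rw [ho, hl]; simp⟩
        · rw [hl] at h1
          obtain ⟨rfl, rfl⟩ := List.cons.inj h1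
          refine (hcon (m + 1) (by omega) l ?_).elim
          rw [h3, popChan_chan_self hadj.ne]
          rfl
    obtain ⟨m, hm, hf⟩ := exec_recv_fair hσ u v π n
    obtain ⟨l, hl'⟩ := hstay m hm
    rcases hf with hf | ⟨z, rest, h1, -, -, h2⟩
    · simp [hl'] at hf
    · rw [hl'] at h1
      obtain ⟨rfl, rfl⟩ := List.cons.inj h1
      refine hcon (m + 1) (by omega) l ?_
      rw [h2, popChan_chan_self hadj.ne]
      rfl

theorem eventually_of_stable {P : ℕ → Prop} (h : ∀ n, P n → P (n + 1)) (h' : ∃ n, P n) :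
    ∀ᶠ n in atTop, P n := by
  obtain ⟨n, hn⟩ := h'
  exact eventually_atTop.2 ⟨n, fun m hm => exec_stable h hm hn⟩

/-- If an action is enabled as long as `P` does not hold, and leads to `P`, then `P` holds
eventually. -/
theorem eventually_act (hσ : IsFairExecution G (algorithm G s t L) σ) {P : ℕ → Prop}
    (hP : ∀ n, P n → P (n + 1)) (v : V) (a : Act κ)
    (hen : ∀ᶠ n in atTop, P n ∨ onAct G s t L v a ((σ n).state v) ≠ none)
    (hdo : ∀ n r, onAct G s t L v a ((σ n).state v) = some r → σ (n + 1) = emit G v r (σ n) →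
      P (n + 1)) : ∀ᶠ n in atTop, P n := by
  obtain ⟨N, hN⟩ := eventually_atTop.1 hen
  refine eventually_of_stable hP ?_
  obtain ⟨m, hm, h | ⟨r, h1, h2⟩⟩ := exec_act_fair hσ v a N
  · exact ⟨m, (hN m hm).resolve_right fun h' => h' h⟩
  · exact ⟨m + 1, hdo m r h1 h2⟩

/-! ### More stable properties -/

variable {n m : ℕ}

theorem exec_sent_mono (hσ : IsFairExecution G (algorithm G s t L) σ) {v : V}
    (h : ((σ n).state v).sent = true) : ((σ (n + 1)).state v).sent = true :=
  (exec_searchMono hσ n).sent v h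

theorem exec_reported_mono (hσ : IsFairExecution G (algorithm G s t L) σ) {v : V} {p : ℕ}
    (h : ((σ n).state v).reported p = true) : ((σ (n + 1)).state v).reported p = true := by
  have key : ∀ y, ReportStep G t L p (σ n) y → y.reported v = true := by
    intro y hy
    cases hy with
    | send w => by_cases hw : v = w <;> simp [hw, reportView] <;> exact h
    | _ => exact h
  exact key _ ((exec_trans hσ n).report p)

theorem exec_answer_mono (hσ : IsFairExecution G (algorithm G s t L) σ) {v w : V}
    (h : ((σ n).state v).answer w ≠ none) : ((σ (n + 1)).state v).answer w ≠ none := by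
  obtain ⟨e, he⟩ := Option.ne_none_iff_exists'.1 h
  exact Option.ne_none_iff_exists'.2 ⟨e, (exec_searchMono hσ n).answer v w e he⟩

theorem exec_report_mono (hσ : IsFairExecution G (algorithm G s t L) σ) {v w : V} {p : ℕ}
    (h : ((σ n).state v).report w p ≠ none) : ((σ (n + 1)).state v).report w p ≠ none := by
  obtain ⟨e, he⟩ := Option.ne_none_iff_exists'.1 h
  exact Option.ne_none_iff_exists'.2
    ⟨e, ((exec_inv hσ n).report p).mono (exec_trans hσ n) he⟩

theorem exec_check_mono (hσ : IsFairExecution G (algorithm G s t L) σ) (d : κ) (n : ℕ) :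
    (∀ v w, ((σ n).state v).checkedChild d w = true →
      ((σ (n + 1)).state v).checkedChild d w = true) ∧
    (∀ v, ((σ n).state v).checkSent d = true → ((σ (n + 1)).state v).checkSent d = true) ∧
    ∀ v, ((σ n).state v).confirmed d = true → ((σ (n + 1)).state v).confirmed d = true := by
  rcases (exec_trans hσ n).check d with ⟨e1, e2, e3, _⟩ | ⟨_, _, e1, e2, e3, _⟩ |
    ⟨_, _, e1, e2, e3, _⟩ | ⟨_, _, _, e1, e2, e3, _⟩ <;>
  · refine ⟨fun v w h => ?_, fun v h => ?_, fun v h => ?_⟩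
    · rw [e1]; simp [h]
    · rw [e2]; simp [h]
    · rw [e3]; simp [h]

theorem exec_output_mono (hσ : IsFairExecution G (algorithm G s t L) σ) {v : V}
    (h : ((σ n).state v).output ≠ none) : ((σ (n + 1)).state v).output ≠ none := by
  rcases (exec_trans hσ n).output v with ⟨h1, _⟩ | ⟨-, k, -, h3⟩ | ⟨-, -, -, h4, -⟩
  · rwa [h1]
  · simp [h3]
  · simp [h4]

/-- A node that knows to be `p`-safe also knows whether it is `p`-empty. -/
theorem exec_knowsEmpty_of_later (hσ : IsFairExecution G (algorithm G s t L) σ) (hnm : n ≤ m)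
    {u : V} {p : ℕ} (hs : ((σ n).state u).KnowsSafe G u p) (h : ((σ m).state u).KnowsEmpty G u p) :
    ((σ n).state u).KnowsEmpty G u p := by
  obtain ⟨-, h2, h3⟩ := h
  have hne : ((σ n).state u).pulse ≠ some p := fun h => h2 (exec_pulse hσ hnm h)
  refine ⟨hs, hne, fun w hw => ?_⟩
  obtain ⟨k, hk, rfl | ⟨h4, h5, h6, h7⟩⟩ := hs
  · exact (hne hk).elim
  · obtain ⟨e, he⟩ := Option.ne_none_iff_exists'.1 (h7 w hw)
    have h8 := exec_stable (P := fun n => ((σ n).state u).report w p = some e)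
      (fun n hn => ((exec_inv hσ n).report p).mono (exec_trans hσ n) hn) hnm he
    have h9 : ((σ m).state u).IsExecChild w :=
      exec_stable (P := fun n => ((σ n).state u).answer w = some true)
        (fun n hn => (exec_searchMono hσ n).answer u w true hn) hnm hw
    rw [h3 w h9, Option.some.injEq] at h8
    rw [he, ← h8]

/-- A node that has registered for `p` knows that it is `prev p`-safe, and it is not
`prev p`-empty. -/
theorem exec_reg_not_empty (hσ : IsFairExecution G (algorithm G s t L) σ) (n : ℕ) (u : V) (p : ℕ)
    (d : κ) (h : (((σ n).state u).reg p d).status ≠ .idle) :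
    ((σ n).state u).KnowsSafe G u (prev p) ∧ ¬ ((σ n).state u).KnowsEmpty G u (prev p) := by
  induction n with
  | zero =>
    rw [hσ.start] at h
    simp [AsyncAlgorithm.initial, algorithm, initState, RegState.start] at h
  | succ n ih =>
    have hn := Nat.le_succ n
    have key : ((σ n).state u).KnowsSafe G u (prev p) ∧
        ¬ ((σ n).state u).KnowsEmpty G u (prev p) →
        ((σ (n + 1)).state u).KnowsSafe G u (prev p) ∧
        ¬ ((σ (n + 1)).state u).KnowsEmpty G u (prev p) := fun ⟨h1, h2⟩ =>
      ⟨exec_knowsSafe hσ hn h1, fun h3 => h2 (exec_knowsEmpty_of_later hσ hn h1 h3)⟩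
    rcases (exec_trans hσ n).regState u p d with h1 | ⟨w, y, h1⟩ | ⟨⟨_, _, _, _, _, h5, h6⟩, _⟩ |
      ⟨⟨h1, _⟩, _⟩
    · rw [h1] at h; exact key (ih h)
    · refine key (ih fun hi => h ?_)
      rw [h1]
      exact (RegState.receive_status _ _ _ _ _).1 hi
    · exact key ⟨h5, h6⟩
    · exact key (ih (by simp [h1]))

end

section

open Filter
open AsyncAlgorithm NodeState
variable {V κ : Type*} {J : ℕ} {G : SimpleGraph V} {s : V} {t : ℕ} {L : LayeredCover G κ J}
  {σ : ℕ → Conf V κ}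

/-! ### Progress of the search and of the reports -/

theorem eventually_pulse (hσ : IsFairExecution G (algorithm G s t L) σ) {n : ℕ} {v : V} {k : ℕ}
    (h : ((σ n).state v).pulse = some k) : ∀ᶠ n in atTop, ((σ n).state v).pulse = some k :=
  eventually_atTop.2 ⟨n, fun _ hm => exec_pulse hσ hm h⟩

/-- Every proposal is answered eventually. -/
theorem eventually_answer (hσ : IsFairExecution G (algorithm G s t L) σ) {n : ℕ} {v w : V}
    (hs : ((σ n).state v).sent = true) (hadj : G.Adj v w) :
    ∀ᶠ n in atTop, ((σ n).state v).answer w ≠ none := by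
  refine eventually_of_stable (fun n => exec_answer_mono hσ) ?_
  have hchan : ∀ {n b}, .answer b ∈ (σ n).chan w v .search →
      ∃ m, ((σ m).state v).answer w ≠ none := by
    intro n b hb
    obtain ⟨m, _, rest, _, _, _, h⟩ := exec_delivered hσ hb
    exact ⟨m + 1, by rw [h]; simp [emit, onReceive]⟩
  have hcount := (exec_search hσ n).count v w
  by_cases h0 : ((σ n).state v).answer w = none
  swap
  · exact ⟨n, h0⟩
  -- No answer is recorded, so the token of this proposal is in transit, as a `join` or as an
  -- `answer`.
  simp only [searchView, hs, hadj, h0, and_self, if_true, add_zero] at hcount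
  by_cases hj : ((σ n).chan v w .search).countP Msg.isJoin = 0
  · have h1 : 0 < ((σ n).chan w v .search).countP Msg.isAnswer := by omega
    obtain ⟨m, hm, h2⟩ := List.countP_pos_iff.1 h1
    cases m with
    | answer b => exact hchan hm
    | _ => simp [Msg.isAnswer] at h2
  · obtain ⟨m, hm, h2⟩ := List.countP_pos_iff.1 (Nat.pos_of_ne_zero hj)
    cases m with
    | join k =>
      obtain ⟨m, _, rest, _, _, _, h⟩ := exec_delivered hσ hm
      have : ∃ b, .answer b ∈ (σ (m + 1)).chan w v .search := by
        rw [h]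
        by_cases hp : ((σ m).state w).pulse = none
        · exact ⟨true, by simp [emit, onReceive, hp, hadj.symm, Msg.proc]⟩
        · exact ⟨false, by simp [emit, onReceive, hp, hadj.symm, Msg.proc]⟩
      obtain ⟨b, hb⟩ := this
      exact hchan hb
    | _ => simp [Msg.isJoin] at h2

/-- Every report is delivered eventually. -/
theorem eventually_report (hσ : IsFairExecution G (algorithm G s t L) σ) {n : ℕ} {u w : V} {p : ℕ}
    (hr : ((σ n).state w).reported p = true) (hp : ((σ n).state w).parent = some u) :
    ∀ᶠ n in atTop, ((σ n).state u).report w p ≠ none := by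
  refine eventually_of_stable (fun n => exec_report_mono hσ) ?_
  by_cases h0 : ((σ n).state u).report w p = none
  swap
  · exact ⟨n, h0⟩
  have hcount := ((exec_inv hσ n).report p).count u w
  simp only [hr, hp, and_self, if_true, h0, add_zero] at hcount
  obtain ⟨m, hm⟩ := List.exists_mem_of_length_pos (l := (σ n).chan w u (.safety p)) (by omega)
  obtain ⟨k, _, rest, _, h1, _, h⟩ := exec_delivered hσ hm
  cases m with
  | report p' e =>
    obtain rfl : p' = p := by simpa [Msg.proc] using h1
    exact ⟨k + 1, by rw [h]; simp [emit, onReceive]⟩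
  | _ => simp [Msg.proc] at h1

theorem eventually_answered [Finite V] (hσ : IsFairExecution G (algorithm G s t L) σ) {v : V}
    {k : ℕ} (hk : k < 2 ^ t) (hv : ∀ᶠ n in atTop, ((σ n).state v).pulse = some k)
    (hgo : 0 < k → ∀ᶠ n in atTop, ((σ n).state v).go k = true) :
    ∀ᶠ n in atTop, Answered G (σ n) v := by
  have hgo' : ∀ᶠ n in atTop, k = 0 ∨ ((σ n).state v).go k = true := by
    rcases Nat.eq_zero_or_pos k with h | h
    · exact Eventually.of_forall fun _ => Or.inl h
    · exact (hgo h).mono fun _ => Or.inr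
  have hsent : ∀ᶠ n in atTop, ((σ n).state v).sent = true := by
    refine eventually_act hσ (fun n => exec_sent_mono hσ) v .propose ?_ ?_
    · filter_upwards [hv, hgo'] with n h1 h2
      rw [or_iff_not_imp_left]
      intro h3
      have h4 : ((σ n).state v).sent = false := by simpa using h3
      simp [onAct, h1, h2, h4, hk]
    · intro n r h1 h2
      rw [h2]
      simp only [onAct] at h1
      split at h1
      · simp at h1
      · rw [Option.ite_none_right_eq_some, Option.some.injEq] at h1
        obtain ⟨_, rfl⟩ := h1
        simp [emit]
  obtain ⟨n, hn⟩ := hsent.exists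
  have hall : ∀ᶠ n in atTop, ∀ w, G.Adj v w → ((σ n).state v).answer w ≠ none := by
    rw [eventually_all]
    intro w
    by_cases hw : G.Adj v w
    · exact (eventually_answer hσ hn hw).mono fun _ h _ => h
    · exact Eventually.of_forall fun _ h => (hw h).elim
  filter_upwards [hsent, hall] with n h1 h2 using ⟨h1, h2⟩

/-- Once all children report for `p`, the node knows that it is `p`-safe. -/
theorem eventually_knowsSafe [Finite V] (hσ : IsFairExecution G (algorithm G s t L) σ) {v : V}
    {k p : ℕ} (hk : k < p) (hv : ∀ᶠ n in atTop, ((σ n).state v).pulse = some k)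
    (ha : ∀ᶠ n in atTop, Answered G (σ n) v)
    (hc : ∀ w n, ((σ n).state w).parent = some v →
      ∀ᶠ n in atTop, ((σ n).state w).reported p = true) :
    ∀ᶠ n in atTop, ((σ n).state v).KnowsSafe G v p := by
  have hall : ∀ᶠ n in atTop, ∀ w, ((σ n).state v).IsExecChild w →
      ((σ n).state v).report w p ≠ none := by
    rw [eventually_all]
    intro w
    by_cases hw : ∃ n, ((σ n).state v).IsExecChild w
    · obtain ⟨n, hn⟩ := hw
      have hp := (exec_inv hσ n).parent_of_execChild hn
      obtain ⟨m, hm, hnm⟩ := ((hc w n hp).and (eventually_ge_atTop n)).exists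
      exact (eventually_report hσ hm (exec_parent hσ hnm hp)).mono fun _ h _ => h
    · exact Eventually.of_forall fun n h => (hw ⟨n, h⟩).elim
  filter_upwards [hv, ha, hall] with n h1 h2 h3 using ⟨k, h1, Or.inr ⟨hk, h2.1, h2.2, h3⟩⟩

/-! ### Progress of the registrations -/

theorem RegState.register_status (T : Cluster G) (u : V) (x : RegState V) :
    (x.register T u).1.status ≠ .idle := by
  simp only [RegState.register, RegState.runRegister, RegState.complete]
  split_ifs <;> simp

theorem RegState.deregister_status (T : Cluster G) (u : V) (x : RegState V) :
    3 ≤ (x.deregister T u).1.status.rank := by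
  simp only [RegState.deregister, RegState.runDeregister, RegState.runGo]
  split_ifs <;> simp [RegStatus.rank]

theorem RegStatus.rank_pos {x : RegStatus} : 1 ≤ x.rank ↔ x ≠ .idle := by
  cases x <;> simp [RegStatus.rank]

theorem RegStatus.two_le_rank {x : RegStatus} : 2 ≤ x.rank ↔ x ≠ .idle ∧ x ≠ .registering := by
  cases x <;> simp [RegStatus.rank]

theorem RegStatus.three_le_rank {x : RegStatus} :
    3 ≤ x.rank ↔ x ≠ .idle ∧ x ≠ .registering ∧ x ≠ .registered := by
  cases x <;> simp [RegStatus.rank]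

theorem emit_withReg (v : V) (x : NodeState V κ) (c : Conf V κ) (p : ℕ) (d : κ)
    (r : RegState V × (V → List RegSignal)) :
    ((emit G v (x.withReg p d r) c).state v).reg p d = r.1 := by
  simp [emit, NodeState.withReg]

theorem exec_rank_le (hσ : IsFairExecution G (algorithm G s t L) σ) {u : V} {p r : ℕ} {d : κ}
    (n : ℕ) (h : r ≤ (((σ n).state u).reg p d).status.rank) :
    r ≤ (((σ (n + 1)).state u).reg p d).status.rank :=
  h.trans (exec_rank hσ (Nat.le_succ n) u p d)

/-- A node of pulse `prev (prev p)` that is `prev p`-safe and not `prev p`-empty becomes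
`p`-registered. -/
theorem eventually_isRegistered [Finite V] [Finite κ] (hσ : IsFairExecution G (algorithm G s t L) σ)
    {u : V} {p : ℕ} (hp : 0 < p) (hpt : p ≤ 2 ^ t)
    (hu : ∀ᶠ n in atTop, ((σ n).state u).pulse = some (prev (prev p)))
    (hs : ∀ᶠ n in atTop, ((σ n).state u).KnowsSafe G u (prev p))
    (he : ∀ᶠ n in atTop, ¬ ((σ n).state u).KnowsEmpty G u (prev p)) :
    ∀ᶠ n in atTop, ((σ n).state u).IsRegistered L u p := by
  simp only [IsRegistered]
  rw [eventually_all]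
  intro d
  by_cases hd : RegCluster L u p d
  swap
  · exact Eventually.of_forall fun n h => (hd h).elim
  have h1 : ∀ᶠ n in atTop, 1 ≤ (((σ n).state u).reg p d).status.rank := by
    refine eventually_act hσ (exec_rank_le hσ) u (.register p d) ?_ ?_
    · filter_upwards [hu, hs, he] with n h1 h2 h3
      rw [or_iff_not_imp_left, RegStatus.rank_pos, not_not]
      intro h4
      simp only [onAct]
      rw [if_pos ⟨hp, hpt, h1, hd, h4, h2, h3⟩]
      simp
    · intro n r h1 h2
      simp only [onAct] at h1
      rw [Option.ite_none_right_eq_some, Option.some.injEq] at h1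
      obtain ⟨_, rfl⟩ := h1
      rw [h2, emit_withReg, RegStatus.rank_pos]
      exact RegState.register_status _ _ _
  have h2 : ∀ᶠ n in atTop, 2 ≤ (((σ n).state u).reg p d).status.rank := by
    refine eventually_of_stable (exec_rank_le hσ) ?_
    obtain ⟨n, hn⟩ := h1.exists
    by_cases hr : (((σ n).state u).reg p d).status = .registering
    · obtain ⟨m, hm, h3⟩ := (exec_reg hσ p d).eventually_registered u n hr
      refine ⟨m, RegStatus.two_le_rank.2 ⟨?_, h3⟩⟩
      exact RegStatus.rank_pos.1 (hn.trans (exec_rank hσ hm u p d))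
    · exact ⟨n, RegStatus.two_le_rank.2 ⟨RegStatus.rank_pos.1 hn, hr⟩⟩
  exact h2.mono fun n hn _ => RegStatus.two_le_rank.1 hn

theorem eventually_deregistered [Finite V] [Finite κ]
    (hσ : IsFairExecution G (algorithm G s t L) σ) {u : V} {p : ℕ} (hp : 0 < p) (hpt : p ≤ 2 ^ t)
    (hu : ∀ᶠ n in atTop, ((σ n).state u).pulse = some (prev (prev p)))
    (hs : ∀ᶠ n in atTop, ((σ n).state u).KnowsSafe G u (prev p))
    (he : ∀ᶠ n in atTop, ¬ ((σ n).state u).KnowsEmpty G u (prev p))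
    (hsp : ∀ᶠ n in atTop, ((σ n).state u).KnowsSafe G u p) {d : κ} (hd : RegCluster L u p d) :
    ∀ᶠ n in atTop, 3 ≤ (((σ n).state u).reg p d).status.rank := by
  have hr := eventually_isRegistered hσ hp hpt hu hs he
  refine eventually_act hσ (exec_rank_le hσ) u (.deregister p d) ?_ ?_
  · filter_upwards [hu, hr, hsp] with n h1 h2 h3
    rw [or_iff_not_imp_left, RegStatus.three_le_rank]
    intro h4
    have h5 : (((σ n).state u).reg p d).status = .registered := by
      by_contra h5
      exact h4 ⟨(h2 d hd).1, (h2 d hd).2, h5⟩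
    simp only [onAct]
    rw [if_pos ⟨hp, hpt, h1, hd, h5, h2, h3⟩]
    simp
  · intro n r h1 h2
    simp only [onAct] at h1
    rw [Option.ite_none_right_eq_some, Option.some.injEq] at h1
    obtain ⟨_, rfl⟩ := h1
    rw [h2, emit_withReg]
    exact RegState.deregister_status _ _ _

/-- If all nodes of pulse `prev (prev p)` become `p`-safe, then those that are not `prev p`-empty
get all their Go-Aheads. -/
theorem eventually_released [Finite V] [Finite κ] (hσ : IsFairExecution G (algorithm G s t L) σ)
    {a : V} {p : ℕ} (hp : 0 < p) (hpt : p ≤ 2 ^ t)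
    (hsafe : ∀ u n, ((σ n).state u).pulse = some (prev (prev p)) →
      ∀ᶠ n in atTop, ((σ n).state u).KnowsSafe G u (prev p) ∧ ((σ n).state u).KnowsSafe G u p)
    (ha : ∀ᶠ n in atTop, ((σ n).state a).pulse = some (prev (prev p)))
    (he : ∀ᶠ n in atTop, ¬ ((σ n).state a).KnowsEmpty G a (prev p)) :
    ∀ᶠ n in atTop, Released t L (σ n) a p := by
  -- Whoever registers for `p` has pulse `prev (prev p)` and is not `prev p`-empty, so by `hsafe` it
  -- becomes `p`-safe and deregisters. Hence registrations cease in every cluster, as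
  -- `eventually_free` requires.
  have hquiet : ∀ d, ∀ᶠ n in atTop, ∀ u, ((regView p d (σ n)).st u).status ≠ .registering ∧
      ((regView p d (σ n)).st u).status ≠ .registered := by
    intro d
    rw [eventually_all]
    intro u
    by_cases hi : ∃ n, (((σ n).state u).reg p d).status ≠ .idle
    · obtain ⟨n, hn⟩ := hi
      obtain ⟨-, -, hpu, hd⟩ := exec_reg_guard hσ n u p d hn
      have hs := hsafe u n hpu
      have hne : ∀ᶠ n in atTop, ¬ ((σ n).state u).KnowsEmpty G u (prev p) := by
        refine eventually_atTop.2 ⟨n, fun m hm => ?_⟩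
        refine (exec_reg_not_empty hσ m u p d ?_).2
        rw [← RegStatus.rank_pos] at hn ⊢
        exact hn.trans (exec_rank hσ hm u p d)
      refine (eventually_deregistered hσ hp hpt (eventually_pulse hσ hpu) (hs.mono fun _ h => h.1)
        hne (hs.mono fun _ h => h.2) hd).mono fun n hn => ?_
      exact (RegStatus.three_le_rank.1 hn).2
    · simp only [ne_eq, not_exists, not_not] at hi
      exact Eventually.of_forall fun n => by simp [regView, hi n]
  obtain ⟨n, hn⟩ := ha.exists
  have hs := hsafe a n hn
  have hall : ∀ᶠ n in atTop, ∀ d, RegCluster L a p d →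
      (((σ n).state a).reg p d).status = .free := by
    rw [eventually_all]
    intro d
    by_cases hd : RegCluster L a p d
    swap
    · exact Eventually.of_forall fun n h => (hd h).elim
    filter_upwards [(exec_reg hσ p d).eventually_free (hquiet d) a, eventually_deregistered hσ hp
      hpt ha (hs.mono fun _ h => h.1) he (hs.mono fun _ h => h.2) hd] with n h1 h2 _
    have h1' : (((σ n).state a).reg p d).status ≠ .deregistered := h1
    rw [RegStatus.three_le_rank] at h2
    cases h3 : (((σ n).state a).reg p d).status <;> simp_all
  filter_upwards [ha, hall] with n h1 h2 using ⟨hp, hpt, h1, h2⟩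

/-- A node that has received the confirmations of its registrations reports. -/
theorem eventually_reported [Finite V] [Finite κ] (hσ : IsFairExecution G (algorithm G s t L) σ)
    {v : V} {k p : ℕ} (hpt : p ≤ 2 ^ t) (hk : prev (prev p) < k) (hkp : k ≤ p)
    (hv : ∀ᶠ n in atTop, ((σ n).state v).pulse = some k)
    (hs : ∀ᶠ n in atTop, ((σ n).state v).KnowsSafe G v p) :
    ∀ᶠ n in atTop, ((σ n).state v).reported p = true := by
  -- A node that never knows itself to be `p`-empty completes its registrations for all `q` with
  -- `prev q = p`: they require only `p`-safety, which is at hand. Finitely many `q` are concerned,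
  -- so all are done from some time on.
  have hcond : ∀ᶠ n in atTop, ((σ n).state v).KnowsEmpty G v p ∨
      ∀ q ≤ 2 ^ t, 0 < q → prev q = p → ((σ n).state v).pulse = some (prev (prev q)) →
        ((σ n).state v).IsRegistered L v q := by
    by_cases he : ∃ n, ((σ n).state v).KnowsEmpty G v p
    · obtain ⟨n, hn⟩ := he
      exact eventually_atTop.2 ⟨n, fun m hm => Or.inl (exec_knowsEmpty hσ hm hn)⟩
    · rw [not_exists] at he
      suffices ∀ᶠ n in atTop, ∀ q ∈ Set.Iic (2 ^ t), 0 < q → prev q = p →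
          ((σ n).state v).pulse = some (prev (prev q)) → ((σ n).state v).IsRegistered L v q from
        this.mono fun n hn => Or.inr hn
      rw [eventually_all_finite (Set.finite_Iic _)]
      intro q hqt
      by_cases hq : 0 < q ∧ prev q = p ∧ k = prev (prev q)
      · obtain ⟨hq0, rfl, hqk⟩ := hq
        exact (eventually_isRegistered hσ hq0 hqt (hqk ▸ hv) hs
          (Eventually.of_forall he)).mono fun n hn _ _ _ => hn
      · filter_upwards [hv] with n h1 h2 h3 h4
        rw [h1, Option.some.injEq] at h4
        exact (hq ⟨h2, h3, h4⟩).elim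
  refine eventually_act hσ (fun n => exec_reported_mono hσ) v (.report p) ?_ ?_
  · filter_upwards [hv, hs, hcond] with n h1 h2 h3
    rw [or_iff_not_imp_left]
    intro h4
    have h4' : ((σ n).state v).reported p = false := by simpa using h4
    simp only [onAct]
    rw [if_pos ⟨h4', hpt, ⟨k, h1, hk, hkp⟩, h2, h3.imp id fun h q h5 h6 => h q h6 h5⟩]
    simp
  · intro n r h1 h2
    simp only [onAct] at h1
    rw [Option.ite_none_right_eq_some, Option.some.injEq] at h1
    obtain ⟨_, rfl⟩ := h1
    rw [h2]
    simp [emit]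

end

section

open Filter
open AsyncAlgorithm NodeState
variable {V κ : Type*} {G : SimpleGraph V} {s : V} {t : ℕ} {L : LayeredCover G κ (t + 6)}
  {σ : ℕ → Conf V κ}

/-! ### Progress of the pulses -/

theorem Inv.exists_execAnc {J : ℕ} {L : LayeredCover G κ J} {c : Conf V κ} (h : Inv G s t L c)
    {p l : ℕ} (hl : l ≤ p) {v : V} (hv : (c.state v).pulse = some p) :
    ∃ a, (c.state a).pulse = some l ∧ ExecAnc c a v := by
  induction p generalizing v with
  | zero => exact ⟨v, by rw [hv, Nat.le_zero.1 hl], .refl⟩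
  | succ p ih =>
    rcases hl.eq_or_lt with rfl | hlt
    · exact ⟨v, hv, .refl⟩
    · have hs : v ≠ s := by
        rintro rfl
        have : (c.state v).pulse = some 0 := h.search.source.1
        simp [this] at hv
      obtain ⟨u, hu⟩ := h.exists_parent (by simp [hv]) hs
      obtain ⟨k, h1, h2, _⟩ := h.parent_spec hu
      rw [hv, Option.some.injEq] at h2
      obtain rfl : k = p := by omega
      obtain ⟨a, h3, h4⟩ := ih (by omega) h1
      exact ⟨a, h3, h4.tail hu⟩

/-- A node that may release a pulse issues the Go-Ahead. -/
theorem eventually_go_of_released (hσ : IsFairExecution G (algorithm G s t L) σ) {a : V} {p : ℕ}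
    (h : ∀ᶠ n in atTop, Released t L (σ n) a p) :
    ∀ᶠ n in atTop, ((σ n).state a).go p = true := by
  refine eventually_act hσ (fun n => exec_go_mono hσ (Nat.le_succ n)) a (.release p) ?_ ?_
  · filter_upwards [h] with n ⟨h1, h2, h3, h4⟩
    rw [or_iff_not_imp_left]
    intro h5
    have h5' : ((σ n).state a).go p = false := by simpa using h5
    simp only [onAct]
    rw [if_pos ⟨h1, h2, h3, h5', h4⟩]
    simp
  · intro n r h1 h2
    simp only [onAct] at h1
    rw [Option.ite_none_right_eq_some, Option.some.injEq] at h1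
    obtain ⟨_, rfl⟩ := h1
    rw [h2]
    simp [emit, takeGoAhead]

/-- Go-Aheads move down the execution tree. -/
theorem eventually_go_of_execAnc (hσ : IsFairExecution G (algorithm G s t L) σ) {a v : V} {n p : ℕ}
    (hav : ExecAnc (σ n) a v) (hv : ((σ n).state v).pulse = some p)
    (ha : ∀ᶠ n in atTop, ((σ n).state a).go p = true) :
    ∀ᶠ n in atTop, ((σ n).state v).go p = true := by
  suffices ∀ k ≤ p, ((σ n).state v).pulse = some k →
      ∀ᶠ n in atTop, ((σ n).state v).go p = true from this p le_rfl hv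
  clear hv
  induction hav with
  | refl => exact fun _ _ _ => ha
  | @tail u w _ hp ih =>
    intro k hk hw
    obtain ⟨i, h1, h2, _⟩ := (exec_inv hσ n).parent_spec hp
    rw [hw, Option.some.injEq] at h2
    obtain ⟨m, hm, hnm⟩ := ((ih i (by omega) h1).and (eventually_ge_atTop n)).exists
    refine eventually_of_stable (fun n => exec_go_mono hσ (Nat.le_succ n)) ?_
    rcases (exec_goInv hσ m p).pass u w i hm (exec_pulse hσ hnm h1) (by omega)
      (exec_parent hσ hnm hp) with h | h
    · exact ⟨m, h⟩
    · obtain ⟨l, _, rest, _, _, _, h3⟩ := exec_delivered hσ h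
      exact ⟨l + 1, by rw [h3]; simp [emit, onReceive, takeGoAhead]⟩

/-- What happens eventually at the nodes at distance `p` from the source. -/
structure Progress (G : SimpleGraph V) (s : V) (t : ℕ) (σ : ℕ → Conf V κ) (p : ℕ) : Prop where
  pulse : ∀ v, G.edist v s = (p : ℕ∞) → ∀ᶠ n in atTop, ((σ n).state v).pulse = some p
  safe : ∀ v i, prev (prev p) ≤ i → i ≤ p → G.edist v s = (i : ℕ∞) →
    ∀ᶠ n in atTop, ((σ n).state v).KnowsSafe G v p
  answered : p < 2 ^ t → ∀ v, G.edist v s = (p : ℕ∞) → ∀ᶠ n in atTop, Answered G (σ n) v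

/-- In the induction the three claims follow in this order: pulses at distance `p` from `answered`
at `p - 1`, safety for `p` from `answered` at all smaller distances, and `answered` at `p` from the
Go-Ahead, which needs safety for `prev p` and for `p` only. -/
theorem exec_progress [Finite V] [Finite κ] (hσ : IsFairExecution G (algorithm G s t L) σ) (p : ℕ)
    (hpt : p ≤ 2 ^ t) : Progress G s t σ p := by
  induction p using Nat.strong_induction_on with
  | _ p ih =>
    have hpulse : ∀ v, G.edist v s = (p : ℕ∞) →
        ∀ᶠ n in atTop, ((σ n).state v).pulse = some p := by
      intro v hv
      cases p with
      | zero =>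
        rw [eq_of_edist_eq_zero hv]
        exact Eventually.of_forall fun n => (exec_search hσ n).source.1
      | succ p =>
        obtain ⟨y, hadj, hy⟩ := exists_adj_edist hv
        filter_upwards [(ih p (by omega) (by omega)).answered (by omega) y hy] with n hn
        exact (exec_correct hσ n).pulse_eq
          ((exec_inv hσ n).pulse_of_answered hn hadj.symm) hv
    -- Inner induction up the execution tree, from pulse `p`, where safety is immediate, to `prev
    -- (prev p)`, where the collection of reports stops.
    have hsafe : ∀ j i v, i + j = p → prev (prev p) ≤ i → G.edist v s = (i : ℕ∞) →
        ∀ᶠ n in atTop, ((σ n).state v).KnowsSafe G v p := by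
      intro j
      induction j with
      | zero =>
        rintro i v rfl _ hv
        exact (hpulse v hv).mono fun n hn => ⟨i, hn, Or.inl rfl⟩
      | succ j ihj =>
        intro i v hij hi hv
        have hPi := ih i (by omega) (by omega)
        refine eventually_knowsSafe hσ (by omega) (hPi.pulse v hv) (hPi.answered (by omega) v hv) ?_
        intro w n hw
        obtain ⟨k, h1, h2, _⟩ := (exec_inv hσ n).parent_spec hw
        have h3 := exec_correct hσ n v k h1
        rw [hv] at h3
        obtain rfl : k = i := Nat.cast_injective (R := ℕ∞) h3
        exact eventually_reported hσ hpt (by omega) (by omega) (eventually_pulse hσ h2)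
          (ihj (k + 1) w (by omega) (by omega) (exec_correct hσ n w _ h2).symm)
    refine ⟨hpulse, fun v i h1 h2 h3 => hsafe (p - i) i v (by omega) h1 h3, fun hlt v hv => ?_⟩
    refine eventually_answered hσ hlt (hpulse v hv) fun hp => ?_
    obtain ⟨N, hN⟩ := (hpulse v hv).exists
    have hI := exec_inv hσ N
    obtain ⟨x, hx, hxv⟩ := hI.exists_execAnc (prev_le p) hN
    obtain ⟨a, ha, hax⟩ := hI.exists_execAnc (prev_le (prev p)) hx
    refine eventually_go_of_execAnc hσ (hax.trans hxv) hN (eventually_go_of_released hσ ?_)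
    refine eventually_released hσ hp hpt (fun u n hu => ?_) (eventually_pulse hσ ha) ?_
    · have hd := (exec_correct hσ n u _ hu).symm
      have hlt1 := prev_lt hp
      have hle := prev_le (prev p)
      exact ((ih (prev p) hlt1 (by omega)).safe u _ (prev_le _) hle hd).and
        (hsafe (p - prev (prev p)) _ u (by omega) le_rfl hd)
    -- The descendant `x` of pulse `prev p` prevents `a` from ever being `prev p`-empty, so `a` does
    -- register.
    · refine eventually_atTop.2 ⟨N, fun n hn => ?_⟩
      exact (hax.mono hσ hn).not_empty (exec_inv hσ n) (exec_pulse hσ hn hx)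

/-- The source learns that it is `2 ^ t`-safe. -/
theorem eventually_source_safe [Finite V] [Finite κ]
    (hσ : IsFairExecution G (algorithm G s t L) σ) :
    ∀ᶠ n in atTop, ((σ n).state s).KnowsSafe G s (2 ^ t) := by
  refine (exec_progress hσ (2 ^ t) le_rfl).safe s 0 ?_ (Nat.zero_le _) (by simp)
  -- For `p = 2 ^ t` the subtraction in `prev` leaves zero, so the reports for `2 ^ t` are collected
  -- all the way up to the source.
  have h1 : level (2 ^ t) = t := by simpa using level_eq (l := t) (m := 1) rfl
  have h2 := prev_add_le (p := 2 ^ t) (by positivity)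
  have h3 := prev_le (prev (2 ^ t))
  rw [h1] at h2
  omega

/-! ### Progress of the checking stage -/

section Check

variable {d : κ}

theorem eventually_subtreeDone [Finite V] [Finite κ]
    (hσ : IsFairExecution G (algorithm G s t L) σ) (hd : L.level d = t) :
    ∀ v ∈ (L.cluster d).nodes, ∀ᶠ n in atTop, SubtreeDone G s t L v ((σ n).state v) d := by
  refine (L.cluster d).induction_up fun u hu ih => ?_
  have hall : ∀ᶠ n in atTop, ∀ w, (L.cluster d).IsChild u w →
      ((σ n).state u).checkedChild d w = true := by
    rw [eventually_all]
    intro w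
    by_cases hw : (L.cluster d).IsChild u w
    swap
    · exact Eventually.of_forall fun n h => (hw h).elim
    obtain ⟨-, hne, rfl⟩ := id hw
    have hsent : ∀ᶠ n in atTop, ((σ n).state w).checkSent d = true := by
      refine eventually_act hσ (fun n => (exec_check_mono hσ d n).2.1 w) w (.checkUp d) ?_ ?_
      · filter_upwards [ih w hw] with n h1
        rw [or_iff_not_imp_left]
        intro h2
        have h2' : ((σ n).state w).checkSent d = false := by simpa using h2
        simp only [onAct]
        rw [if_pos ⟨h1, hne, h2'⟩]
        simp
      · intro n r h1 h2
        simp only [onAct] at h1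
        rw [Option.ite_none_right_eq_some, Option.some.injEq] at h1
        obtain ⟨_, rfl⟩ := h1
        rw [h2]
        simp [emit]
    suffices ∀ᶠ n in atTop, ((σ n).state ((L.cluster d).parent w)).checkedChild d w = true from
      this.mono fun _ h _ => h
    refine eventually_of_stable (fun n => (exec_check_mono hσ d n).1 _ w) ?_
    obtain ⟨n, hn⟩ := hsent.exists
    rcases (exec_checkInv hσ d n).sent_parent w hn hw.adj.symm with h | h
    · exact ⟨n, h⟩
    · obtain ⟨l, _, rest, _, _, _, h3⟩ := exec_delivered hσ h
      exact ⟨l + 1, by rw [h3]; simp [emit, onReceive]⟩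
  filter_upwards [hall, eventually_source_safe hσ] with n h1 h2
  exact ⟨hd, hu, fun h => h ▸ h2, h1⟩

theorem eventually_confirmed [Finite V] [Finite κ]
    (hσ : IsFairExecution G (algorithm G s t L) σ) (hd : L.level d = t) :
    ∀ v ∈ (L.cluster d).nodes, ∀ᶠ n in atTop, ((σ n).state v).confirmed d = true := by
  refine (L.cluster d).induction_down ?_ fun u w hw ih => ?_
  · refine eventually_act hσ (fun n => (exec_check_mono hσ d n).2.2 (L.cluster d).root)
      (L.cluster d).root (.checkRoot d) ?_ ?_
    · filter_upwards [eventually_subtreeDone hσ hd _ (L.cluster d).root_mem] with n h1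
      rw [or_iff_not_imp_left]
      intro h2
      have h2' : ((σ n).state (L.cluster d).root).confirmed d = false := by simpa using h2
      simp only [onAct]
      simp [h1, h2']
    · intro n r h1 h2
      simp only [onAct] at h1
      rw [Option.ite_none_right_eq_some, Option.some.injEq] at h1
      obtain ⟨_, rfl⟩ := h1
      rw [h2]
      simp [emit, takeConfirmation]
  · refine eventually_of_stable (fun n => (exec_check_mono hσ d n).2.2 _) ?_
    obtain ⟨n, hn⟩ := ih.exists
    rcases (exec_checkInv hσ d n).confirmed_child u w hn hw with h | h
    · exact ⟨n, h⟩
    · obtain ⟨l, _, rest, _, _, _, h3⟩ := exec_delivered hσ h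
      exact ⟨l + 1, by rw [h3]; simp [emit, onReceive, takeConfirmation]⟩

end Check

theorem eventually_output [Finite V] [Finite κ]
    (hσ : IsFairExecution G (algorithm G s t L) σ) (v : V) :
    ∀ᶠ n in atTop, ((σ n).state v).output ≠ none := by
  have hconf : ∀ᶠ n in atTop, ∀ d, L.level d = t → v ∈ (L.cluster d).members →
      ((σ n).state v).confirmed d = true := by
    rw [eventually_all]
    intro d
    by_cases hd : L.level d = t ∧ v ∈ (L.cluster d).members
    · exact (eventually_confirmed hσ hd.1 v ((L.cluster d).members_subset hd.2)).mono
        fun _ h _ _ => h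
    · exact Eventually.of_forall fun n h1 h2 => (hd ⟨h1, h2⟩).elim
  refine eventually_act hσ (fun n => exec_output_mono hσ) v .conclude ?_ ?_
  · filter_upwards [hconf] with n h1
    rw [or_iff_not_imp_left, not_not]
    intro h2
    have h3 : ((σ n).state v).pulse = none := by
      rw [Option.eq_none_iff_forall_ne_some]
      intro k hk
      simp [(exec_output hσ n v).1 k hk] at h2
    simp only [onAct]
    rw [if_pos ⟨h3, h2, h1⟩]
    simp
  · intro n r h1 h2
    simp only [onAct] at h1
    rw [Option.ite_none_right_eq_some, Option.some.injEq] at h1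
    obtain ⟨_, rfl⟩ := h1
    rw [h2]
    simp [emit]

theorem exec_parent_spec (hσ : IsFairExecution G (algorithm G s t L) σ) {n : ℕ} {u v : V}
    (h : ((σ n).state v).parent = some u) : G.Adj v u ∧ G.edist v s = G.edist u s + 1 := by
  obtain ⟨k, h1, h2, _, h3, _⟩ := (exec_inv hσ n).parent_spec h
  refine ⟨h3.symm, ?_⟩
  rw [← exec_correct hσ n u k h1, ← exec_correct hσ n v _ h2]
  push_cast
  rfl

end

end PulseBFS

end

/-! ### The thresholded BFS theorem -/

theorem mainTheorem10 {V κ : Type*} [Finite V] [Finite κ] (G : SimpleGraph V) (s : V) (t : ℕ)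
    (L : PulseBFS.LayeredCover G κ (t + 6))
    (σ : ℕ → AsyncAlgorithm.Config V (PulseBFS.Proc κ) (PulseBFS.Msg κ) (PulseBFS.NodeState V κ))
    (hσ : AsyncAlgorithm.IsFairExecution G (PulseBFS.algorithm G s t L) σ) :
    -- at no time does a node hold a wrong pulse or a wrong output
    (∀ n v,
      (∀ k : ℕ, ((σ n).state v).pulse = some k →
        (k : ℕ∞) = G.edist v s ∧ G.edist v s ≤ ((2 ^ t : ℕ) : ℕ∞)) ∧
      (∀ d : ℕ∞, ((σ n).state v).output = some d →
        d = PulseBFS.thresholdedDist G s (2 ^ t) v)) ∧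
    -- from some time on, all nodes have their pulses, parents and outputs
    (∃ N, ∀ n, N ≤ n → ∀ v,
      ((σ n).state v).output = some (PulseBFS.thresholdedDist G s (2 ^ t) v) ∧
      (G.edist v s ≤ ((2 ^ t : ℕ) : ℕ∞) →
        ∃ k : ℕ, ((σ n).state v).pulse = some k ∧ (k : ℕ∞) = G.edist v s) ∧
      (((2 ^ t : ℕ) : ℕ∞) < G.edist v s →
        ((σ n).state v).pulse = none ∧ ((σ n).state v).output = some ⊤) ∧
      -- the execution tree is a BFS tree
      (G.edist v s ≤ ((2 ^ t : ℕ) : ℕ∞) → v ≠ s →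
        ∃ u, ((σ n).state v).parent = some u ∧ G.Adj v u ∧ G.edist v s = G.edist u s + 1) ∧
      (v = s ∨ ((2 ^ t : ℕ) : ℕ∞) < G.edist v s → ((σ n).state v).parent = none)) := by
  refine ⟨fun n v => ⟨fun k hk => PulseBFS.exec_edist_le hσ hk,
    fun e he => PulseBFS.exec_output_eq hσ he⟩, ?_⟩
  -- As `V` is finite, one time `N` for all nodes follows from a separate time for each node.
  rw [← Filter.eventually_atTop, Filter.eventually_all]
  intro v
  have hpulse : ∀ᶠ n in Filter.atTop, G.edist v s ≤ ((2 ^ t : ℕ) : ℕ∞) →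
      ∃ k : ℕ, ((σ n).state v).pulse = some k ∧ (k : ℕ∞) = G.edist v s := by
    filter_upwards [PulseBFS.eventually_source_safe hσ] with n hn hv
    obtain ⟨k, hk⟩ := Option.ne_none_iff_exists'.1 (PulseBFS.exec_pulse_of_source_safe hσ hn hv)
    exact ⟨k, hk, PulseBFS.exec_correct hσ n v k hk⟩
  filter_upwards [PulseBFS.eventually_output hσ v, hpulse] with n hout hp
  have ho : ((σ n).state v).output = some (PulseBFS.thresholdedDist G s (2 ^ t) v) := by
    obtain ⟨e, he⟩ := Option.ne_none_iff_exists'.1 hout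
    rw [he, PulseBFS.exec_output_eq hσ he]
  refine ⟨ho, hp, fun hv => ⟨?_, ?_⟩, fun hv hs => ?_, fun hv => ?_⟩
  · rw [Option.eq_none_iff_forall_ne_some]
    exact fun k hk => (PulseBFS.exec_edist_le hσ hk).2.not_gt hv
  · rw [ho, PulseBFS.thresholdedDist, if_neg hv.not_ge]
  · obtain ⟨k, hk, _⟩ := hp hv
    obtain ⟨u, hu⟩ := (PulseBFS.exec_inv hσ n).exists_parent (by simp [hk]) hs
    exact ⟨u, hu, PulseBFS.exec_parent_spec hσ hu⟩
  · rw [Option.eq_none_iff_forall_ne_some]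
    intro u hu
    obtain ⟨k, _, hk, _⟩ := (PulseBFS.exec_inv hσ n).parent_spec hu
    rcases hv with rfl | hv
    · have h0 : ((σ n).state v).pulse = some 0 := (PulseBFS.exec_inv hσ n).search.source.1
      simp [h0] at hk
    · exact (PulseBFS.exec_edist_le hσ hk).2.not_gt hv
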